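/- Let $\mathcal{X}$ be a category. Write $\mathrm{ICat}(\mathcal{X})$ for the 2-category whose objects are the $\mathcal{X}$-indexed categories, i.e. pseudofunctors $\mathcal{M}\colon\mathcal{X}^{op}\to\mathrm{Cat}$, whose 1-cells are pseudonatural transformations and whose 2-cells are modifications. It is a cartesian monoidal 2-category: the product $\mathcal{M}\boxtimes\mathcal{N}$ is given pointwise by $(\mathcal{M}\boxtimes\mathcal{N})(x)=\mathcal{M}x\times\mathcal{N}x$, and the unit $\Delta\mathbf{1}$ is the constant pseudofunctor at the terminal category. Let $\mathrm{PsMon}(\mathrm{ICat}(\mathcal{X}))$ be the 2-category of pseudomonoids in $(\mathrm{ICat}(\mathcal{X}),\boxtimes,\Delta\mathbf{1})$. An object is an $\mathcal{X}$-indexed category $\mathcal{M}$ with 1-cells $m\colon\mathcal{M}\boxtimes\mathcal{M}\to\mathcal{M}$ and $u\colon\Delta\mathbf{1}\to\mathcal{M}$ and invertible 2-cells $\alpha\colon m\circ(m\boxtimes 1)\cong m\circ(1\boxtimes m)$ (up to the associativity of $\boxtimes$), $\lambda\colon m\circ(u\boxtimes 1)\cong 1$ and $\rho\colon m\circ(1\boxtimes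 u)\cong 1$ (up to the unit constraints of $\boxtimes$) satisfying the pentagon and triangle axioms. A 1-cell $(\mathcal{M},m,u)\to(\mathcal{N},n,w)$ is a strong morphism, i.e. a 1-cell $f\colon\mathcal{M}\to\mathcal{N}$ with invertible 2-cells $\phi\colon n\circ(f\boxtimes f)\cong f\circ m$ and $\phi_0\colon w\cong f\circ u$ compatible with the $\alpha$'s, $\lambda$'s and $\rho$'s. A 2-cell is a 2-cell $f\Rightarrow g$ of $\mathrm{ICat}(\mathcal{X})$ compatible with the $\phi$'s and $\phi_0$'s. Let $\mathrm{MonCat}$ be the 2-category of monoidal categories, strong monoidal functors and monoidal natural transformations, and let $2\mathrm{Cat}_{ps}(\mathcal{X}^{op},\mathrm{MonCat})$ be the 2-category of pseudofunctors $\mathcal{X}^{op}\to\mathrm{MonCat}$, pseudonatural transformations and modifications. Then $\mathrm{PsMon}(\mathrm{ICat}(\mathcal{X}))$ and $2\mathrm{Cat}_{ps}(\mathcal{X}^{op},\mathrm{MonCat})$ are indeed (strict) 2-categories, and they are 2-equivalent: $$\mathrm{PsMon}(\mathrm{ICat}(\mathcal{X}))\;\simeq\;2\mathrm{Cat}_{ps}(\mathcal{X}^{op},\mathrm{MonCat}),$$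 that is, there are (strict) 2-functors in both directions whose two composites are 2-naturally isomorphic to the identity 2-functors. -/

import Mathlib

open CategoryTheory Bicategory
open scoped Pseudofunctor.StrongTrans

universe w v u v₁ u₁

namespace IndexedMonoidal

/-- A 2-category with chosen finite products in the 2-categorical (`Cat`-enriched) sense: for
binary products, composition with the projections is an isomorphism of categories
`K(c, a × b) ≅ K(c, a) × K(c, b)`, and `K(c, 1)` is the terminal category. -/
class FiniteProducts (K : Type u) [Bicategory.{w, v} K] [Strict K] where
  prod : K → K → K
  fst (a b : K) : prod a b ⟶ a
  snd (a b : K) : prod a b ⟶ b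
  lift {a b c : K} (f : c ⟶ a) (g : c ⟶ b) : c ⟶ prod a b
  lift_fst {a b c : K} (f : c ⟶ a) (g : c ⟶ b) : lift f g ≫ fst a b = f
  lift_snd {a b c : K} (f : c ⟶ a) (g : c ⟶ b) : lift f g ≫ snd a b = g
  lift_eta {a b c : K} (h : c ⟶ prod a b) : lift (h ≫ fst a b) (h ≫ snd a b) = h
  pair {a b c : K} {h k : c ⟶ prod a b} (σ : h ≫ fst a b ⟶ k ≫ fst a b)
    (τ : h ≫ snd a b ⟶ k ≫ snd a b) : h ⟶ k
  pair_fst {a b c : K} {h k : c ⟶ prod a b} (σ : h ≫ fst a b ⟶ k ≫ fst a b)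
    (τ : h ≫ snd a b ⟶ k ≫ snd a b) : pair σ τ ▷ fst a b = σ
  pair_snd {a b c : K} {h k : c ⟶ prod a b} (σ : h ≫ fst a b ⟶ k ≫ fst a b)
    (τ : h ≫ snd a b ⟶ k ≫ snd a b) : pair σ τ ▷ snd a b = τ
  pair_eta {a b c : K} {h k : c ⟶ prod a b} (σ : h ⟶ k) : pair (σ ▷ fst a b) (σ ▷ snd a b) = σ
  one : K
  toOne (c : K) : c ⟶ one
  toOne_eta {c : K} (h : c ⟶ one) : h = toOne c
  toOne_eta₂ {c : K} {h k : c ⟶ one} (σ τ : h ⟶ k) : σ = τ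

namespace FiniteProducts

variable {K : Type u} [Bicategory.{w, v} K] [Strict K] [FiniteProducts K]

section
variable {a b c d : K}

theorem lift_ext {h k : c ⟶ prod a b} (h₁ : h ≫ fst a b = k ≫ fst a b)
    (h₂ : h ≫ snd a b = k ≫ snd a b) : h = k := by
  rw [← lift_eta h, h₁, h₂, lift_eta]

theorem lift_fst_assoc (f : c ⟶ a) (g : c ⟶ b) (h : a ⟶ d) :
    lift f g ≫ fst a b ≫ h = f ≫ h := by
  rw [← Strict.assoc, lift_fst]

theorem lift_snd_assoc (f : c ⟶ a) (g : c ⟶ b) (h : b ⟶ d) :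
    lift f g ≫ snd a b ≫ h = g ≫ h := by
  rw [← Strict.assoc, lift_snd]

theorem comp_lift (h : d ⟶ c) (f : c ⟶ a) (g : c ⟶ b) : h ≫ lift f g = lift (h ≫ f) (h ≫ g) :=
  lift_ext (by rw [Strict.assoc, lift_fst, lift_fst]) (by rw [Strict.assoc, lift_snd, lift_snd])

theorem comp_lift_assoc {e : K} (h : d ⟶ c) (f : c ⟶ a) (g : c ⟶ b) (k : prod a b ⟶ e) :
    h ≫ lift f g ≫ k = lift (h ≫ f) (h ≫ g) ≫ k := by
  rw [← Strict.assoc, comp_lift]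

/-- The product `f × g` of 1-cells. -/
def prodMap {a' b' : K} (f : a ⟶ a') (g : b ⟶ b') : prod a b ⟶ prod a' b' :=
  lift (fst a b ≫ f) (snd a b ≫ g)

/-- The product `σ × τ` of 2-cells. -/
def prodMap₂ {a' b' : K} {f f' : a ⟶ a'} {g g' : b ⟶ b'} (σ : f ⟶ f') (τ : g ⟶ g') :
    prodMap f g ⟶ prodMap f' g' :=
  pair (eqToHom (lift_fst _ _) ≫ fst a b ◁ σ ≫ eqToHom (lift_fst _ _).symm)
    (eqToHom (lift_snd _ _) ≫ snd a b ◁ τ ≫ eqToHom (lift_snd _ _).symm)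

variable (a b c) in
/-- The associativity constraint `(a × b) × c ⟶ a × (b × c)`. -/
def prodAssoc : prod (prod a b) c ⟶ prod a (prod b c) :=
  lift (fst _ _ ≫ fst _ _) (lift (fst _ _ ≫ snd _ _) (snd _ _))

theorem lift_prodMap {a' b' : K} (f : c ⟶ a) (g : c ⟶ b) (f' : a ⟶ a') (g' : b ⟶ b') :
    lift f g ≫ prodMap f' g' = lift (f ≫ f') (g ≫ g') := by
  rw [prodMap, comp_lift, lift_fst_assoc, lift_snd_assoc]

theorem prodMap_comp {a' b' a'' b'' : K} (f : a ⟶ a') (g : b ⟶ b') (f' : a' ⟶ a'')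
    (g' : b' ⟶ b'') : prodMap f g ≫ prodMap f' g' = prodMap (f ≫ f') (g ≫ g') := by
  rw [prodMap, lift_prodMap, Strict.assoc, Strict.assoc, prodMap]

theorem prodMap_id (a b : K) : prodMap (𝟙 a) (𝟙 b) = 𝟙 (prod a b) := by
  rw [prodMap, Strict.comp_id, Strict.comp_id]
  simpa only [Strict.id_comp] using lift_eta (𝟙 (prod a b))

end

end FiniteProducts

open FiniteProducts

section Axioms

variable {K : Type u} [Bicategory.{w, v} K] [Strict K] [FiniteProducts K]

attribute [local simp] Strict.assoc Strict.id_comp Strict.comp_id prodMap prodAssoc lift_fst lift_snd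
  lift_fst_assoc lift_snd_assoc comp_lift comp_lift_assoc

/-- The pentagon axiom: the two pastings of associators from `((m × 1) × 1) ≫ (m × 1) ≫ m` to
`assoc ≫ assoc ≫ (1 × (1 × m)) ≫ (1 × m) ≫ m` agree. The equations between composites of structural
1-cells that hold in the cartesian 2-category enter as `eqToHom`s, here and below. -/
def Pentagon {a : K} {m : prod a a ⟶ a}
    (α : prodMap m (𝟙 a) ≫ m ⟶ prodAssoc a a a ≫ prodMap (𝟙 a) m ≫ m) : Prop :=
  prodMap₂ α (𝟙 (𝟙 a)) ▷ m ≫ eqToHom (by simp) ≫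
      prodMap (prodAssoc a a a) (𝟙 a) ◁ prodMap (prodMap (𝟙 a) m) (𝟙 a) ◁ α ≫ eqToHom (by simp) ≫
      prodMap (prodAssoc a a a) (𝟙 a) ◁ prodAssoc a (prod a a) a ◁ prodMap₂ (𝟙 (𝟙 a)) α ▷ m =
    eqToHom (by simp) ≫
      prodMap (prodMap m (𝟙 a)) (𝟙 a) ◁ α ≫ eqToHom (by simp) ≫
      prodAssoc (prod a a) a a ◁ prodMap (𝟙 (prod a a)) m ◁ α ≫ eqToHom (by simp)

/-- The triangle axiom: the two pastings from `((1 × u) × 1) ≫ (m × 1) ≫ m` to the multiplication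
(with the unit object deleted) agree. -/
def Triangle {a : K} {m : prod a a ⟶ a} {u : one ⟶ a}
    (α : prodMap m (𝟙 a) ≫ m ⟶ prodAssoc a a a ≫ prodMap (𝟙 a) m ≫ m)
    (l : prodMap u (𝟙 a) ≫ m ⟶ snd one a) (r : prodMap (𝟙 a) u ≫ m ⟶ fst a one) : Prop :=
  prodMap₂ r (𝟙 (𝟙 a)) ▷ m =
    eqToHom (by simp) ≫
      prodMap (prodMap (𝟙 a) u) (𝟙 a) ◁ α ≫ eqToHom (by simp) ≫
      prodAssoc a one a ◁ prodMap₂ (𝟙 (𝟙 a)) l ▷ m ≫ eqToHom (by simp)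

/-- The compatibility of the 2-cell `φ` with associators. -/
def AssocCompat {a b : K} {m : prod a a ⟶ a} {n : prod b b ⟶ b} {f : a ⟶ b}
    (α : prodMap m (𝟙 a) ≫ m ⟶ prodAssoc a a a ≫ prodMap (𝟙 a) m ≫ m)
    (β : prodMap n (𝟙 b) ≫ n ⟶ prodAssoc b b b ≫ prodMap (𝟙 b) n ≫ n)
    (φ : prodMap f f ≫ n ⟶ m ≫ f) : Prop :=
  prodMap₂ φ (𝟙 f) ▷ n ≫ eqToHom (by simp) ≫
      prodMap m (𝟙 a) ◁ φ ≫ eqToHom (by simp) ≫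
      α ▷ f =
    eqToHom (by simp) ≫
      prodMap (prodMap f f) f ◁ β ≫ eqToHom (by simp) ≫
      prodAssoc a a a ◁ prodMap₂ (𝟙 f) φ ▷ n ≫ eqToHom (by simp) ≫
      prodAssoc a a a ◁ prodMap (𝟙 a) m ◁ φ ≫ eqToHom (by simp)

/-- The compatibility of the 2-cells `φ` and `φ₀` with left unit constraints. -/
def LeftUnitCompat {a b : K} {m : prod a a ⟶ a} {n : prod b b ⟶ b} {u : one ⟶ a} {w : one ⟶ b}
    {f : a ⟶ b} (l : prodMap u (𝟙 a) ≫ m ⟶ snd one a) (l' : prodMap w (𝟙 b) ≫ n ⟶ snd one b)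
    (φ : prodMap f f ≫ n ⟶ m ≫ f) (φ₀ : w ⟶ u ≫ f) : Prop :=
  prodMap₂ φ₀ (𝟙 f) ▷ n ≫ eqToHom (by simp) ≫
      prodMap u (𝟙 a) ◁ φ ≫ eqToHom (by simp) ≫
      l ▷ f =
    eqToHom (by simp) ≫ prodMap (𝟙 one) f ◁ l' ≫ eqToHom (by simp)

/-- The compatibility of the 2-cells `φ` and `φ₀` with right unit constraints. -/
def RightUnitCompat {a b : K} {m : prod a a ⟶ a} {n : prod b b ⟶ b} {u : one ⟶ a} {w : one ⟶ b}
    {f : a ⟶ b} (r : prodMap (𝟙 a) u ≫ m ⟶ fst a one) (r' : prodMap (𝟙 b) w ≫ n ⟶ fst b one)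
    (φ : prodMap f f ≫ n ⟶ m ≫ f) (φ₀ : w ⟶ u ≫ f) : Prop :=
  prodMap₂ (𝟙 f) φ₀ ▷ n ≫ eqToHom (by simp) ≫
      prodMap (𝟙 a) u ◁ φ ≫ eqToHom (by simp) ≫
      r ▷ f =
    eqToHom (by simp) ≫ prodMap f (𝟙 one) ◁ r' ≫ eqToHom (by simp)

end Axioms

/-- A pseudomonoid in a 2-category with finite products, with respect to the cartesian monoidal
structure. -/
structure Pseudomonoid (K : Type u) [Bicategory.{w, v} K] [Strict K] [FiniteProducts K] where
  pt : K
  mul : prod pt pt ⟶ pt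
  unit : one ⟶ pt
  assoc : prodMap mul (𝟙 pt) ≫ mul ≅ prodAssoc pt pt pt ≫ prodMap (𝟙 pt) mul ≫ mul
  leftUnit : prodMap unit (𝟙 pt) ≫ mul ≅ snd one pt
  rightUnit : prodMap (𝟙 pt) unit ≫ mul ≅ fst pt one
  pentagon : Pentagon assoc.hom
  triangle : Triangle assoc.hom leftUnit.hom rightUnit.hom

namespace Pseudomonoid

variable {K : Type u} [Bicategory.{w, v} K] [Strict K] [FiniteProducts K]

/-- A (strong) morphism of pseudomonoids. -/
structure Hom (A B : Pseudomonoid K) where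
  hom : A.pt ⟶ B.pt
  mulIso : prodMap hom hom ≫ B.mul ≅ A.mul ≫ hom
  unitIso : B.unit ≅ A.unit ≫ hom
  assoc_compat : AssocCompat A.assoc.hom B.assoc.hom mulIso.hom
  leftUnit_compat : LeftUnitCompat A.leftUnit.hom B.leftUnit.hom mulIso.hom unitIso.hom
  rightUnit_compat : RightUnitCompat A.rightUnit.hom B.rightUnit.hom mulIso.hom unitIso.hom

/-- A 2-cell between morphisms of pseudomonoids. -/
@[ext]
structure Hom₂ {A B : Pseudomonoid K} (f g : Hom A B) where
  cell : f.hom ⟶ g.hom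
  mul_compat : prodMap₂ cell cell ▷ B.mul ≫ g.mulIso.hom = f.mulIso.hom ≫ A.mul ◁ cell
  unit_compat : f.unitIso.hom ≫ A.unit ◁ cell = g.unitIso.hom

/-- The multiplicativity constraint of an identity morphism. -/
def idMulIso (A : Pseudomonoid K) : prodMap (𝟙 A.pt) (𝟙 A.pt) ≫ A.mul ≅ A.mul ≫ 𝟙 A.pt :=
  eqToIso (by rw [prodMap_id, Strict.id_comp, Strict.comp_id])

/-- The unit constraint of an identity morphism. -/
def idUnitIso (A : Pseudomonoid K) : A.unit ≅ A.unit ≫ 𝟙 A.pt :=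
  eqToIso (Strict.comp_id _).symm

/-- The multiplicativity constraint of a composite morphism. -/
def compMulIso {A B C : Pseudomonoid K} (f : Hom A B) (g : Hom B C) :
    prodMap (f.hom ≫ g.hom) (f.hom ≫ g.hom) ≫ C.mul ≅ A.mul ≫ f.hom ≫ g.hom :=
  eqToIso (by rw [← prodMap_comp, Strict.assoc]) ≪≫
    whiskerLeftIso (prodMap f.hom f.hom) g.mulIso ≪≫ eqToIso (Strict.assoc _ _ _).symm ≪≫
    whiskerRightIso f.mulIso g.hom ≪≫ eqToIso (Strict.assoc _ _ _)

/-- The unit constraint of a composite morphism. -/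
def compUnitIso {A B C : Pseudomonoid K} (f : Hom A B) (g : Hom B C) :
    C.unit ≅ A.unit ≫ f.hom ≫ g.hom :=
  g.unitIso ≪≫ whiskerRightIso f.unitIso g.hom ≪≫ eqToIso (Strict.assoc _ _ _)

theorem compMulIso_hom {A B C : Pseudomonoid K} (f : Hom A B) (g : Hom B C) :
    (compMulIso f g).hom = eqToHom (by rw [← prodMap_comp, Strict.assoc]) ≫
      prodMap f.hom f.hom ◁ g.mulIso.hom ≫ eqToHom (Strict.assoc _ _ _).symm ≫
      f.mulIso.hom ▷ g.hom ≫ eqToHom (Strict.assoc _ _ _) := rfl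

theorem compUnitIso_hom {A B C : Pseudomonoid K} (f : Hom A B) (g : Hom B C) :
    (compUnitIso f g).hom = g.unitIso.hom ≫ f.unitIso.hom ▷ g.hom ≫
      eqToHom (Strict.assoc _ _ _) := rfl

end Pseudomonoid

section IndexedCategories

open Pseudofunctor.StrongTrans

theorem catHom₂_ext {C D : Cat.{v, u}} {F G : C ⟶ D} {σ τ : F ⟶ G}
    (h : ∀ a : C, σ.toNatTrans.app a = τ.toNatTrans.app a) : σ = τ :=
  Cat.Hom₂.ext (NatTrans.ext (funext h))

theorem catHom₂_congr {C D : Cat.{v, u}} {F G : C ⟶ D} {σ τ : F ⟶ G} (h : σ = τ) (a : C) :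
    σ.toNatTrans.app a = τ.toNatTrans.app a := by rw [h]

variable {B : Type u₁} [Bicategory.{w, v₁} B]

/-- The pointwise product `x ↦ M x × N x` of two `Cat`-valued pseudofunctors. -/
def prodPseudo (M N : Pseudofunctor B Cat.{v, u}) : Pseudofunctor B Cat.{v, u} where
  obj x := Cat.of (M.obj x × N.obj x)
  map f := ((M.map f).toFunctor.prod (N.map f).toFunctor).toCatHom
  map₂ θ := (NatTrans.prod (M.map₂ θ).toNatTrans (N.map₂ θ).toNatTrans).toCatHom₂
  mapId x :=
    { hom := (NatTrans.prod (M.mapId x).hom.toNatTrans (N.mapId x).hom.toNatTrans).toCatHom₂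
      inv := (NatTrans.prod (M.mapId x).inv.toNatTrans (N.mapId x).inv.toNatTrans).toCatHom₂
      hom_inv_id := catHom₂_ext fun a => Prod.ext
        (catHom₂_congr (M.mapId x).hom_inv_id a.1) (catHom₂_congr (N.mapId x).hom_inv_id a.2)
      inv_hom_id := catHom₂_ext fun a => Prod.ext
        (catHom₂_congr (M.mapId x).inv_hom_id a.1) (catHom₂_congr (N.mapId x).inv_hom_id a.2) }
  mapComp f g :=
    { hom := (NatTrans.prod (M.mapComp f g).hom.toNatTrans
        (N.mapComp f g).hom.toNatTrans).toCatHom₂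
      inv := (NatTrans.prod (M.mapComp f g).inv.toNatTrans
        (N.mapComp f g).inv.toNatTrans).toCatHom₂
      hom_inv_id := catHom₂_ext fun a => Prod.ext
        (catHom₂_congr (M.mapComp f g).hom_inv_id a.1)
        (catHom₂_congr (N.mapComp f g).hom_inv_id a.2)
      inv_hom_id := catHom₂_ext fun a => Prod.ext
        (catHom₂_congr (M.mapComp f g).inv_hom_id a.1)
        (catHom₂_congr (N.mapComp f g).inv_hom_id a.2) }
  map₂_id f := catHom₂_ext fun a => Prod.ext
    (catHom₂_congr (M.map₂_id f) a.1) (catHom₂_congr (N.map₂_id f) a.2)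
  map₂_comp f g := catHom₂_ext fun a => Prod.ext
    (catHom₂_congr (M.map₂_comp f g) a.1) (catHom₂_congr (N.map₂_comp f g) a.2)
  map₂_whisker_left f _ _ η := catHom₂_ext fun a => Prod.ext
    (catHom₂_congr (M.map₂_whisker_left f η) a.1) (catHom₂_congr (N.map₂_whisker_left f η) a.2)
  map₂_whisker_right η f := catHom₂_ext fun a => Prod.ext
    (catHom₂_congr (M.map₂_whisker_right η f) a.1) (catHom₂_congr (N.map₂_whisker_right η f) a.2)
  map₂_associator f g h := catHom₂_ext fun a => Prod.ext
    (catHom₂_congr (M.map₂_associator f g h) a.1) (catHom₂_congr (N.map₂_associator f g h) a.2)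
  map₂_left_unitor f := catHom₂_ext fun a => Prod.ext
    (catHom₂_congr (M.map₂_left_unitor f) a.1) (catHom₂_congr (N.map₂_left_unitor f) a.2)
  map₂_right_unitor f := catHom₂_ext fun a => Prod.ext
    (catHom₂_congr (M.map₂_right_unitor f) a.1) (catHom₂_congr (N.map₂_right_unitor f) a.2)

/-- The terminal category, with one object and one morphism. -/
def terminalCat : Cat.{v, u} :=
  letI : Category.{v} PUnit.{u + 1} :=
    { Hom _ _ := PUnit
      id _ := ⟨⟩
      comp _ _ := ⟨⟩ }
  Cat.of PUnit.{u + 1}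

/-- The functor from a category to the terminal category. -/
def toTerminal (C : Cat.{v, u}) : C ⟶ terminalCat.{v, u} :=
  ⟨{ obj _ := PUnit.unit, map _ := PUnit.unit }⟩

/-- The constant pseudofunctor at the terminal category. -/
def onePseudo : Pseudofunctor B Cat.{v, u} where
  obj _ := terminalCat
  map _ := 𝟙 _
  map₂ _ := 𝟙 _
  mapId _ := Iso.refl _
  mapComp _ _ := (λ_ _).symm

theorem comp_naturality_app {F G H : Pseudofunctor B Cat.{v, u}} (η : F ⟶ G) (θ : G ⟶ H)
    {x y : B} (f : x ⟶ y) (a : F.obj x) :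
    ((η ≫ θ).naturality f).hom.toNatTrans.app a =
      (θ.app y).toFunctor.map ((η.naturality f).hom.toNatTrans.app a) ≫
        (θ.naturality f).hom.toNatTrans.app ((η.app x).toFunctor.obj a) := by
  change 𝟙 _ ≫ (θ.app y).toFunctor.map ((η.naturality f).hom.toNatTrans.app a) ≫ 𝟙 _ ≫
    (θ.naturality f).hom.toNatTrans.app ((η.app x).toFunctor.obj a) ≫ 𝟙 _ = _
  simp

/-- The first projection of a pointwise product. -/
def fstTrans (M N : Pseudofunctor B Cat.{v, u}) : prodPseudo M N ⟶ M where
  app x := (CategoryTheory.Prod.fst (M.obj x) (N.obj x)).toCatHom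
  naturality f := Cat.Hom.isoMk (Iso.refl (CategoryTheory.Prod.fst _ _ ⋙ (M.map f).toFunctor))
  naturality_naturality η := catHom₂_ext fun a =>
    (Category.comp_id _).trans (Category.id_comp _).symm
  naturality_id x := catHom₂_ext fun a => by
    change 𝟙 _ ≫ (M.mapId x).hom.toNatTrans.app a.1 =
      (M.mapId x).hom.toNatTrans.app a.1 ≫ 𝟙 _ ≫ 𝟙 _
    simp
  naturality_comp f g := catHom₂_ext fun a => by
    change 𝟙 _ ≫ (M.mapComp f g).hom.toNatTrans.app a.1 =
      (M.mapComp f g).hom.toNatTrans.app a.1 ≫ 𝟙 _ ≫ 𝟙 _ ≫ 𝟙 _ ≫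
        (M.map g).toFunctor.map (𝟙 _) ≫ 𝟙 _
    simp

/-- The second projection of a pointwise product. -/
def sndTrans (M N : Pseudofunctor B Cat.{v, u}) : prodPseudo M N ⟶ N where
  app x := (CategoryTheory.Prod.snd (M.obj x) (N.obj x)).toCatHom
  naturality f := Cat.Hom.isoMk (Iso.refl (CategoryTheory.Prod.snd _ _ ⋙ (N.map f).toFunctor))
  naturality_naturality η := catHom₂_ext fun a =>
    (Category.comp_id _).trans (Category.id_comp _).symm
  naturality_id x := catHom₂_ext fun a => by
    change 𝟙 _ ≫ (N.mapId x).hom.toNatTrans.app a.2 =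
      (N.mapId x).hom.toNatTrans.app a.2 ≫ 𝟙 _ ≫ 𝟙 _
    simp
  naturality_comp f g := catHom₂_ext fun a => by
    change 𝟙 _ ≫ (N.mapComp f g).hom.toNatTrans.app a.2 =
      (N.mapComp f g).hom.toNatTrans.app a.2 ≫ 𝟙 _ ≫ 𝟙 _ ≫ 𝟙 _ ≫
        (N.map g).toFunctor.map (𝟙 _) ≫ 𝟙 _
    simp

/-- The pairing of two pseudonatural transformations. -/
def liftTrans {M N L : Pseudofunctor B Cat.{v, u}} (η : L ⟶ M) (θ : L ⟶ N) :
    L ⟶ prodPseudo M N where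
  app x := ((η.app x).toFunctor.prod' (θ.app x).toFunctor).toCatHom
  naturality f :=
    { hom := (NatTrans.prod' (η.naturality f).hom.toNatTrans
        (θ.naturality f).hom.toNatTrans).toCatHom₂
      inv := (NatTrans.prod' (η.naturality f).inv.toNatTrans
        (θ.naturality f).inv.toNatTrans).toCatHom₂
      hom_inv_id := catHom₂_ext fun a => Prod.ext
        (catHom₂_congr (η.naturality f).hom_inv_id a) (catHom₂_congr (θ.naturality f).hom_inv_id a)
      inv_hom_id := catHom₂_ext fun a => Prod.ext
        (catHom₂_congr (η.naturality f).inv_hom_id a)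
        (catHom₂_congr (θ.naturality f).inv_hom_id a) }
  naturality_naturality σ := catHom₂_ext fun a => Prod.ext
    (catHom₂_congr (η.naturality_naturality σ) a) (catHom₂_congr (θ.naturality_naturality σ) a)
  naturality_id x := catHom₂_ext fun a => Prod.ext
    (catHom₂_congr (η.naturality_id x) a) (catHom₂_congr (θ.naturality_id x) a)
  naturality_comp f g := catHom₂_ext fun a => Prod.ext
    (catHom₂_congr (η.naturality_comp f g) a) (catHom₂_congr (θ.naturality_comp f g) a)

theorem modification_app {F G : Pseudofunctor B Cat.{v, u}} {η θ : F ⟶ G} (σ : η ⟶ θ)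
    {x y : B} (f : x ⟶ y) (a : F.obj x) :
    (σ.as.app y).toNatTrans.app ((F.map f).toFunctor.obj a) ≫
        (θ.naturality f).hom.toNatTrans.app a =
      (η.naturality f).hom.toNatTrans.app a ≫
        (G.map f).toFunctor.map ((σ.as.app x).toNatTrans.app a) :=
  catHom₂_congr (σ.as.naturality f) a

/-- The pairing of two modifications. -/
def pairMod {M N L : Pseudofunctor B Cat.{v, u}} {h k : L ⟶ prodPseudo M N}
    (σ : h ≫ fstTrans M N ⟶ k ≫ fstTrans M N) (τ : h ≫ sndTrans M N ⟶ k ≫ sndTrans M N) :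
    h ⟶ k where
  as :=
    { app x :=
        { toNatTrans :=
          { app a := ((σ.as.app x).toNatTrans.app a, (τ.as.app x).toNatTrans.app a)
            naturality a b f := Prod.ext ((σ.as.app x).toNatTrans.naturality f)
              ((τ.as.app x).toNatTrans.naturality f) } }
      naturality {x y} f := catHom₂_ext fun a => Prod.ext
        (by
          have e := modification_app σ f a
          rw [comp_naturality_app, comp_naturality_app] at e
          exact ((congrArg (_ ≫ ·) (Category.comp_id _)).symm.trans e).trans
            (congrArg (· ≫ _) (Category.comp_id _)))
        (by
          have e := modification_app τ f a
          rw [comp_naturality_app, comp_naturality_app] at e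
          exact ((congrArg (_ ≫ ·) (Category.comp_id _)).symm.trans e).trans
            (congrArg (· ≫ _) (Category.comp_id _))) }

/-- The transformation to the constant pseudofunctor at the terminal category. -/
def toOneTrans (M : Pseudofunctor B Cat.{v, u}) : M ⟶ onePseudo where
  app x := toTerminal _
  naturality f := Iso.refl (toTerminal _)

theorem trans_ext {F G : Pseudofunctor B Cat.{v, u}} {η θ : F ⟶ G} (h : ∀ x, η.app x = θ.app x)
    (h' : ∀ {x y : B} (f : x ⟶ y) (a : F.obj x), (η.naturality f).hom.toNatTrans.app a ≍
      (θ.naturality f).hom.toNatTrans.app a) : η = θ := by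
  obtain ⟨η, nη, _, _, _⟩ := η
  obtain ⟨θ, nθ, _, _, _⟩ := θ
  obtain rfl : η = θ := funext h
  congr 1
  funext x y f
  exact Iso.ext (catHom₂_ext fun a => eq_of_heq (h' f a))

theorem id_naturality_app (F : Pseudofunctor B Cat.{v, u}) {x y : B} (f : x ⟶ y) (a : F.obj x) :
    ((𝟙 F : F ⟶ F).naturality f).hom.toNatTrans.app a = 𝟙 ((F.map f).toFunctor.obj a) :=
  Category.id_comp _

theorem eqToIso_app {F G : Pseudofunctor B Cat.{v, u}} {η θ : F ⟶ G} (h : η = θ) (x : B)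
    (a : F.obj x) : ((eqToIso h).hom.as.app x).toNatTrans.app a = eqToHom (by rw [h]) := by
  subst h; rfl

/-- Pseudofunctors to `Cat`, pseudonatural transformations and modifications form a 2-category. -/
instance : Strict (Pseudofunctor B Cat.{v, u}) where
  id_comp f := trans_ext (fun _ => rfl) fun h a => heq_of_eq <| by
    rw [comp_naturality_app, id_naturality_app]
    exact (congrArg (· ≫ _) ((f.app _).toFunctor.map_id _)).trans (Category.id_comp _)
  comp_id f := trans_ext (fun _ => rfl) fun h a => heq_of_eq <| by
    rw [comp_naturality_app, id_naturality_app]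
    exact Category.comp_id _
  assoc f g h := trans_ext (fun _ => rfl) fun k a => heq_of_eq <| by
    simp only [comp_naturality_app]
    exact (congrArg (· ≫ _) ((h.app _).toFunctor.map_comp _ _)).trans (Category.assoc _ _ _)
  leftUnitor_eqToIso f := Iso.ext (homCategory.ext fun x => catHom₂_ext fun a =>
    by rw [eqToIso_app]; rfl)
  rightUnitor_eqToIso f := Iso.ext (homCategory.ext fun x => catHom₂_ext fun a =>
    by rw [eqToIso_app]; rfl)
  associator_eqToIso f g h := Iso.ext (homCategory.ext fun x => catHom₂_ext fun a =>
    by rw [eqToIso_app]; rfl)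

/-- The cartesian structure on the 2-category of pseudofunctors to `Cat`: pointwise products, and the
constant pseudofunctor at the terminal category. -/
instance : FiniteProducts (Pseudofunctor B Cat.{v, u}) where
  prod := prodPseudo
  fst := fstTrans
  snd := sndTrans
  lift := liftTrans
  lift_fst f g := trans_ext (fun _ => rfl) fun h a => heq_of_eq <| by
    rw [comp_naturality_app]
    exact Category.comp_id _
  lift_snd f g := trans_ext (fun _ => rfl) fun h a => heq_of_eq <| by
    rw [comp_naturality_app]
    exact Category.comp_id _
  lift_eta k := trans_ext (fun _ => rfl) fun h a => heq_of_eq <| Prod.ext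
    ((comp_naturality_app _ _ _ _).trans (Category.comp_id _))
    ((comp_naturality_app _ _ _ _).trans (Category.comp_id _))
  pair := pairMod
  pair_fst _ _ := rfl
  pair_snd _ _ := rfl
  pair_eta _ := rfl
  one := onePseudo
  toOne := toOneTrans
  toOne_eta _ := trans_ext (fun _ => rfl) fun _ _ => heq_of_eq rfl
  toOne_eta₂ _ _ := homCategory.ext fun _ => catHom₂_ext fun _ => rfl

end IndexedCategories

section Components

variable {B : Type u₁} [Bicategory.{w, v₁} B]

/-- The components of a modification. -/
def cmp {F G : Pseudofunctor B Cat.{v, u}} {η θ : F ⟶ G} (σ : η ⟶ θ) (x : B) (a : F.obj x) :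
    (η.app x).toFunctor.obj a ⟶ (θ.app x).toFunctor.obj a :=
  (σ.as.app x).toNatTrans.app a

section
variable {F G : Pseudofunctor B Cat.{v, u}} {η θ κ : F ⟶ G}

theorem cmp_ext {σ τ : η ⟶ θ} (h : ∀ x a, cmp σ x a = cmp τ x a) : σ = τ :=
  Pseudofunctor.StrongTrans.homCategory.ext fun x => catHom₂_ext (h x)

theorem cmp_eq_iff {σ τ : η ⟶ θ}
    {p q : ∀ (x : B) (a : F.obj x), (η.app x).toFunctor.obj a ⟶ (θ.app x).toFunctor.obj a}
    (hp : ∀ x a, cmp σ x a = p x a) (hq : ∀ x a, cmp τ x a = q x a) :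
    σ = τ ↔ ∀ x a, p x a = q x a :=
  ⟨fun h x a => by rw [← hp, ← hq, h], fun h => cmp_ext fun x a => by rw [hp, hq, h]⟩

theorem cmp_comp {σ : η ⟶ θ} {τ : θ ⟶ κ} {x : B} {a : F.obj x}
    {p : (η.app x).toFunctor.obj a ⟶ (θ.app x).toFunctor.obj a}
    {q : (θ.app x).toFunctor.obj a ⟶ (κ.app x).toFunctor.obj a}
    (hp : cmp σ x a = p) (hq : cmp τ x a = q) : cmp (σ ≫ τ) x a = p ≫ q := by
  subst hp hq; rfl

theorem cmp_eqToHom_comp (h : η = θ) {σ : θ ⟶ κ} {x : B} {a : F.obj x}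
    {p : (η.app x).toFunctor.obj a ⟶ (κ.app x).toFunctor.obj a}
    (hp : cmp σ x a ≍ p) : cmp (eqToHom h ≫ σ) x a = p := by
  subst h
  obtain rfl := eq_of_heq hp
  rw [eqToHom_refl, Category.id_comp]

theorem cmp_eqToIso (h : η = θ) {x : B} {a : F.obj x}
    {p : (η.app x).toFunctor.obj a ⟶ (θ.app x).toFunctor.obj a}
    (hp : 𝟙 ((η.app x).toFunctor.obj a) ≍ p) : cmp (eqToIso h).hom x a = p := by
  subst h
  exact eq_of_heq hp

theorem cmp_comp_eqToHom (h : θ = κ) {σ : η ⟶ θ} {x : B} {a : F.obj x}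
    {p : (η.app x).toFunctor.obj a ⟶ (κ.app x).toFunctor.obj a}
    (hp : cmp σ x a ≍ p) : cmp (σ ≫ eqToHom h) x a = p := by
  subst h
  obtain rfl := eq_of_heq hp
  rw [eqToHom_refl, Category.comp_id]

end

theorem cmp_whiskerLeft {F G H : Pseudofunctor B Cat.{v, u}} (η : F ⟶ G) {θ κ : G ⟶ H}
    (σ : θ ⟶ κ) (x : B) (a : F.obj x) :
    cmp (η ◁ σ) x a = cmp σ x ((η.app x).toFunctor.obj a) := rfl

theorem cmp_whiskerRight {F G H : Pseudofunctor B Cat.{v, u}} {η θ : F ⟶ G} (σ : η ⟶ θ)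
    (κ : G ⟶ H) {x : B} {a : F.obj x} {p : (η.app x).toFunctor.obj a ⟶ (θ.app x).toFunctor.obj a}
    (hp : cmp σ x a = p) : cmp (σ ▷ κ) x a = (κ.app x).toFunctor.map p := by
  subst hp; rfl

theorem cmp_fst {L M N : Pseudofunctor B Cat.{v, u}} {h k : L ⟶ prod M N} (σ : h ⟶ k) (x : B)
    (a : L.obj x) : (cmp σ x a).1 = cmp (σ ▷ fst M N) x a := rfl

theorem cmp_snd {L M N : Pseudofunctor B Cat.{v, u}} {h k : L ⟶ prod M N} (σ : h ⟶ k) (x : B)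
    (a : L.obj x) : (cmp σ x a).2 = cmp (σ ▷ snd M N) x a := rfl

theorem cmp_prodMap₂ {M N M' N' : Pseudofunctor B Cat.{v, u}} {f f' : M ⟶ M'} {g g' : N ⟶ N'}
    (σ : f ⟶ f') (τ : g ⟶ g') (x : B) (a : (prod M N).obj x) :
    cmp (prodMap₂ σ τ) x a = Prod.mkHom (cmp σ x a.1) (cmp τ x a.2) :=
  Prod.ext
    ((cmp_fst _ x a).trans ((congrArg (cmp · x a) (pair_fst _ _)).trans (cmp_eqToHom_comp _
      (heq_of_eq (cmp_comp_eqToHom (lift_fst _ _).symm (HEq.refl _))))))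
    ((cmp_snd _ x a).trans ((congrArg (cmp · x a) (pair_snd _ _)).trans (cmp_eqToHom_comp _
      (heq_of_eq (cmp_comp_eqToHom (lift_snd _ _).symm (HEq.refl _))))))

end Components

section Plain
section
variable {T : Type*} {C : Type*} {D : Type*} {E : Type*} [Category T] [Category C] [Category D]
  [Category E]

/-- The compatibility of a tensorator with associators, in terms of components. -/
def AssocEq (m : C × C ⥤ C) (n : D × D ⥤ D) (f : C ⥤ D)
    (α : ∀ p : (C × C) × C, m.obj (m.obj p.1, p.2) ⟶ m.obj (p.1.1, m.obj (p.1.2, p.2)))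
    (β : ∀ p : (D × D) × D, n.obj (n.obj p.1, p.2) ⟶ n.obj (p.1.1, n.obj (p.1.2, p.2)))
    (φ : ∀ p : C × C, n.obj (f.obj p.1, f.obj p.2) ⟶ f.obj (m.obj p)) : Prop :=
  ∀ p : (C × C) × C,
    n.map (Prod.mkHom (φ p.1) (𝟙 (f.obj p.2))) ≫ φ (m.obj p.1, p.2) ≫ f.map (α p) =
      β ((f.obj p.1.1, f.obj p.1.2), f.obj p.2) ≫
        n.map (Prod.mkHom (𝟙 (f.obj p.1.1)) (φ (p.1.2, p.2))) ≫ φ (p.1.1, m.obj (p.1.2, p.2))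

/-- The compatibility of a tensorator with left unitors, in terms of components. -/
def LeftUnitEq (m : C × C ⥤ C) (n : D × D ⥤ D) (u : T ⥤ C) (w : T ⥤ D) (f : C ⥤ D)
    (l : ∀ p : T × C, m.obj (u.obj p.1, p.2) ⟶ p.2) (l' : ∀ p : T × D, n.obj (w.obj p.1, p.2) ⟶ p.2)
    (φ : ∀ p : C × C, n.obj (f.obj p.1, f.obj p.2) ⟶ f.obj (m.obj p))
    (φ₀ : ∀ t : T, w.obj t ⟶ f.obj (u.obj t)) : Prop :=
  ∀ p : T × C, n.map (Prod.mkHom (φ₀ p.1) (𝟙 (f.obj p.2))) ≫ φ (u.obj p.1, p.2) ≫ f.map (l p) =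
    l' (p.1, f.obj p.2)

/-- The compatibility of a tensorator with right unitors, in terms of components. -/
def RightUnitEq (m : C × C ⥤ C) (n : D × D ⥤ D) (u : T ⥤ C) (w : T ⥤ D) (f : C ⥤ D)
    (r : ∀ p : C × T, m.obj (p.1, u.obj p.2) ⟶ p.1) (r' : ∀ p : D × T, n.obj (p.1, w.obj p.2) ⟶ p.1)
    (φ : ∀ p : C × C, n.obj (f.obj p.1, f.obj p.2) ⟶ f.obj (m.obj p))
    (φ₀ : ∀ t : T, w.obj t ⟶ f.obj (u.obj t)) : Prop :=
  ∀ p : C × T, n.map (Prod.mkHom (𝟙 (f.obj p.1)) (φ₀ p.2)) ≫ φ (p.1, u.obj p.2) ≫ f.map (r p) =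
    r' (f.obj p.1, p.2)

variable {m : C × C ⥤ C} {n : D × D ⥤ D} {k : E × E ⥤ E} {f : C ⥤ D} {g : D ⥤ E}
  {u : T ⥤ C} {w : T ⥤ D} {z : T ⥤ E}
  {φ : ∀ p : C × C, n.obj (f.obj p.1, f.obj p.2) ⟶ f.obj (m.obj p)}
  {γ : ∀ p : D × D, k.obj (g.obj p.1, g.obj p.2) ⟶ g.obj (n.obj p)}
  {φ₀ : ∀ t : T, w.obj t ⟶ f.obj (u.obj t)} {γ₀ : ∀ t : T, z.obj t ⟶ g.obj (w.obj t)}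

theorem map_split (k : E × E ⥤ E) {a b c a' b' c' : E} (p : a ⟶ b) (q : b ⟶ c) (p' : a' ⟶ b')
    (q' : b' ⟶ c') : k.map (Prod.mkHom (p ≫ q) (p' ≫ q')) =
      k.map (Prod.mkHom p p') ≫ k.map (Prod.mkHom q q') := by
  rw [← k.map_comp]; rfl

theorem AssocEq.id (m : C × C ⥤ C)
    (α : ∀ p : (C × C) × C, m.obj (m.obj p.1, p.2) ⟶ m.obj (p.1.1, m.obj (p.1.2, p.2))) :
    AssocEq m m (𝟭 C) α α fun p => 𝟙 (m.obj p) := by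
  intro p
  have h₁ : m.map (Prod.mkHom (𝟙 (m.obj p.1)) (𝟙 p.2)) = 𝟙 _ := m.map_id _
  have h₂ : m.map (Prod.mkHom (𝟙 p.1.1) (𝟙 (m.obj (p.1.2, p.2)))) = 𝟙 _ := m.map_id _
  refine (congrArg (· ≫ _) h₁).trans (.trans ?_ (congrArg (α p ≫ · ≫ _) h₂).symm)
  simp

theorem LeftUnitEq.id (m : C × C ⥤ C) (u : T ⥤ C)
    (l : ∀ p : T × C, m.obj (u.obj p.1, p.2) ⟶ p.2) :
    LeftUnitEq m m u u (𝟭 C) l l (fun p => 𝟙 (m.obj p)) fun t => 𝟙 (u.obj t) := fun _ =>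
  (congrArg (· ≫ _) (m.map_id _)).trans ((Category.id_comp _).trans (Category.id_comp _))

theorem RightUnitEq.id (m : C × C ⥤ C) (u : T ⥤ C)
    (r : ∀ p : C × T, m.obj (p.1, u.obj p.2) ⟶ p.1) :
    RightUnitEq m m u u (𝟭 C) r r (fun p => 𝟙 (m.obj p)) fun t => 𝟙 (u.obj t) := fun _ =>
  (congrArg (· ≫ _) (m.map_id _)).trans ((Category.id_comp _).trans (Category.id_comp _))

theorem AssocEq.comp {α : ∀ p : (C × C) × C, m.obj (m.obj p.1, p.2) ⟶ m.obj (p.1.1, m.obj (p.1.2, p.2))}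
    {β : ∀ p : (D × D) × D, n.obj (n.obj p.1, p.2) ⟶ n.obj (p.1.1, n.obj (p.1.2, p.2))}
    {τ : ∀ p : (E × E) × E, k.obj (k.obj p.1, p.2) ⟶ k.obj (p.1.1, k.obj (p.1.2, p.2))}
    (hγ : ∀ {p q : D × D} (t : p ⟶ q),
      k.map (Prod.mkHom (g.map t.1) (g.map t.2)) ≫ γ q = γ p ≫ g.map (n.map t))
    (h : AssocEq m n f α β φ) (h' : AssocEq n k g β τ γ) :
    AssocEq m k (f ⋙ g) α τ fun p => γ (f.obj p.1, f.obj p.2) ≫ g.map (φ p) := by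
  intro p
  have h₁ := h p
  have h₂ := h' ((f.obj p.1.1, f.obj p.1.2), f.obj p.2)
  have h₃ := hγ (Prod.mkHom (φ p.1) (𝟙 (f.obj p.2)))
  have h₄ := hγ (Prod.mkHom (𝟙 (f.obj p.1.1)) (φ (p.1.2, p.2)))
  have s₁ := map_split k (γ (f.obj p.1.1, f.obj p.1.2)) (g.map (φ p.1)) (𝟙 _)
    (𝟙 (g.obj (f.obj p.2)))
  have s₂ := map_split k (𝟙 _) (𝟙 (g.obj (f.obj p.1.1))) (γ (f.obj p.1.2, f.obj p.2))
    (g.map (φ (p.1.2, p.2)))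
  simp only [Category.comp_id, CategoryTheory.Functor.map_id, Prod.mkHom] at *
  simp only [CategoryTheory.Functor.comp_obj, CategoryTheory.Functor.comp_map, Category.assoc, s₁, s₂]
  rw [reassoc_of% h₃, ← g.map_comp, ← g.map_comp, h₁, g.map_comp, reassoc_of% h₂]
  rw [reassoc_of% h₄, g.map_comp]

theorem LeftUnitEq.comp {l : ∀ p : T × C, m.obj (u.obj p.1, p.2) ⟶ p.2}
    {l' : ∀ p : T × D, n.obj (w.obj p.1, p.2) ⟶ p.2}
    {l'' : ∀ p : T × E, k.obj (z.obj p.1, p.2) ⟶ p.2}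
    (hγ : ∀ {p q : D × D} (t : p ⟶ q),
      k.map (Prod.mkHom (g.map t.1) (g.map t.2)) ≫ γ q = γ p ≫ g.map (n.map t))
    (h : LeftUnitEq m n u w f l l' φ φ₀) (h' : LeftUnitEq n k w z g l' l'' γ γ₀) :
    LeftUnitEq m k u z (f ⋙ g) l l'' (fun p => γ (f.obj p.1, f.obj p.2) ≫ g.map (φ p))
      fun t => γ₀ t ≫ g.map (φ₀ t) := by
  intro p
  have h₁ := h p
  have h₂ := h' (p.1, f.obj p.2)
  have h₃ := hγ (Prod.mkHom (φ₀ p.1) (𝟙 (f.obj p.2)))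
  have s₁ := map_split k (γ₀ p.1) (g.map (φ₀ p.1)) (𝟙 _) (𝟙 (g.obj (f.obj p.2)))
  simp only [Category.comp_id, CategoryTheory.Functor.map_id, Prod.mkHom] at *
  simp only [CategoryTheory.Functor.comp_obj, CategoryTheory.Functor.comp_map, Category.assoc, s₁]
  rw [reassoc_of% h₃, ← g.map_comp, ← g.map_comp, h₁, h₂]

theorem RightUnitEq.comp {r : ∀ p : C × T, m.obj (p.1, u.obj p.2) ⟶ p.1}
    {r' : ∀ p : D × T, n.obj (p.1, w.obj p.2) ⟶ p.1}
    {r'' : ∀ p : E × T, k.obj (p.1, z.obj p.2) ⟶ p.1}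
    (hγ : ∀ {p q : D × D} (t : p ⟶ q),
      k.map (Prod.mkHom (g.map t.1) (g.map t.2)) ≫ γ q = γ p ≫ g.map (n.map t))
    (h : RightUnitEq m n u w f r r' φ φ₀) (h' : RightUnitEq n k w z g r' r'' γ γ₀) :
    RightUnitEq m k u z (f ⋙ g) r r'' (fun p => γ (f.obj p.1, f.obj p.2) ≫ g.map (φ p))
      fun t => γ₀ t ≫ g.map (φ₀ t) := by
  intro p
  have h₁ := h p
  have h₂ := h' (f.obj p.1, p.2)
  have h₃ := hγ (Prod.mkHom (𝟙 (f.obj p.1)) (φ₀ p.2))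
  have s₁ := map_split k (𝟙 _) (𝟙 (g.obj (f.obj p.1))) (γ₀ p.2) (g.map (φ₀ p.2))
  simp only [Category.comp_id, CategoryTheory.Functor.map_id, Prod.mkHom] at *
  simp only [CategoryTheory.Functor.comp_obj, CategoryTheory.Functor.comp_map, Category.assoc, s₁]
  rw [reassoc_of% h₃, ← g.map_comp, ← g.map_comp, h₁, h₂]

end

end Plain

section Compat
variable {B : Type u₁} [Bicategory.{w, v₁} B]

theorem assocCompat_iff {M N : Pseudofunctor B Cat.{v, u}} {m : prod M M ⟶ M} {n : prod N N ⟶ N}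
    {f : M ⟶ N} (α : prodMap m (𝟙 M) ≫ m ⟶ prodAssoc M M M ≫ prodMap (𝟙 M) m ≫ m)
    (β : prodMap n (𝟙 N) ≫ n ⟶ prodAssoc N N N ≫ prodMap (𝟙 N) n ≫ n)
    (φ : prodMap f f ≫ n ⟶ m ≫ f) : AssocCompat α β φ ↔ ∀ x : B,
      AssocEq (C := M.obj x) (D := N.obj x) (m.app x).toFunctor (n.app x).toFunctor
        (f.app x).toFunctor (cmp α x) (cmp β x) (cmp φ x) := by
  refine cmp_eq_iff (fun x a => ?_) (fun x a => ?_)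
  · exact cmp_comp (cmp_whiskerRight _ _ (cmp_prodMap₂ φ (𝟙 f) x a)) (cmp_eqToHom_comp _ (heq_of_eq
      (cmp_comp (cmp_whiskerLeft _ _ _ _) (cmp_eqToHom_comp _ (heq_of_eq
        (cmp_whiskerRight _ _ rfl))))))
  · exact cmp_eqToHom_comp _ (heq_of_eq (cmp_comp (cmp_whiskerLeft _ _ _ _)
      (cmp_eqToHom_comp _ (heq_of_eq (cmp_comp
        ((cmp_whiskerLeft _ _ _ _).trans (cmp_whiskerRight _ _ (cmp_prodMap₂ (𝟙 f) φ x _)))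
        (cmp_eqToHom_comp _ (heq_of_eq (cmp_comp_eqToHom _ (heq_of_eq
          ((cmp_whiskerLeft _ _ _ _).trans (cmp_whiskerLeft _ _ _ _)))))))))))

section
variable {M N : Pseudofunctor B Cat.{v, u}} {m : prod M M ⟶ M} {n : prod N N ⟶ N}
  {u : one ⟶ M} {w : one ⟶ N} {f : M ⟶ N}

theorem leftUnitCompat_iff (l : prodMap u (𝟙 M) ≫ m ⟶ snd one M)
    (l' : prodMap w (𝟙 N) ≫ n ⟶ snd one N) (φ : prodMap f f ≫ n ⟶ m ≫ f) (φ₀ : w ⟶ u ≫ f) :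
    LeftUnitCompat l l' φ φ₀ ↔ ∀ x : B,
      LeftUnitEq (T := onePseudo.obj x) (C := M.obj x) (D := N.obj x) (m.app x).toFunctor
        (n.app x).toFunctor (u.app x).toFunctor (w.app x).toFunctor (f.app x).toFunctor
        (cmp l x) (cmp l' x) (cmp φ x) (cmp φ₀ x) := by
  refine cmp_eq_iff (fun x a => ?_) (fun x a => ?_)
  · exact cmp_comp (cmp_whiskerRight _ _ (cmp_prodMap₂ φ₀ (𝟙 f) x a)) (cmp_eqToHom_comp _ (heq_of_eq
      (cmp_comp (cmp_whiskerLeft _ _ _ _) (cmp_eqToHom_comp _ (heq_of_eq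
        (cmp_whiskerRight _ _ rfl))))))
  · exact cmp_eqToHom_comp _ (heq_of_eq (cmp_comp_eqToHom _ (heq_of_eq (cmp_whiskerLeft _ _ _ _))))

theorem rightUnitCompat_iff (r : prodMap (𝟙 M) u ≫ m ⟶ fst M one)
    (r' : prodMap (𝟙 N) w ≫ n ⟶ fst N one) (φ : prodMap f f ≫ n ⟶ m ≫ f) (φ₀ : w ⟶ u ≫ f) :
    RightUnitCompat r r' φ φ₀ ↔ ∀ x : B,
      RightUnitEq (T := onePseudo.obj x) (C := M.obj x) (D := N.obj x) (m.app x).toFunctor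
        (n.app x).toFunctor (u.app x).toFunctor (w.app x).toFunctor (f.app x).toFunctor
        (cmp r x) (cmp r' x) (cmp φ x) (cmp φ₀ x) := by
  refine cmp_eq_iff (fun x a => ?_) (fun x a => ?_)
  · exact cmp_comp (cmp_whiskerRight _ _ (cmp_prodMap₂ (𝟙 f) φ₀ x a)) (cmp_eqToHom_comp _ (heq_of_eq
      (cmp_comp (cmp_whiskerLeft _ _ _ _) (cmp_eqToHom_comp _ (heq_of_eq
        (cmp_whiskerRight _ _ rfl))))))
  · exact cmp_eqToHom_comp _ (heq_of_eq (cmp_comp_eqToHom _ (heq_of_eq (cmp_whiskerLeft _ _ _ _))))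

end

theorem cmp_compMul {M N L : Pseudofunctor B Cat.{v, u}} {m : prod M M ⟶ M} {n : prod N N ⟶ N}
    {k : prod L L ⟶ L} {f : M ⟶ N} {g : N ⟶ L} (φ : prodMap f f ≫ n ⟶ m ≫ f)
    (γ : prodMap g g ≫ k ⟶ n ≫ g) (h₁ : prodMap (f ≫ g) (f ≫ g) ≫ k = _) (h₂ : _ = _) (h₃ : _ = _)
    (x : B) (p : (prod M M).obj x) :
    cmp (eqToHom h₁ ≫ prodMap f f ◁ γ ≫ eqToHom h₂ ≫ φ ▷ g ≫ eqToHom h₃ :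
        prodMap (f ≫ g) (f ≫ g) ≫ k ⟶ m ≫ f ≫ g) x p =
      cmp γ x ((f.app x).toFunctor.obj p.1, (f.app x).toFunctor.obj p.2) ≫
        (g.app x).toFunctor.map (cmp φ x p) :=
  cmp_eqToHom_comp _ (heq_of_eq (cmp_comp (cmp_whiskerLeft _ _ _ _)
    (cmp_eqToHom_comp _ (heq_of_eq (cmp_comp_eqToHom h₃
      (heq_of_eq (cmp_whiskerRight _ _ rfl)))))))

namespace Pseudomonoid

variable {P Q R : Pseudomonoid (Pseudofunctor B Cat.{v, u})}

theorem cmp_idMulIso (x : B) (p : (prod P.pt P.pt).obj x) :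
    cmp (idMulIso P).hom x p = 𝟙 ((P.mul.app x).toFunctor.obj p) :=
  cmp_eqToIso _ (heq_of_eq rfl)

theorem cmp_idUnitIso (x : B) (t : (one : Pseudofunctor B Cat.{v, u}).obj x) :
    cmp (idUnitIso P).hom x t = 𝟙 ((P.unit.app x).toFunctor.obj t) :=
  cmp_eqToIso _ (heq_of_eq rfl)

theorem cmp_mulIso_naturality (g : Hom P Q) (x : B) {p q : (prod P.pt P.pt).obj x} (t : p ⟶ q) :
    (Q.mul.app x).toFunctor.map (Prod.mkHom ((g.hom.app x).toFunctor.map t.1)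
      ((g.hom.app x).toFunctor.map t.2)) ≫ cmp g.mulIso.hom x q =
      cmp g.mulIso.hom x p ≫ (g.hom.app x).toFunctor.map ((P.mul.app x).toFunctor.map t) :=
  (g.mulIso.hom.as.app x).toNatTrans.naturality t

theorem cmp_compMulIso (f : Hom P Q) (g : Hom Q R) (x : B) (p : (prod P.pt P.pt).obj x) :
    cmp (compMulIso f g).hom x p =
      cmp g.mulIso.hom x ((f.hom.app x).toFunctor.obj p.1, (f.hom.app x).toFunctor.obj p.2) ≫
        (g.hom.app x).toFunctor.map (cmp f.mulIso.hom x p) :=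
  (congrArg (cmp · x p) (compMulIso_hom f g)).trans (cmp_compMul _ _ _ _ _ _ _)

theorem cmp_compUnitIso (f : Hom P Q) (g : Hom Q R) (x : B)
    (t : (one : Pseudofunctor B Cat.{v, u}).obj x) : cmp (compUnitIso f g).hom x t =
      cmp g.unitIso.hom x t ≫ (g.hom.app x).toFunctor.map (cmp f.unitIso.hom x t) :=
  (congrArg (cmp · x t) (compUnitIso_hom f g)).trans
    (cmp_comp rfl (cmp_comp_eqToHom (Strict.assoc _ _ _) (heq_of_eq (cmp_whiskerRight _ _ rfl))))

/-- The composite of two morphisms of pseudomonoids. -/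
def Hom.comp (f : Hom P Q) (g : Hom Q R) : Hom P R where
  hom := f.hom ≫ g.hom
  mulIso := compMulIso f g
  unitIso := compUnitIso f g
  assoc_compat := (assocCompat_iff _ _ _).2 fun x => by
    rw [show cmp (compMulIso f g).hom x = _ from funext (cmp_compMulIso f g x)]
    exact AssocEq.comp (cmp_mulIso_naturality g x) ((assocCompat_iff _ _ _).1 f.assoc_compat x)
      ((assocCompat_iff _ _ _).1 g.assoc_compat x)
  leftUnit_compat := (leftUnitCompat_iff _ _ _ _).2 fun x => by
    rw [show cmp (compMulIso f g).hom x = _ from funext (cmp_compMulIso f g x),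
      show cmp (compUnitIso f g).hom x = _ from funext (cmp_compUnitIso f g x)]
    exact LeftUnitEq.comp (cmp_mulIso_naturality g x)
      ((leftUnitCompat_iff _ _ _ _).1 f.leftUnit_compat x)
      ((leftUnitCompat_iff _ _ _ _).1 g.leftUnit_compat x)
  rightUnit_compat := (rightUnitCompat_iff _ _ _ _).2 fun x => by
    rw [show cmp (compMulIso f g).hom x = _ from funext (cmp_compMulIso f g x),
      show cmp (compUnitIso f g).hom x = _ from funext (cmp_compUnitIso f g x)]
    exact RightUnitEq.comp (cmp_mulIso_naturality g x)
      ((rightUnitCompat_iff _ _ _ _).1 f.rightUnit_compat x)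
      ((rightUnitCompat_iff _ _ _ _).1 g.rightUnit_compat x)

end Pseudomonoid

end Compat

section PseudomonoidBicategory

variable {B : Type u₁} [Bicategory.{w, v₁} B]

theorem mulCompat_iff {M N : Pseudofunctor B Cat.{v, u}} {m : prod M M ⟶ M} {n : prod N N ⟶ N}
    {f g : M ⟶ N} (σ : f ⟶ g) (φ : prodMap f f ≫ n ⟶ m ≫ f) (ψ : prodMap g g ≫ n ⟶ m ≫ g) :
    prodMap₂ σ σ ▷ n ≫ ψ = φ ≫ m ◁ σ ↔ ∀ (x : B) (p : (prod M M).obj x),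
      (n.app x).toFunctor.map (Prod.mkHom (cmp σ x p.1) (cmp σ x p.2)) ≫ cmp ψ x p =
        cmp φ x p ≫ cmp σ x ((m.app x).toFunctor.obj p) :=
  cmp_eq_iff (fun _ _ => cmp_comp (cmp_whiskerRight _ _ (cmp_prodMap₂ σ σ _ _)) rfl)
    (fun _ _ => cmp_comp rfl (cmp_whiskerLeft _ _ _ _))

theorem unitCompat_iff {M N : Pseudofunctor B Cat.{v, u}} {e : one ⟶ M} {e' : one ⟶ N}
    {f g : M ⟶ N} (σ : f ⟶ g) (φ₀ : e' ⟶ e ≫ f) (ψ₀ : e' ⟶ e ≫ g) :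
    φ₀ ≫ e ◁ σ = ψ₀ ↔ ∀ (x : B) (t : (one : Pseudofunctor B Cat.{v, u}).obj x),
      cmp φ₀ x t ≫ cmp σ x ((e.app x).toFunctor.obj t) = cmp ψ₀ x t :=
  cmp_eq_iff (fun _ _ => cmp_comp rfl (cmp_whiskerLeft _ _ _ _)) fun _ _ => rfl

namespace Pseudomonoid

variable {P Q R S : Pseudomonoid (Pseudofunctor B Cat.{v, u})}

variable (P) in
/-- The identity morphism of a pseudomonoid. -/
def Hom.id : Hom P P where
  hom := 𝟙 P.pt
  mulIso := idMulIso P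
  unitIso := idUnitIso P
  assoc_compat := (assocCompat_iff _ _ _).2 fun x => by
    rw [show cmp (idMulIso P).hom x = _ from funext (cmp_idMulIso x)]
    exact AssocEq.id _ _
  leftUnit_compat := (leftUnitCompat_iff _ _ _ _).2 fun x => by
    rw [show cmp (idMulIso P).hom x = _ from funext (cmp_idMulIso x),
      show cmp (idUnitIso P).hom x = _ from funext (cmp_idUnitIso x)]
    exact LeftUnitEq.id _ _ _
  rightUnit_compat := (rightUnitCompat_iff _ _ _ _).2 fun x => by
    rw [show cmp (idMulIso P).hom x = _ from funext (cmp_idMulIso x),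
      show cmp (idUnitIso P).hom x = _ from funext (cmp_idUnitIso x)]
    exact RightUnitEq.id _ _ _

theorem Hom₂.mul_app {f g : Hom P Q} (σ : Hom₂ f g) (x : B) (p : (prod P.pt P.pt).obj x) :
    (Q.mul.app x).toFunctor.map (Prod.mkHom (cmp σ.cell x p.1) (cmp σ.cell x p.2)) ≫
      cmp g.mulIso.hom x p =
        cmp f.mulIso.hom x p ≫ cmp σ.cell x ((P.mul.app x).toFunctor.obj p) :=
  (mulCompat_iff _ _ _).1 σ.mul_compat x p

theorem Hom₂.unit_app {f g : Hom P Q} (σ : Hom₂ f g) (x : B)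
    (t : (one : Pseudofunctor B Cat.{v, u}).obj x) :
    cmp f.unitIso.hom x t ≫ cmp σ.cell x ((P.unit.app x).toFunctor.obj t) =
      cmp g.unitIso.hom x t :=
  (unitCompat_iff _ _ _).1 σ.unit_compat x t

/-- A 2-cell of pseudomonoids, from the componentwise form of the axioms. -/
def Hom₂.mk' {f g : Hom P Q} (σ : f.hom ⟶ g.hom)
    (h : ∀ (x : B) (p : (prod P.pt P.pt).obj x),
      (Q.mul.app x).toFunctor.map (Prod.mkHom (cmp σ x p.1) (cmp σ x p.2)) ≫ cmp g.mulIso.hom x p =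
        cmp f.mulIso.hom x p ≫ cmp σ x ((P.mul.app x).toFunctor.obj p))
    (h' : ∀ (x : B) (t : (one : Pseudofunctor B Cat.{v, u}).obj x),
      cmp f.unitIso.hom x t ≫ cmp σ x ((P.unit.app x).toFunctor.obj t) = cmp g.unitIso.hom x t) :
    Hom₂ f g where
  cell := σ
  mul_compat := (mulCompat_iff _ _ _).2 h
  unit_compat := (unitCompat_iff _ _ _).2 h'

instance homCategory (P Q : Pseudomonoid (Pseudofunctor B Cat.{v, u})) : Category (Hom P Q) where
  Hom := Hom₂
  id f := .mk' (𝟙 f.hom)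
    (fun x p => ((congrArg (· ≫ _) ((Q.mul.app x).toFunctor.map_id _)).trans
      (Category.id_comp _)).trans (Category.comp_id _).symm)
    (fun x t => Category.comp_id _)
  comp {f g h} σ τ := .mk' (σ.cell ≫ τ.cell)
    (fun x p => by
      refine (congrArg (· ≫ _) (map_split (E := Q.pt.obj x) (Q.mul.app x).toFunctor _ _ _ _)).trans ?_
      refine (Category.assoc _ _ _).trans ((congrArg (_ ≫ ·) (τ.mul_app x p)).trans ?_)
      refine (Category.assoc _ _ _).symm.trans ((congrArg (· ≫ _) (σ.mul_app x p)).trans ?_)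
      exact Category.assoc _ _ _)
    (fun x t => (Category.assoc _ _ _).symm.trans
      ((congrArg (· ≫ _) (σ.unit_app x t)).trans (τ.unit_app x t)))
  id_comp _ := Hom₂.ext (Category.id_comp _)
  comp_id _ := Hom₂.ext (Category.comp_id _)
  assoc _ _ _ := Hom₂.ext (Category.assoc _ _ _)

theorem cell_comp {f g h : Hom P Q} (σ : f ⟶ g) (τ : g ⟶ h) : (σ ≫ τ).cell = σ.cell ≫ τ.cell := rfl

theorem cell_id (f : Hom P Q) : Hom₂.cell (𝟙 f) = 𝟙 f.hom := rfl

/-- An isomorphism between morphisms of pseudomonoids, from an invertible 2-cell. -/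
def Hom.isoMk {f g : Hom P Q} (σ : Hom₂ f g) (τ : Hom₂ g f) (h : σ.cell ≫ τ.cell = 𝟙 _)
    (h' : τ.cell ≫ σ.cell = 𝟙 _) : f ≅ g where
  hom := σ
  inv := τ
  hom_inv_id := Hom₂.ext h
  inv_hom_id := Hom₂.ext h'

/-- Whiskering of 2-cells of pseudomonoids. -/
def Hom₂.whiskerLeft (f : Hom P Q) {g h : Hom Q R} (σ : Hom₂ g h) :
    f.comp g ⟶ f.comp h := .mk' (f.hom ◁ σ.cell)
  (fun x p => by
    refine (whisker_eq _ (cmp_compMulIso f h x p)).trans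
      (.trans ?_ (eq_whisker (cmp_compMulIso f g x p) _).symm)
    refine (Category.assoc _ _ _).symm.trans ((eq_whisker (σ.mul_app x
      ((f.hom.app x).toFunctor.obj p.1, (f.hom.app x).toFunctor.obj p.2)) _).trans ?_)
    refine (Category.assoc _ _ _).trans (.trans ?_ (Category.assoc _ _ _).symm)
    exact whisker_eq _ ((σ.cell.as.app x).toNatTrans.naturality _).symm)
  (fun x t => by
    refine (eq_whisker (cmp_compUnitIso f g x t) _).trans
      (.trans ?_ (cmp_compUnitIso f h x t).symm)
    refine (Category.assoc _ _ _).trans ((whisker_eq _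
      ((σ.cell.as.app x).toNatTrans.naturality (cmp f.unitIso.hom x t))).trans ?_)
    exact (Category.assoc _ _ _).symm.trans (eq_whisker (σ.unit_app x t) _))

/-- Whiskering of 2-cells of pseudomonoids. -/
def Hom₂.whiskerRight {f g : Hom P Q} (σ : Hom₂ f g) (h : Hom Q R) :
    f.comp h ⟶ g.comp h := .mk' (σ.cell ▷ h.hom)
  (fun x p => by
    refine (whisker_eq _ (cmp_compMulIso g h x p)).trans
      (.trans ?_ (eq_whisker (cmp_compMulIso f h x p) _).symm)
    refine (Category.assoc _ _ _).symm.trans ((eq_whisker (cmp_mulIso_naturality h x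
      (p := ((f.hom.app x).toFunctor.obj p.1, (f.hom.app x).toFunctor.obj p.2))
      (q := ((g.hom.app x).toFunctor.obj p.1, (g.hom.app x).toFunctor.obj p.2))
      (Prod.mkHom (cmp σ.cell x p.1) (cmp σ.cell x p.2))) _).trans ?_)
    refine (Category.assoc _ _ _).trans (.trans ?_ (Category.assoc _ _ _).symm)
    refine whisker_eq _ (((h.hom.app x).toFunctor.map_comp _ _).symm.trans ?_)
    exact (congrArg (h.hom.app x).toFunctor.map (σ.mul_app x p)).trans
      ((h.hom.app x).toFunctor.map_comp _ _))
  (fun x t => by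
    refine (eq_whisker (cmp_compUnitIso f h x t) _).trans
      (.trans ?_ (cmp_compUnitIso g h x t).symm)
    refine (Category.assoc _ _ _).trans (whisker_eq _ ?_)
    exact ((h.hom.app x).toFunctor.map_comp _ _).symm.trans
      (congrArg (h.hom.app x).toFunctor.map (σ.unit_app x t)))

theorem Hom.ext' {f g : Hom P Q} (h : f.hom = g.hom)
    (h₁ : ∀ x p, cmp f.mulIso.hom x p ≍ cmp g.mulIso.hom x p)
    (h₂ : ∀ x t, cmp f.unitIso.hom x t ≍ cmp g.unitIso.hom x t) : f = g := by
  obtain ⟨f, φ, φ₀, _, _, _⟩ := f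
  obtain ⟨g, γ, γ₀, _, _, _⟩ := g
  dsimp only at h h₁ h₂
  subst h
  obtain rfl : φ = γ := Iso.ext (cmp_ext fun x p => eq_of_heq (h₁ x p))
  obtain rfl : φ₀ = γ₀ := Iso.ext (cmp_ext fun x p => eq_of_heq (h₂ x p))
  rfl

theorem Hom.comp_assoc (f : Hom P Q) (g : Hom Q R) (h : Hom R S) :
    (f.comp g).comp h = f.comp (g.comp h) :=
  Hom.ext' (Strict.assoc _ _ _)
    (fun x p => heq_of_eq (((cmp_compMulIso (f.comp g) h x p).trans (whisker_eq _ ((congrArg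
      (h.hom.app x).toFunctor.map (cmp_compMulIso f g x p)).trans
        ((h.hom.app x).toFunctor.map_comp _ _)))).trans ((cmp_compMulIso f (g.comp h) x p).trans
        ((eq_whisker (cmp_compMulIso g h x _) _).trans (Category.assoc _ _ _))).symm))
    (fun x t => heq_of_eq (((cmp_compUnitIso (f.comp g) h x t).trans (whisker_eq _ ((congrArg
      (h.hom.app x).toFunctor.map (cmp_compUnitIso f g x t)).trans
        ((h.hom.app x).toFunctor.map_comp _ _)))).trans ((cmp_compUnitIso f (g.comp h) x t).trans
        ((eq_whisker (cmp_compUnitIso g h x _) _).trans (Category.assoc _ _ _))).symm))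

theorem Hom.id_comp (f : Hom P Q) : (Hom.id P).comp f = f :=
  Hom.ext' (Strict.id_comp _)
    (fun x p => heq_of_eq ((cmp_compMulIso (Hom.id P) f x p).trans ((whisker_eq _ ((congrArg
      (f.hom.app x).toFunctor.map (cmp_idMulIso x p)).trans
        ((f.hom.app x).toFunctor.map_id _))).trans (Category.comp_id _))))
    (fun x t => heq_of_eq ((cmp_compUnitIso (Hom.id P) f x t).trans ((whisker_eq _ ((congrArg
      (f.hom.app x).toFunctor.map (cmp_idUnitIso x t)).trans
        ((f.hom.app x).toFunctor.map_id _))).trans (Category.comp_id _))))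

theorem Hom.comp_id (f : Hom P Q) : f.comp (Hom.id Q) = f :=
  Hom.ext' (Strict.comp_id _)
    (fun x p => heq_of_eq ((cmp_compMulIso f (Hom.id Q) x p).trans
      ((eq_whisker (cmp_idMulIso x _) _).trans (Category.id_comp _))))
    (fun x t => heq_of_eq ((cmp_compUnitIso f (Hom.id Q) x t).trans
      ((eq_whisker (cmp_idUnitIso x _) _).trans (Category.id_comp _))))

/-- The isomorphism between equal morphisms whose 2-cell is a given structural one. -/
def Hom.isoOfEq {f g : Hom P Q} (h : f = g) (e : f.hom ≅ g.hom)
    (he : e = eqToIso (congrArg Hom.hom h)) : f ≅ g where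
  hom :=
    { cell := e.hom
      mul_compat := by subst h he; exact (𝟙 f : f ⟶ f).mul_compat
      unit_compat := by subst h he; exact (𝟙 f : f ⟶ f).unit_compat }
  inv :=
    { cell := e.inv
      mul_compat := by subst h he; exact (𝟙 f : f ⟶ f).mul_compat
      unit_compat := by subst h he; exact (𝟙 f : f ⟶ f).unit_compat }
  hom_inv_id := Hom₂.ext e.hom_inv_id
  inv_hom_id := Hom₂.ext e.inv_hom_id

theorem Hom₂.ext_of {f g : Hom P Q} {σ τ : f ⟶ g} {s t : f.hom ⟶ g.hom} (hs : σ.cell = s)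
    (ht : τ.cell = t) (h : s = t) : σ = τ :=
  Hom₂.ext (hs.trans (h.trans ht.symm))

section
variable (f : Hom P Q) (g : Hom Q R) (h : Hom R S)

/-- The associator of morphisms of pseudomonoids, given by that of the underlying 2-category. -/
def assocIso : (f.comp g).comp h ≅ f.comp (g.comp h) :=
  Hom.isoOfEq (Hom.comp_assoc f g h) (α_ f.hom g.hom h.hom)
      (Strict.associator_eqToIso f.hom g.hom h.hom)

/-- The left unitor of morphisms of pseudomonoids, given by that of the underlying 2-category. -/
def leftIso : (Hom.id P).comp f ≅ f :=
  Hom.isoOfEq (Hom.id_comp f) (λ_ f.hom) (Strict.leftUnitor_eqToIso f.hom)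

/-- The right unitor of morphisms of pseudomonoids, given by that of the underlying 2-category. -/
def rightIso : f.comp (Hom.id Q) ≅ f :=
  Hom.isoOfEq (Hom.comp_id f) (ρ_ f.hom) (Strict.rightUnitor_eqToIso f.hom)

theorem cell_whiskerLeft {g g' : Hom Q R} (σ : g ⟶ g') :
  (Hom₂.whiskerLeft f σ).cell = f.hom ◁ σ.cell := rfl
theorem cell_whiskerRight {f f' : Hom P Q} (σ : f ⟶ f') (g : Hom Q R) :
  (Hom₂.whiskerRight σ g).cell = σ.cell ▷ g.hom := rfl

end

/-- The 2-category of pseudomonoids in the cartesian 2-category of pseudofunctors to `Cat`, strong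
morphisms, and their 2-cells; all composites are those of the underlying 2-category. -/
instance : Bicategory (Pseudomonoid (Pseudofunctor B Cat.{v, u})) where
  Hom := Hom
  id := Hom.id
  comp := Hom.comp
  homCategory := homCategory
  whiskerLeft := Hom₂.whiskerLeft
  whiskerRight := Hom₂.whiskerRight
  associator := assocIso
  leftUnitor := leftIso
  rightUnitor := rightIso
  whiskerLeft_id f g := Hom₂.ext_of (cell_whiskerLeft _ _) (cell_id _)
    ((congrArg (f.hom ◁ ·) (cell_id g)).trans (Bicategory.whiskerLeft_id f.hom g.hom))
  whiskerLeft_comp f _ _ _ σ τ := Hom₂.ext (Bicategory.whiskerLeft_comp f.hom σ.cell τ.cell)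
  id_whiskerLeft σ := Hom₂.ext (Bicategory.id_whiskerLeft σ.cell)
  comp_whiskerLeft f g _ _ σ := Hom₂.ext (Bicategory.comp_whiskerLeft f.hom g.hom σ.cell)
  id_whiskerRight f g := Hom₂.ext_of (cell_whiskerRight _ _) (cell_id _)
    ((congrArg (· ▷ g.hom) (cell_id f)).trans (Bicategory.id_whiskerRight f.hom g.hom))
  comp_whiskerRight σ τ f := Hom₂.ext (Bicategory.comp_whiskerRight σ.cell τ.cell f.hom)
  whiskerRight_id σ := Hom₂.ext (Bicategory.whiskerRight_id σ.cell)
  whiskerRight_comp σ g h := Hom₂.ext (Bicategory.whiskerRight_comp σ.cell g.hom h.hom)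
  whisker_assoc f _ _ σ h := Hom₂.ext (Bicategory.whisker_assoc f.hom σ.cell h.hom)
  whisker_exchange σ τ := Hom₂.ext (Bicategory.whisker_exchange σ.cell τ.cell)
  pentagon f g h i := Hom₂.ext (Bicategory.pentagon f.hom g.hom h.hom i.hom)
  triangle f g := Hom₂.ext (Bicategory.triangle f.hom g.hom)

end Pseudomonoid

end PseudomonoidBicategory

section MonoidalCategories

open MonoidalCategory

/-- A monoidal category. -/
structure MonoidalCat where
  carrier : Type u
  [category : Category.{v} carrier]
  [monoidal : MonoidalCategory carrier]

namespace MonoidalCat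

attribute [instance] category monoidal

/-- A strong monoidal functor. -/
structure Hom (C D : MonoidalCat.{v, u}) where
  functor : C.carrier ⥤ D.carrier
  [monoidal : functor.Monoidal]

attribute [instance] Hom.monoidal

/-- The identity functor. -/
abbrev Hom.id (C : MonoidalCat.{v, u}) : Hom C C := ⟨𝟭 C.carrier⟩

/-- The composite of strong monoidal functors. -/
abbrev Hom.comp {C D E : MonoidalCat.{v, u}} (F : Hom C D) (G : Hom D E) : Hom C E :=
  ⟨F.functor ⋙ G.functor⟩

/-- A monoidal natural transformation. -/
@[ext]
structure Hom₂ {C D : MonoidalCat.{v, u}} (F G : Hom C D) where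
  natTrans : F.functor ⟶ G.functor
  [isMonoidal : natTrans.IsMonoidal]

attribute [instance] Hom₂.isMonoidal

instance (C D : MonoidalCat.{v, u}) : Category (Hom C D) where
  Hom := Hom₂
  id F := ⟨𝟙 F.functor⟩
  comp σ τ := ⟨σ.natTrans ≫ τ.natTrans⟩
  id_comp _ := Hom₂.ext (Category.id_comp _)
  comp_id _ := Hom₂.ext (Category.comp_id _)
  assoc _ _ _ := Hom₂.ext (Category.assoc _ _ _)

/-- An isomorphism of strong monoidal functors, from an invertible monoidal transformation. -/
def isoMk {C D : MonoidalCat.{v, u}} {F G : Hom C D} (e : F.functor ≅ G.functor)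
    [e.hom.IsMonoidal] : F ≅ G where
  hom := ⟨e.hom⟩
  inv := ⟨e.inv⟩
  hom_inv_id := Hom₂.ext e.hom_inv_id
  inv_hom_id := Hom₂.ext e.inv_hom_id

/-- Whiskering of monoidal natural transformations. -/
abbrev Hom₂.whiskerLeft {C D E : MonoidalCat.{v, u}} (F : Hom C D) {G H : Hom D E} (σ : Hom₂ G H) :
    Hom₂ (F.comp G) (F.comp H) := ⟨CategoryTheory.Functor.whiskerLeft F.functor σ.natTrans⟩

/-- Whiskering of monoidal natural transformations. -/
abbrev Hom₂.whiskerRight {C D E : MonoidalCat.{v, u}} {F G : Hom C D} (σ : Hom₂ F G) (H : Hom D E) :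
    Hom₂ (F.comp H) (G.comp H) := ⟨CategoryTheory.Functor.whiskerRight σ.natTrans H.functor⟩

/-- The 2-category of monoidal categories, strong monoidal functors and monoidal natural
transformations. -/
instance : Bicategory MonoidalCat.{v, u} where
  Hom := Hom
  id := Hom.id
  comp := Hom.comp
  whiskerLeft F _ _ σ := Hom₂.whiskerLeft F σ
  whiskerRight σ G := Hom₂.whiskerRight σ G
  associator F G H :=
    isoMk (CategoryTheory.Functor.associator F.functor G.functor H.functor)
  leftUnitor F :=
    isoMk (F := (Hom.id _).comp F) (G := F) (CategoryTheory.Functor.leftUnitor F.functor)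
  rightUnitor F :=
    isoMk (F := F.comp (Hom.id _)) (G := F) (CategoryTheory.Functor.rightUnitor F.functor)
  whiskerLeft_id _ _ := Hom₂.ext (by ext; rfl)
  whiskerLeft_comp _ _ _ _ _ _ := Hom₂.ext (by ext; rfl)
  id_whiskerLeft _ := Hom₂.ext (NatTrans.ext (funext fun _ =>
    ((Category.id_comp _).trans (Category.comp_id _)).symm))
  comp_whiskerLeft _ _ _ _ _ := Hom₂.ext (NatTrans.ext (funext fun _ =>
    ((Category.id_comp _).trans (Category.comp_id _)).symm))
  id_whiskerRight _ G := Hom₂.ext (NatTrans.ext (funext fun _ => G.functor.map_id _))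
  comp_whiskerRight _ _ G := Hom₂.ext (NatTrans.ext (funext fun _ => G.functor.map_comp _ _))
  whiskerRight_id _ := Hom₂.ext (NatTrans.ext (funext fun _ =>
    ((Category.id_comp _).trans (Category.comp_id _)).symm))
  whiskerRight_comp _ _ _ := Hom₂.ext (NatTrans.ext (funext fun _ =>
    ((Category.id_comp _).trans (Category.comp_id _)).symm))
  whisker_assoc _ _ _ _ _ := Hom₂.ext (NatTrans.ext (funext fun _ =>
    ((Category.id_comp _).trans (Category.comp_id _)).symm))
  whisker_exchange σ τ := Hom₂.ext (NatTrans.ext (funext fun x =>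
    ((Hom₂.natTrans τ).naturality ((Hom₂.natTrans σ).app x)).symm))
  pentagon F G H K := Hom₂.ext (CategoryTheory.Functor.pentagon F.functor G.functor H.functor K.functor)
  triangle F G := Hom₂.ext (CategoryTheory.Functor.triangle F.functor G.functor)

end MonoidalCat

end MonoidalCategories

section TwoEquivalences

universe w₁ w₂ v₂ u₂

variable {B : Type u₁} [Bicategory.{w₁, v₁} B] {C : Type u₂} [Bicategory.{w₂, v₂} C]

/-- An isomorphism between 2-functors that is natural in the 2-categorical (`Cat`-enriched)
sense. -/
structure TwoNatIso (F G : StrictPseudofunctor B C) where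
  app (a : B) : F.obj a ⟶ G.obj a
  inv (a : B) : G.obj a ⟶ F.obj a
  app_inv (a : B) : app a ≫ inv a = 𝟙 (F.obj a)
  inv_app (a : B) : inv a ≫ app a = 𝟙 (G.obj a)
  naturality {a b : B} (f : a ⟶ b) : F.map f ≫ app b = app a ≫ G.map f
  naturality₂ {a b : B} {f g : a ⟶ b} (θ : f ⟶ g) :
    F.map₂ θ ▷ app b ≫ eqToHom (naturality g) = eqToHom (naturality f) ≫ app a ◁ G.map₂ θ

/-- An equivalence of 2-categories: a pair of 2-functors that are inverse to each other up to
2-natural isomorphisms. -/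
structure TwoEquivalence (B : Type u₁) [Bicategory.{w₁, v₁} B] (C : Type u₂)
    [Bicategory.{w₂, v₂} C] where
  functor : StrictPseudofunctor B C
  inverse : StrictPseudofunctor C B
  unitIso : TwoNatIso (StrictPseudofunctor.id B) (functor.comp inverse)
  counitIso : TwoNatIso (inverse.comp functor) (StrictPseudofunctor.id C)

end TwoEquivalences

/-- The 2-category of `X`-indexed categories, that is, pseudofunctors `Xᵒᵖ ⥤ᵖ Cat`, pseudonatural
transformations and modifications. -/
abbrev IndexedCat (X : Type u₁) [Category.{v₁} X] := Pseudofunctor (LocallyDiscrete Xᵒᵖ) Cat.{v, u}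

end IndexedMonoidal

/-! A pseudomonoid in indexed categories and a pseudofunctor into monoidal categories are the same
data, sorted differently. A multiplication `m` is a family of functors `m_x : M x × M x ⥤ M x` with
coherent isomorphisms `m_y (f* a, f* b) ≅ f* (m_x (a, b))`; a unit `u` is a family of objects with
coherent isomorphisms `u_y ≅ f* u_x`.

Read in one fibre, `m_x`, `u_x` and the components of `α`, `λ`, `ρ` form a monoidal category:
pentagon and triangle are equations between modifications, hence hold component by component. Read
along `f : x ⟶ y`, the naturality constraints of `m` and `u` are the tensorator and the unit
constraint of the reindexing functor `f*`. The modification axiom for `α` is then the associativity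
axiom of a strong monoidal functor, and those for `λ` and `ρ` are the unitality axioms. What
remains, the compatibility of the constraints of `m` and `u` with 2-cells, identities and
composites, says that `map₂`, `mapId` and `mapComp` are monoidal transformations.

The dictionary continues for cells. The components of `φ` and `φ₀` make each `f_x` strong monoidal,
the modification axioms for `φ` and `φ₀` say that the naturality constraints of `f` are monoidal,
and the axioms on a 2-cell say that its components are monoidal.

The translation rests on `pentagon_iff`, `triangle_iff`, `assocCompat_iff`, `leftUnitCompat_iff`,
`rightUnitCompat_iff`, `mulCompat_iff` and `unitCompat_iff`, which evaluate the 2-categorical axioms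
on objects of the fibres (every structural `eqToHom` becomes an identity there), and on
`nat_assoc_source`, `nat_assoc_target` and their unit analogues, which unfold the modification
axioms.

Both round trips are compared with the identity by 1-cells that are identities with identity
constraints. These replace definitional equalities, since some rebuilt data (the unit functor on the
terminal category, the whiskerings of a monoidal structure) agree with the original only by a
functoriality or monoidal law. Nothing depends on the base being a category, so it is an arbitrary
bicategory `B` until the last statement. -/

namespace IndexedMonoidal

open FiniteProducts

/-! ### Components of pseudonatural transformations and modifications. -/

section Components

variable {B : Type u₁} [Bicategory.{w, v₁} B] {F G : Pseudofunctor B Cat.{v, u}}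

/-- The components of the naturality constraints of a pseudonatural transformation. -/
def nat (η : F ⟶ G) {x y : B} (f : x ⟶ y) (a : F.obj x) :
    (η.app y).toFunctor.obj ((F.map f).toFunctor.obj a) ≅
      (G.map f).toFunctor.obj ((η.app x).toFunctor.obj a) :=
  (Cat.Hom.toNatIso (η.naturality f)).app a

theorem nat_natural (η : F ⟶ G) {x y : B} (f : x ⟶ y) {a b : F.obj x} (t : a ⟶ b) :
    (η.app y).toFunctor.map ((F.map f).toFunctor.map t) ≫ (nat η f b).hom =
      (nat η f a).hom ≫ (G.map f).toFunctor.map ((η.app x).toFunctor.map t) :=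
  (η.naturality f).hom.toNatTrans.naturality t

theorem nat_map₂ (η : F ⟶ G) {x y : B} {f g : x ⟶ y} (θ : f ⟶ g) (a : F.obj x) :
    (η.app y).toFunctor.map ((F.map₂ θ).toNatTrans.app a) ≫ (nat η g a).hom =
      (nat η f a).hom ≫ (G.map₂ θ).toNatTrans.app ((η.app x).toFunctor.obj a) :=
  catHom₂_congr (η.naturality_naturality θ) a

theorem nat_id (η : F ⟶ G) (x : B) (a : F.obj x) :
    (nat η (𝟙 x) a).hom ≫ (G.mapId x).hom.toNatTrans.app ((η.app x).toFunctor.obj a) =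
      (η.app x).toFunctor.map ((F.mapId x).hom.toNatTrans.app a) := by
  refine (catHom₂_congr (η.naturality_id x) a).trans ?_
  -- The two unitors in the pseudonaturality axiom have identity components in `Cat`.
  change _ ≫ 𝟙 _ ≫ 𝟙 _ = _
  exact (whisker_eq _ (Category.comp_id _)).trans (Category.comp_id _)

theorem nat_comp (η : F ⟶ G) {x y z : B} (f : x ⟶ y) (g : y ⟶ z) (a : F.obj x) :
    (nat η (f ≫ g) a).hom ≫ (G.mapComp f g).hom.toNatTrans.app ((η.app x).toFunctor.obj a) =
      (η.app z).toFunctor.map ((F.mapComp f g).hom.toNatTrans.app a) ≫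
        (nat η g ((F.map f).toFunctor.obj a)).hom ≫ (G.map g).toFunctor.map (nat η f a).hom := by
  refine (catHom₂_congr (η.naturality_comp f g) a).trans ?_
  -- The three identities are the components of the associators of `Cat`.
  change _ ≫ 𝟙 _ ≫ _ ≫ 𝟙 _ ≫ _ ≫ 𝟙 _ = _
  rw [Category.id_comp, Category.id_comp, Category.comp_id]
  rfl

/-- A pseudonatural transformation from its components. -/
def mkTrans (app : ∀ x, (F.obj x : Type u) ⥤ (G.obj x : Type u))
    (iso : ∀ {x y : B} (f : x ⟶ y), (F.map f).toFunctor ⋙ app y ≅ app x ⋙ (G.map f).toFunctor)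
    (map₂ : ∀ {x y : B} {f g : x ⟶ y} (θ : f ⟶ g) (a : F.obj x),
      (app y).map ((F.map₂ θ).toNatTrans.app a) ≫ (iso g).hom.app a =
        (iso f).hom.app a ≫ (G.map₂ θ).toNatTrans.app ((app x).obj a))
    (mapId : ∀ (x : B) (a : F.obj x), (iso (𝟙 x)).hom.app a ≫
      (G.mapId x).hom.toNatTrans.app ((app x).obj a) =
        (app x).map ((F.mapId x).hom.toNatTrans.app a))
    (mapComp : ∀ {x y z : B} (f : x ⟶ y) (g : y ⟶ z) (a : F.obj x),
      (iso (f ≫ g)).hom.app a ≫ (G.mapComp f g).hom.toNatTrans.app ((app x).obj a) =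
        (app z).map ((F.mapComp f g).hom.toNatTrans.app a) ≫
          (iso g).hom.app ((F.map f).toFunctor.obj a) ≫
            (G.map g).toFunctor.map ((iso f).hom.app a)) : F ⟶ G where
  app x := (app x).toCatHom
  naturality f := Cat.Hom.isoMk (iso f)
  naturality_naturality θ := catHom₂_ext (map₂ θ)
  naturality_id x := catHom₂_ext fun a => (mapId x a).trans (by
    change _ = _ ≫ 𝟙 _ ≫ 𝟙 _
    exact ((whisker_eq _ (Category.comp_id _)).trans (Category.comp_id _)).symm)
  naturality_comp f g := catHom₂_ext fun a => (mapComp f g a).trans (by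
    change _ = _ ≫ 𝟙 _ ≫ _ ≫ 𝟙 _ ≫ _ ≫ 𝟙 _
    rw [Category.id_comp, Category.id_comp, Category.comp_id]
    rfl)

/-- An invertible modification from its components. -/
def mkIso {η θ : F ⟶ G} (e : ∀ x, (η.app x).toFunctor ≅ (θ.app x).toFunctor)
    (h : ∀ {x y : B} (f : x ⟶ y) (a : F.obj x),
      (e y).hom.app ((F.map f).toFunctor.obj a) ≫ (nat θ f a).hom =
        (nat η f a).hom ≫ (G.map f).toFunctor.map ((e x).hom.app a)) : η ≅ θ :=
  Pseudofunctor.StrongTrans.isoMk (fun x => Cat.Hom.isoMk (e x)) fun f => catHom₂_ext (h f)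

/-- The components of an invertible modification. -/
def cmpIso {η θ : F ⟶ G} (σ : η ≅ θ) (x : B) (a : F.obj x) :
    (η.app x).toFunctor.obj a ≅ (θ.app x).toFunctor.obj a where
  hom := cmp σ.hom x a
  inv := cmp σ.inv x a
  hom_inv_id := congrArg (cmp · x a) σ.hom_inv_id
  inv_hom_id := congrArg (cmp · x a) σ.inv_hom_id

theorem cmp_natural {η θ : F ⟶ G} (σ : η ⟶ θ) (x : B) {a b : F.obj x} (t : a ⟶ b) :
    (η.app x).toFunctor.map t ≫ cmp σ x b = cmp σ x a ≫ (θ.app x).toFunctor.map t :=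
  (σ.as.app x).toNatTrans.naturality t

theorem cmp_nat {η θ : F ⟶ G} (σ : η ⟶ θ) {x y : B} (f : x ⟶ y) (a : F.obj x) :
    cmp σ y ((F.map f).toFunctor.obj a) ≫ (nat θ f a).hom =
      (nat η f a).hom ≫ (G.map f).toFunctor.map (cmp σ x a) :=
  modification_app σ f a

theorem nat_id_trans (F : Pseudofunctor B Cat.{v, u}) {x y : B} (f : x ⟶ y) (a : F.obj x) :
    (nat (𝟙 F) f a).hom = 𝟙 ((F.map f).toFunctor.obj a) :=
  id_naturality_app F f a

theorem nat_comp_trans {H : Pseudofunctor B Cat.{v, u}} (η : F ⟶ G) (θ : G ⟶ H) {x y : B}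
    (f : x ⟶ y) (a : F.obj x) : (nat (η ≫ θ) f a).hom =
      (θ.app y).toFunctor.map (nat η f a).hom ≫ (nat θ f ((η.app x).toFunctor.obj a)).hom :=
  comp_naturality_app η θ f a

/-- The projections have identity naturality constraints, so precomposing `η` and `θ` with them adds
nothing but images of identities. -/
theorem nat_prodMap {F' G' : Pseudofunctor B Cat.{v, u}} (η : F ⟶ G) (θ : F' ⟶ G') {x y : B}
    (f : x ⟶ y) (p : (prod F F').obj x) :
    (nat (prodMap η θ) f p).hom = Prod.mkHom (nat η f p.1).hom (nat θ f p.2).hom :=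
  Prod.ext
    ((nat_comp_trans (fst F F') η f p).trans ((eq_whisker ((η.app y).toFunctor.map_id _) _).trans
      (Category.id_comp _)))
    ((nat_comp_trans (snd F F') θ f p).trans ((eq_whisker ((θ.app y).toFunctor.map_id _) _).trans
      (Category.id_comp _)))

theorem nat_prodMap_comp {F' G' H : Pseudofunctor B Cat.{v, u}} (η : F ⟶ G) (θ : F' ⟶ G')
    (m : prod G G' ⟶ H) {x y : B} (f : x ⟶ y) (p : (prod F F').obj x) :
    (nat (prodMap η θ ≫ m) f p).hom =
      (m.app y).toFunctor.map (Prod.mkHom (nat η f p.1).hom (nat θ f p.2).hom) ≫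
        (nat m f ((η.app x).toFunctor.obj p.1, (θ.app x).toFunctor.obj p.2)).hom :=
  (nat_comp_trans _ _ f p).trans (eq_whisker (congrArg _ (nat_prodMap η θ f p)) _)

theorem nat_prodAssoc (F G H : Pseudofunctor B Cat.{v, u}) {x y : B} (f : x ⟶ y)
    (p : (prod (prod F G) H).obj x) : (nat (prodAssoc F G H) f p).hom = 𝟙 _ :=
  Prod.ext ((nat_comp_trans (fst _ _) (fst _ _) f p).trans (Category.comp_id _))
    (Prod.ext ((nat_comp_trans (fst _ _) (snd _ _) f p).trans (Category.comp_id _)) rfl)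

end Components

/-! ### Pentagon, triangle and modification axioms, evaluated on objects. -/

section Axioms

variable {B : Type u₁} [Bicategory.{w, v₁} B] {M : Pseudofunctor B Cat.{v, u}}
  {m : prod M M ⟶ M} {u : one ⟶ M}

/-- The 1-cells linked by each `eqToHom` agree definitionally on objects of a fibre, so the
`eqToHom`s have identity components and drop out. What is left is the pentagon of a monoidal
category in each fibre. -/
theorem pentagon_iff (α : prodMap m (𝟙 M) ≫ m ⟶ prodAssoc M M M ≫ prodMap (𝟙 M) m ≫ m) :
    Pentagon α ↔ ∀ (x : B) (p : (prod (prod (prod M M) M) M).obj x),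
      (m.app x).toFunctor.map (Prod.mkHom (cmp α x p.1) (𝟙 p.2)) ≫
        cmp α x ((p.1.1.1, (m.app x).toFunctor.obj (p.1.1.2, p.1.2)), p.2) ≫
          (m.app x).toFunctor.map (Prod.mkHom (𝟙 p.1.1.1) (cmp α x ((p.1.1.2, p.1.2), p.2))) =
      cmp α x (((m.app x).toFunctor.obj p.1.1, p.1.2), p.2) ≫
        cmp α x (p.1.1, (m.app x).toFunctor.obj (p.1.2, p.2)) := by
  refine cmp_eq_iff (fun x p => ?_) (fun x p => ?_)
  · exact cmp_comp (cmp_whiskerRight _ _ (cmp_prodMap₂ α (𝟙 (𝟙 M)) x p))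
      (cmp_eqToHom_comp _ (heq_of_eq (cmp_comp rfl (cmp_eqToHom_comp _ (heq_of_eq
        (cmp_whiskerRight _ _ (cmp_prodMap₂ (𝟙 (𝟙 M)) α x _)))))))
  · exact cmp_eqToHom_comp _ (heq_of_eq (cmp_comp rfl (cmp_eqToHom_comp _ (heq_of_eq
      (cmp_comp_eqToHom _ (heq_of_eq rfl))))))

theorem triangle_iff (α : prodMap m (𝟙 M) ≫ m ⟶ prodAssoc M M M ≫ prodMap (𝟙 M) m ≫ m)
    (l : prodMap u (𝟙 M) ≫ m ⟶ snd one M) (r : prodMap (𝟙 M) u ≫ m ⟶ fst M one) :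
    Triangle α l r ↔ ∀ (x : B) (p : (prod (prod M one) M).obj x),
      (m.app x).toFunctor.map (Prod.mkHom (cmp r x p.1) (𝟙 p.2)) =
        cmp α x ((p.1.1, (u.app x).toFunctor.obj p.1.2), p.2) ≫
          (m.app x).toFunctor.map (Prod.mkHom (𝟙 p.1.1) (cmp l x (p.1.2, p.2))) := by
  refine cmp_eq_iff (fun x p => ?_) (fun x p => ?_)
  · exact cmp_whiskerRight _ _ (cmp_prodMap₂ r (𝟙 (𝟙 M)) x p)
  · exact cmp_eqToHom_comp _ (heq_of_eq (cmp_comp rfl (cmp_eqToHom_comp _ (heq_of_eq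
      (cmp_comp_eqToHom _ (heq_of_eq (cmp_whiskerRight _ _
        (cmp_prodMap₂ (𝟙 (𝟙 M)) l x (p.1.1, (p.1.2, p.2))))))))))

/-- Together with `nat_assoc_source` this turns the modification axiom for the associativity
constraint at `f` into the associativity axiom of a monoidal functor with tensorator `nat m f`. The
reassociation 1-cell contributes an identity, being built from projections. -/
theorem nat_assoc_target {x y : B} (f : x ⟶ y) (p : (prod (prod M M) M).obj x) :
    (nat (prodAssoc M M M ≫ prodMap (𝟙 M) m ≫ m) f p).hom =
      (m.app y).toFunctor.map (Prod.mkHom (𝟙 ((M.map f).toFunctor.obj p.1.1))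
        (nat m f (p.1.2, p.2)).hom) ≫
        (nat m f (p.1.1, (m.app x).toFunctor.obj (p.1.2, p.2))).hom := by
  refine (nat_comp_trans _ _ f p).trans ((eq_whisker ((congrArg
    ((prodMap (𝟙 M) m ≫ m).app y).toFunctor.map (nat_prodAssoc M M M f p)).trans
      (((prodMap (𝟙 M) m ≫ m).app y).toFunctor.map_id _)) _).trans ((Category.id_comp _).trans ?_))
  refine (nat_prodMap_comp (𝟙 M) m m f (p.1.1, (p.1.2, p.2))).trans ?_
  rw [nat_id_trans]
  rfl

theorem nat_assoc_source {x y : B} (f : x ⟶ y) (p : (prod (prod M M) M).obj x) :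
    (nat (prodMap m (𝟙 M) ≫ m) f p).hom =
      (m.app y).toFunctor.map (Prod.mkHom (nat m f p.1).hom (𝟙 ((M.map f).toFunctor.obj p.2))) ≫
        (nat m f ((m.app x).toFunctor.obj p.1, p.2)).hom := by
  refine (nat_prodMap_comp m (𝟙 M) m f p).trans ?_
  rw [nat_id_trans]
  rfl

theorem nat_leftUnit_source {x y : B} (f : x ⟶ y) (p : (prod one M).obj x) :
    (nat (prodMap u (𝟙 M) ≫ m) f p).hom =
      (m.app y).toFunctor.map (Prod.mkHom (nat u f p.1).hom (𝟙 ((M.map f).toFunctor.obj p.2))) ≫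
        (nat m f ((u.app x).toFunctor.obj p.1, p.2)).hom := by
  refine (nat_prodMap_comp u (𝟙 M) m f p).trans ?_
  rw [nat_id_trans]
  rfl

theorem nat_rightUnit_source {x y : B} (f : x ⟶ y) (p : (prod M one).obj x) :
    (nat (prodMap (𝟙 M) u ≫ m) f p).hom =
      (m.app y).toFunctor.map (Prod.mkHom (𝟙 ((M.map f).toFunctor.obj p.1)) (nat u f p.2).hom) ≫
        (nat m f (p.1, (u.app x).toFunctor.obj p.2)).hom := by
  refine (nat_prodMap_comp (𝟙 M) u m f p).trans ?_
  rw [nat_id_trans]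
  rfl

end Axioms

/-! ### Monoidal categories and functors from tensor product data. -/

section Plain

/-- The monoidal category with a given tensor product functor, unit object and constraints. -/
abbrev monoidalOfTensor {C : Type u} [Category.{v} C] (m : C × C ⥤ C) (e : C)
    (α : ∀ a b c : C, m.obj (m.obj (a, b), c) ≅ m.obj (a, m.obj (b, c)))
    (l : ∀ a : C, m.obj (e, a) ≅ a) (r : ∀ a : C, m.obj (a, e) ≅ a)
    (hα : ∀ {a b c a' b' c' : C} (f : a ⟶ a') (g : b ⟶ b') (h : c ⟶ c'),
      m.map (Prod.mkHom (m.map (Prod.mkHom f g)) h) ≫ (α a' b' c').hom =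
        (α a b c).hom ≫ m.map (Prod.mkHom f (m.map (Prod.mkHom g h))))
    (hl : ∀ {a b : C} (f : a ⟶ b),
      m.map (Prod.mkHom (𝟙 e) f) ≫ (l b).hom = (l a).hom ≫ f)
    (hr : ∀ {a b : C} (f : a ⟶ b),
      m.map (Prod.mkHom f (𝟙 e)) ≫ (r b).hom = (r a).hom ≫ f)
    (pentagon : ∀ a b c d : C, m.map (Prod.mkHom (α a b c).hom (𝟙 d)) ≫
      (α a (m.obj (b, c)) d).hom ≫ m.map (Prod.mkHom (𝟙 a) (α b c d).hom) =
        (α (m.obj (a, b)) c d).hom ≫ (α a b (m.obj (c, d))).hom)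
    (triangle : ∀ a b : C, (α a e b).hom ≫ m.map (Prod.mkHom (𝟙 a) (l b).hom) =
      m.map (Prod.mkHom (r a).hom (𝟙 b))) : MonoidalCategory C :=
  letI : MonoidalCategoryStruct C :=
    { tensorObj a b := m.obj (a, b)
      whiskerLeft a _ _ f := m.map (Prod.mkHom (𝟙 a) f)
      whiskerRight f b := m.map (Prod.mkHom f (𝟙 b))
      tensorHom f g := m.map (Prod.mkHom f g)
      tensorUnit := e
      associator := α
      leftUnitor := l
      rightUnitor := r }
  .ofTensorHom (id_tensorHom_id := fun _ _ => m.map_id _)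
    (id_tensorHom := fun _ _ _ _ => rfl) (tensorHom_id := fun _ _ => rfl)
    (tensorHom_comp_tensorHom := fun f g h k => (map_split m f h g k).symm)
    (associator_naturality := hα) (leftUnitor_naturality := hl) (rightUnitor_naturality := hr)
    (pentagon := pentagon) (triangle := triangle)

open MonoidalCategory in
/-- A strong monoidal functor, from axioms in terms of tensor products of morphisms. -/
abbrev monoidalOfIso {C D : Type u} [Category.{v} C] [Category.{v} D] [MonoidalCategory C]
    [MonoidalCategory D] (F : C ⥤ D) (e : 𝟙_ D ≅ F.obj (𝟙_ C))
    (t : ∀ a b : C, F.obj a ⊗ F.obj b ≅ F.obj (a ⊗ b))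
    (natural : ∀ {a b a' b' : C} (f : a ⟶ b) (g : a' ⟶ b'),
      (F.map f ⊗ₘ F.map g) ≫ (t b b').hom = (t a a').hom ≫ F.map (f ⊗ₘ g))
    (assoc : ∀ a b c : C,
      ((t a b).hom ⊗ₘ 𝟙 (F.obj c)) ≫ (t (a ⊗ b) c).hom ≫ F.map (α_ a b c).hom =
        (α_ (F.obj a) (F.obj b) (F.obj c)).hom ≫ (𝟙 (F.obj a) ⊗ₘ (t b c).hom) ≫
          (t a (b ⊗ c)).hom)
    (left : ∀ a : C, (e.hom ⊗ₘ 𝟙 (F.obj a)) ≫ (t (𝟙_ C) a).hom ≫ F.map (λ_ a).hom =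
      (λ_ (F.obj a)).hom)
    (right : ∀ a : C, (𝟙 (F.obj a) ⊗ₘ e.hom) ≫ (t a (𝟙_ C)).hom ≫ F.map (ρ_ a).hom =
      (ρ_ (F.obj a)).hom) : F.Monoidal :=
  CategoryTheory.Functor.CoreMonoidal.toMonoidal
    { εIso := e
      μIso := t
      μIso_hom_natural_left f c := by
        rw [← tensorHom_id, ← tensorHom_id, ← F.map_id, natural]
      μIso_hom_natural_right c f := by
        rw [← id_tensorHom, ← id_tensorHom, ← F.map_id, natural]
      associativity a b c := by rw [← tensorHom_id, ← id_tensorHom, assoc]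
      left_unitality a := by rw [← tensorHom_id, left]
      right_unitality a := by rw [← id_tensorHom, right] }

end Plain

/-! ### Fibres of a pseudomonoid and their reindexing functors. -/

namespace Pseudomonoid

variable {B : Type u₁} [Bicategory.{w, v₁} B]

section
variable (P : Pseudomonoid (Pseudofunctor B Cat.{v, u})) (x : B)

/-- The tensor product functor on a fibre of a pseudomonoid. -/
abbrev tensor : ↑(P.pt.obj x) × ↑(P.pt.obj x) ⥤ ↑(P.pt.obj x) :=
  (P.mul.app x).toFunctor

/-- The monoidal structure on a fibre of a pseudomonoid. -/
abbrev fibreMonoidal : MonoidalCategory (P.pt.obj x) :=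
  monoidalOfTensor (C := P.pt.obj x) (P.tensor x) ((P.unit.app x).toFunctor.obj PUnit.unit)
    (fun a b c => cmpIso P.assoc x ((a, b), c))
    (fun a => cmpIso P.leftUnit x (PUnit.unit, a))
    (fun a => cmpIso P.rightUnit x (a, PUnit.unit))
    (fun {a b c a' b' c'} f g h => cmp_natural P.assoc.hom x
      (a := ((a, b), c)) (b := ((a', b'), c')) ((f, g), h))
    -- Naturality of the unit constraint at `(⟨⟩, f)` involves the image under the unit functor of
    -- the only morphism of the terminal category. That morphism is an identity, so its image is one
    -- by `map_id`.
    (fun {a b} f => (eq_whisker (congrArg (fun t => (P.tensor x).map (Prod.mkHom t f))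
        ((P.unit.app x).toFunctor.map_id PUnit.unit).symm) _).trans
      (cmp_natural P.leftUnit.hom x (a := (PUnit.unit, a)) (b := (PUnit.unit, b))
        (PUnit.unit, f)))
    (fun {a b} f => (eq_whisker (congrArg (fun t => (P.tensor x).map (Prod.mkHom f t))
        ((P.unit.app x).toFunctor.map_id PUnit.unit).symm) _).trans
      (cmp_natural P.rightUnit.hom x (a := (a, PUnit.unit)) (b := (b, PUnit.unit))
        (f, PUnit.unit)))
    (fun a b c d => (pentagon_iff _).1 P.pentagon x (((a, b), c), d))
    (fun a b => ((triangle_iff _ _ _).1 P.triangle x ((a, PUnit.unit), b)).symm)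

/-- A fibre of a pseudomonoid, as a monoidal category. -/
abbrev fibre : MonoidalCat.{v, u} :=
  letI := P.fibreMonoidal x
  ⟨P.pt.obj x⟩

variable {x} in
/-- Reindexing along a morphism, as a strong monoidal functor. -/
abbrev reindex {y : B} (f : x ⟶ y) : P.fibre x ⟶ P.fibre y :=
  letI := P.fibreMonoidal x
  letI := P.fibreMonoidal y
  letI := monoidalOfIso (C := P.pt.obj x) (D := P.pt.obj y)
    (P.pt.map f).toFunctor (nat P.unit f PUnit.unit)
    (fun a b => nat P.mul f (a, b))
    (fun {a b a' b'} s t => nat_natural P.mul f (a := (a, a')) (b := (b, b')) (s, t))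
    -- Associativity of the tensorator is the modification axiom `cmp_nat` for `P.assoc`, with the
    -- constraints of its source and target unfolded.
    (fun a b c => (Category.assoc _ _ _).symm.trans
      ((eq_whisker (nat_assoc_source f ((a, b), c)) _).symm.trans
        ((cmp_nat P.assoc.hom f ((a, b), c)).symm.trans
          (whisker_eq _ (nat_assoc_target f ((a, b), c))))))
    -- The target of the unit constraint is a projection, whose naturality constraint is an
    -- identity; hence the final `Category.comp_id`.
    (fun a => (Category.assoc _ _ _).symm.trans
      ((eq_whisker (nat_leftUnit_source f (PUnit.unit, a)) _).symm.trans
        ((cmp_nat P.leftUnit.hom f (PUnit.unit, a)).symm.trans (Category.comp_id _))))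
    (fun a => (Category.assoc _ _ _).symm.trans
      ((eq_whisker (nat_rightUnit_source f (a, PUnit.unit)) _).symm.trans
        ((cmp_nat P.rightUnit.hom f (a, PUnit.unit)).symm.trans (Category.comp_id _))))
  ⟨(P.pt.map f).toFunctor⟩

end

end Pseudomonoid

/-! ### Monoidal transformations from components. -/

namespace MonoidalCat

/-- A monoidal natural transformation, from components. -/
abbrev mkHom₂ {C D : MonoidalCat.{v, u}} {F G : C ⟶ D} (σ : F.functor ⟶ G.functor)
    (unit : Functor.LaxMonoidal.ε F.functor ≫ σ.app (MonoidalCategoryStruct.tensorUnit C.carrier) =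
      Functor.LaxMonoidal.ε G.functor)
    (tensor : ∀ a b : C.carrier, Functor.LaxMonoidal.μ F.functor a b ≫
      σ.app (MonoidalCategoryStruct.tensorObj a b) =
        MonoidalCategoryStruct.tensorHom (σ.app a) (σ.app b) ≫
          Functor.LaxMonoidal.μ G.functor a b) : F ⟶ G :=
  letI : σ.IsMonoidal := ⟨unit, tensor⟩
  ⟨σ⟩

/-- A monoidal natural isomorphism, from components. -/
abbrev mkIso {C D : MonoidalCat.{v, u}} {F G : C ⟶ D} (e : F.functor ≅ G.functor)
    (unit : Functor.LaxMonoidal.ε F.functor ≫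
      e.hom.app (MonoidalCategoryStruct.tensorUnit C.carrier) = Functor.LaxMonoidal.ε G.functor)
    (tensor : ∀ a b : C.carrier, Functor.LaxMonoidal.μ F.functor a b ≫
      e.hom.app (MonoidalCategoryStruct.tensorObj a b) =
        MonoidalCategoryStruct.tensorHom (e.hom.app a) (e.hom.app b) ≫
          Functor.LaxMonoidal.μ G.functor a b) : F ≅ G :=
  letI : e.hom.IsMonoidal := ⟨unit, tensor⟩
  isoMk e

/-- Being monoidal is a property of a natural transformation, so equations of 2-cells can be checked
on components. This is how laws already known in `Cat` are inherited by the monoidal versions. -/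
theorem hom₂_ext {C D : MonoidalCat.{v, u}} {F G : C ⟶ D} {σ τ : F ⟶ G}
    (h : ∀ a, (Hom₂.natTrans σ).app a = (Hom₂.natTrans τ).app a) : σ = τ :=
  Hom₂.ext (NatTrans.ext (funext h))

end MonoidalCat

/-! ### From pseudomonoids to pseudofunctors into monoidal categories. -/

namespace Pseudomonoid

variable {B : Type u₁} [Bicategory.{w, v₁} B]

/-- The pseudofunctor to monoidal categories given by the fibres of a pseudomonoid. -/
def toMonoidal (P : Pseudomonoid (Pseudofunctor B Cat.{v, u})) :
    Pseudofunctor B MonoidalCat.{v, u} where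
  obj x := P.fibre x
  map f := P.reindex f
  map₂ {_ y f g} θ := MonoidalCat.mkHom₂ (F := P.reindex f) (G := P.reindex g)
    (P.pt.map₂ θ).toNatTrans
    -- The source of `P.unit` is constant, so its action on `θ` is an identity and disappears under
    -- `map_id`.
    ((nat_map₂ P.unit θ PUnit.unit).symm.trans
      ((eq_whisker ((P.unit.app y).toFunctor.map_id _) _).trans (Category.id_comp _)))
    (fun a b => (nat_map₂ P.mul θ (a, b)).symm)
  mapId x := MonoidalCat.mkIso (F := P.reindex (𝟙 x)) (G := 𝟙 (P.fibre x))
    (Cat.Hom.toNatIso (P.pt.mapId x))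
    ((nat_id P.unit x PUnit.unit).trans ((P.unit.app x).toFunctor.map_id _))
    -- The tensorator of reindexing is `nat P.mul`; monoidality of `mapId`, and below of `mapComp`,
    -- is therefore the identity and composition axiom of pseudonaturality for `P.mul`.
    (fun a b => (nat_id P.mul x (a, b)).trans (Category.comp_id _).symm)
  mapComp {_ _ z} f g := MonoidalCat.mkIso (F := P.reindex (f ≫ g))
    (G := P.reindex f ≫ P.reindex g) (Cat.Hom.toNatIso (P.pt.mapComp f g))
    ((nat_comp P.unit f g PUnit.unit).trans
      ((eq_whisker ((P.unit.app z).toFunctor.map_id _) _).trans (Category.id_comp _)))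
    (fun a b => nat_comp P.mul f g (a, b))
  map₂_id f := MonoidalCat.hom₂_ext (catHom₂_congr (P.pt.map₂_id f))
  map₂_comp θ κ := MonoidalCat.hom₂_ext (catHom₂_congr (P.pt.map₂_comp θ κ))
  map₂_whisker_left f _ _ θ := MonoidalCat.hom₂_ext (catHom₂_congr (P.pt.map₂_whisker_left f θ))
  map₂_whisker_right θ f := MonoidalCat.hom₂_ext (catHom₂_congr (P.pt.map₂_whisker_right θ f))
  map₂_associator f g h := MonoidalCat.hom₂_ext (catHom₂_congr (P.pt.map₂_associator f g h))
  map₂_left_unitor f := MonoidalCat.hom₂_ext (catHom₂_congr (P.pt.map₂_left_unitor f))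
  map₂_right_unitor f := MonoidalCat.hom₂_ext (catHom₂_congr (P.pt.map₂_right_unitor f))

variable {P Q R : Pseudomonoid (Pseudofunctor B Cat.{v, u})}

/-- The action of a morphism of pseudomonoids on fibres. -/
abbrev Hom.fibre (f : Hom P Q) (x : B) : P.fibre x ⟶ Q.fibre x :=
  letI := P.fibreMonoidal x
  letI := Q.fibreMonoidal x
  letI := monoidalOfIso (C := P.pt.obj x) (D := Q.pt.obj x) (f.hom.app x).toFunctor
    (cmpIso f.unitIso x PUnit.unit)
    (fun a b => cmpIso f.mulIso x (a, b))
    (fun {a b a' b'} s t => cmp_natural f.mulIso.hom x (a := (a, a')) (b := (b, b')) (s, t))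
    -- The three coherence axioms of a strong monoidal functor are the three axioms of a morphism of
    -- pseudomonoids, taken at the component `x`.
    (fun a b c => (assocCompat_iff _ _ _).1 f.assoc_compat x ((a, b), c))
    (fun a => (leftUnitCompat_iff _ _ _ _).1 f.leftUnit_compat x (PUnit.unit, a))
    (fun a => (rightUnitCompat_iff _ _ _ _).1 f.rightUnit_compat x (a, PUnit.unit))
  ⟨(f.hom.app x).toFunctor⟩

/-- The transformation of pseudofunctors to monoidal categories given by a morphism of
pseudomonoids. -/
def Hom.toMonoidal (f : Hom P Q) : P.toMonoidal ⟶ Q.toMonoidal where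
  app x := f.fibre x
  naturality {x y} h := MonoidalCat.mkIso (F := P.reindex h ≫ f.fibre y)
    (G := f.fibre x ≫ Q.reindex h) (Cat.Hom.toNatIso (f.hom.naturality h))
    (by
      -- The modification axioms for `f.unitIso`, and below for `f.mulIso`, say that the naturality
      -- constraint of `f` at `h` respects units and tensor products. The constraints of composite
      -- 1-cells unfold to those of composite monoidal functors.
      have e := cmp_nat f.unitIso.hom h PUnit.unit
      exact (Category.assoc _ _ _).trans ((whisker_eq _
        (nat_comp_trans P.unit f.hom h PUnit.unit)).symm.trans e))
    (fun a b => by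
      have e := cmp_nat f.mulIso.hom h (a, b)
      exact (Category.assoc _ _ _).trans ((whisker_eq _
        (nat_comp_trans P.mul f.hom h (a, b))).symm.trans (e.trans ((eq_whisker
          (nat_prodMap_comp f.hom f.hom Q.mul h (a, b)) _).trans (Category.assoc _ _ _)))))
  naturality_naturality θ :=
    MonoidalCat.hom₂_ext (catHom₂_congr (f.hom.naturality_naturality θ))
  naturality_id x := MonoidalCat.hom₂_ext (catHom₂_congr (f.hom.naturality_id x))
  naturality_comp h k := MonoidalCat.hom₂_ext (catHom₂_congr (f.hom.naturality_comp h k))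

/-- The modification given by a 2-cell of pseudomonoids. -/
def Hom₂.toMonoidal {f g : Hom P Q} (σ : Hom₂ f g) : f.toMonoidal ⟶ g.toMonoidal where
  as :=
    { app x := MonoidalCat.mkHom₂ (F := f.fibre x) (G := g.fibre x) (σ.cell.as.app x).toNatTrans
        (σ.unit_app x PUnit.unit) (fun a b => (σ.mul_app x (a, b)).symm)
      naturality h := MonoidalCat.hom₂_ext (catHom₂_congr (σ.cell.as.naturality h)) }

end Pseudomonoid

/-! ### Strict 2-functors and 2-natural isomorphisms via heterogeneous equality. -/

section TwoFunctors

universe w₁ w₂ v₂ u₂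

variable {B : Type u₁} [Bicategory.{w₁, v₁} B] {C : Type u₂} [Bicategory.{w₂, v₂} C]

/-- A strict 2-functor preserves whiskering only after transport along the equations for its action
on 1-cells. Heterogeneous equality hides the transport and can be checked on components; this lemma
restores the `eqToHom` form. -/
theorem eq_conj_of_heq {a b : C} {f f' g g' : a ⟶ b} (e : f = f') (e' : g = g') {σ : f ⟶ g}
    {τ : f' ⟶ g'} (h : σ ≍ τ) : σ = eqToHom e ≫ τ ≫ eqToHom e'.symm := by
  subst e e'
  rw [eq_of_heq h, eqToHom_refl, eqToHom_refl, Category.id_comp, Category.comp_id]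

theorem comp_eqToHom_eq_of_heq {a b : C} {f f' g g' : a ⟶ b} (e : f = f') (e' : g = g')
    {σ : f ⟶ g} {τ : f' ⟶ g'} (h : σ ≍ τ) : σ ≫ eqToHom e' = eqToHom e ≫ τ := by
  subst e e'
  rw [eq_of_heq h, eqToHom_refl, eqToHom_refl, Category.id_comp, Category.comp_id]

/-- A 2-functor, from its actions and their strict compatibility with all operations. -/
def strictPseudofunctorMk [Strict B] [Strict C] (obj : B → C)
    (map : ∀ {a b : B}, (a ⟶ b) → (obj a ⟶ obj b))
    (map₂ : ∀ {a b : B} {f g : a ⟶ b}, (f ⟶ g) → (map f ⟶ map g))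
    (map₂_id : ∀ {a b : B} (f : a ⟶ b), map₂ (𝟙 f) = 𝟙 (map f))
    (map₂_comp : ∀ {a b : B} {f g h : a ⟶ b} (σ : f ⟶ g) (τ : g ⟶ h),
      map₂ (σ ≫ τ) = map₂ σ ≫ map₂ τ)
    (map_id : ∀ a : B, map (𝟙 a) = 𝟙 (obj a))
    (map_comp : ∀ {a b c : B} (f : a ⟶ b) (g : b ⟶ c), map (f ≫ g) = map f ≫ map g)
    (whiskerLeft : ∀ {a b c : B} (f : a ⟶ b) {g h : b ⟶ c} (σ : g ⟶ h),
      map₂ (f ◁ σ) ≍ map f ◁ map₂ σ)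
    (whiskerRight : ∀ {a b c : B} {f g : a ⟶ b} (σ : f ⟶ g) (h : b ⟶ c),
      map₂ (σ ▷ h) ≍ map₂ σ ▷ map h) : StrictPseudofunctor B C :=
  .mk''
    { obj
      map
      map₂
      map₂_id
      map₂_comp
      map_id
      map_comp
      map₂_whisker_left f _ _ σ :=
        eq_conj_of_heq (map_comp _ _) (map_comp _ _) (whiskerLeft f σ)
      map₂_whisker_right σ h :=
        eq_conj_of_heq (map_comp _ _) (map_comp _ _) (whiskerRight σ h) }

/-- A 2-natural isomorphism, from its components. -/
def twoNatIsoMk {F G : StrictPseudofunctor B C} (app : ∀ a : B, F.obj a ⟶ G.obj a)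
    (inv : ∀ a : B, G.obj a ⟶ F.obj a) (app_inv : ∀ a : B, app a ≫ inv a = 𝟙 (F.obj a))
    (inv_app : ∀ a : B, inv a ≫ app a = 𝟙 (G.obj a))
    (naturality : ∀ {a b : B} (f : a ⟶ b), F.map f ≫ app b = app a ≫ G.map f)
    (naturality₂ : ∀ {a b : B} {f g : a ⟶ b} (θ : f ⟶ g),
      F.map₂ θ ▷ app b ≍ app a ◁ G.map₂ θ) : TwoNatIso F G where
  app
  inv
  app_inv
  inv_app
  naturality
  naturality₂ θ := comp_eqToHom_eq_of_heq _ _ (naturality₂ θ)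

end TwoFunctors

/-! ### Strictness of the 2-category of pseudofunctors into monoidal categories. -/

namespace MonoidalCat

/-- The oplax constraints of a strong monoidal functor are inverse to the lax ones, so the lax ones
determine the whole structure. They are compared heterogeneously because their types depend on the
functor. -/
theorem hom_ext {C D : MonoidalCat.{v, u}} {F G : C ⟶ D} (h : F.functor = G.functor)
    (unit : Functor.LaxMonoidal.ε F.functor ≍ Functor.LaxMonoidal.ε G.functor)
    (tensor : ∀ a b : C.carrier,
      Functor.LaxMonoidal.μ F.functor a b ≍ Functor.LaxMonoidal.μ G.functor a b) : F = G := by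
  obtain ⟨F, mF⟩ := F
  obtain ⟨G, mG⟩ := G
  dsimp only at h
  subst h
  congr 1
  exact Functor.Monoidal.toLaxMonoidal_injective F (Functor.LaxMonoidal.ext (eq_of_heq unit)
    (funext fun a => funext fun b => eq_of_heq (tensor a b)))

section

variable {B : Type u₁} [Bicategory.{w, v₁} B] {P Q R : Pseudofunctor B MonoidalCat.{v, u}}

/-- The components of a modification. -/
def component {η θ : P ⟶ Q} (σ : η ⟶ θ) (x : B) (a : (P.obj x).carrier) :
    (η.app x).functor.obj a ⟶ (θ.app x).functor.obj a :=
  (Hom₂.natTrans (σ.as.app x)).app a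

theorem component_ext {η θ : P ⟶ Q} {σ τ : η ⟶ θ}
    (h : ∀ x a, component σ x a = component τ x a) : σ = τ :=
  Pseudofunctor.StrongTrans.homCategory.ext fun x => hom₂_ext (h x)

/-- Used where source and target agree only propositionally: once the 1-cells are identified,
2-cells are determined by their components, and in the applications these match definitionally. -/
theorem heq_of_component {η η' θ θ' : P ⟶ Q} (h : η = η') (h' : θ = θ') {σ : η ⟶ θ}
    {τ : η' ⟶ θ'} (H : ∀ x a, component σ x a ≍ component τ x a) : σ ≍ τ := by
  subst h h'
  exact heq_of_eq (component_ext fun x a => eq_of_heq (H x a))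

theorem component_eqToIso {η θ : P ⟶ Q} (h : η = θ) (x : B) (a : (P.obj x).carrier) :
    component (eqToIso h).hom x a = eqToHom (by rw [h]) := by
  subst h
  rfl

theorem component_whiskerLeft (η : P ⟶ Q) {θ κ : Q ⟶ R} (σ : θ ⟶ κ) (x : B)
    (a : (P.obj x).carrier) :
    component (η ◁ σ) x a = component σ x ((η.app x).functor.obj a) := rfl

theorem component_whiskerRight {η θ : P ⟶ Q} (σ : η ⟶ θ) (κ : Q ⟶ R) (x : B)
    (a : (P.obj x).carrier) :
    component (σ ▷ κ) x a = (κ.app x).functor.map (component σ x a) := rfl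

/-- The components of the naturality constraints of a pseudonatural transformation. -/
def naturalityApp (η : P ⟶ Q) {x y : B} (f : x ⟶ y) (a : (P.obj x).carrier) :
    (η.app y).functor.obj ((P.map f).functor.obj a) ⟶
      (Q.map f).functor.obj ((η.app x).functor.obj a) :=
  (Hom₂.natTrans (η.naturality f).hom).app a

theorem naturalityApp_id (P : Pseudofunctor B MonoidalCat.{v, u}) {x y : B} (f : x ⟶ y)
    (a : (P.obj x).carrier) :
    naturalityApp (𝟙 P) f a = 𝟙 ((P.map f).functor.obj a) :=
  Category.id_comp _

theorem naturalityApp_comp (η : P ⟶ Q) (θ : Q ⟶ R) {x y : B} (f : x ⟶ y)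
    (a : (P.obj x).carrier) : naturalityApp (η ≫ θ) f a =
      (θ.app y).functor.map (naturalityApp η f a) ≫
        naturalityApp θ f ((η.app x).functor.obj a) := by
  change 𝟙 _ ≫ (θ.app y).functor.map (naturalityApp η f a) ≫ 𝟙 _ ≫
    naturalityApp θ f ((η.app x).functor.obj a) ≫ 𝟙 _ = _
  rw [Category.id_comp, Category.id_comp, Category.comp_id]

theorem trans_ext {η θ : P ⟶ Q} (h : ∀ x, (η.app x).functor = (θ.app x).functor)
    (unit : ∀ x, Functor.LaxMonoidal.ε (η.app x).functor ≍
      Functor.LaxMonoidal.ε (θ.app x).functor)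
    (tensor : ∀ x (a b : (P.obj x).carrier), Functor.LaxMonoidal.μ (η.app x).functor a b ≍
      Functor.LaxMonoidal.μ (θ.app x).functor a b)
    (natural : ∀ {x y : B} (f : x ⟶ y) (a : (P.obj x).carrier),
      naturalityApp η f a ≍ naturalityApp θ f a) : η = θ := by
  obtain ⟨η, nη, _, _, _⟩ := η
  obtain ⟨θ, nθ, _, _, _⟩ := θ
  obtain rfl : η = θ := funext fun x => hom_ext (h x) (unit x) (tensor x)
  congr 1
  funext x y f
  exact Iso.ext (hom₂_ext fun a => eq_of_heq (natural f a))

/-- Pseudofunctors to monoidal categories, pseudonatural transformations and modifications form a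
2-category. -/
theorem strict : Strict (Pseudofunctor B MonoidalCat.{v, u}) where
  id_comp f := trans_ext (fun _ => rfl)
    -- The constraints of a composite are those of the second functor followed by the image of those
    -- of the first; here the first are identities.
    (fun x => heq_of_eq ((whisker_eq _ ((f.app x).functor.map_id _)).trans (Category.comp_id _)))
    (fun x a b => heq_of_eq
      ((whisker_eq _ ((f.app x).functor.map_id _)).trans (Category.comp_id _)))
    fun {x y} h a => heq_of_eq ((naturalityApp_comp _ _ _ _).trans
      ((eq_whisker ((congrArg (f.app y).functor.map (naturalityApp_id _ h a)).trans
        ((f.app y).functor.map_id _)) _).trans (Category.id_comp _)))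
  comp_id {P Q} f := trans_ext (fun _ => rfl)
    (fun x => heq_of_eq (Category.id_comp _)) (fun x a b => heq_of_eq (Category.id_comp _))
    fun {x y} h a => heq_of_eq ((naturalityApp_comp _ _ _ _).trans
      ((whisker_eq _ (naturalityApp_id Q h _)).trans (Category.comp_id _)))
  assoc f g h := trans_ext (fun _ => rfl)
    (fun x => heq_of_eq ((whisker_eq _ ((h.app x).functor.map_comp _ _)).trans
      (Category.assoc _ _ _).symm))
    (fun x a b => heq_of_eq ((whisker_eq _ ((h.app x).functor.map_comp _ _)).trans
      (Category.assoc _ _ _).symm))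
    fun {x y} k a => heq_of_eq <| by
      refine (naturalityApp_comp (f ≫ g) h k a).trans ((eq_whisker ((congrArg
        (h.app y).functor.map (naturalityApp_comp f g k a)).trans
          ((h.app y).functor.map_comp _ _)) _).trans ((Category.assoc _ _ _).trans ?_))
      exact (whisker_eq _ (naturalityApp_comp g h k _)).symm.trans
        (naturalityApp_comp f (g ≫ h) k a).symm
  -- The unitors and associators have identity components, and so does `eqToIso` because the 1-cells
  -- it relates agree definitionally on objects.
  leftUnitor_eqToIso f := Iso.ext (component_ext fun x a => by rw [component_eqToIso]; rfl)
  rightUnitor_eqToIso f := Iso.ext (component_ext fun x a => by rw [component_eqToIso]; rfl)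
  associator_eqToIso f g h := Iso.ext (component_ext fun x a => by rw [component_eqToIso]; rfl)

end

end MonoidalCat

/-! ### Strictness of the 2-category of pseudomonoids. -/

namespace Pseudomonoid

variable {B : Type u₁} [Bicategory.{w, v₁} B] {P Q : Pseudomonoid (Pseudofunctor B Cat.{v, u})}

theorem cell_eqToHom {f g : P ⟶ Q} (h : f = g) :
    Hom₂.cell (eqToHom h) = eqToHom (congrArg Hom.hom h) := by
  subst h
  rfl

/-- Pseudomonoids, strong morphisms and their 2-cells form a 2-category. -/
theorem strict : Strict (Pseudomonoid (Pseudofunctor B Cat.{v, u})) where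
  id_comp := Hom.id_comp
  comp_id := Hom.comp_id
  assoc := Hom.comp_assoc
  -- A structural isomorphism of pseudomonoids has as its cell the structural isomorphism of the
  -- ambient strict 2-category, which is an `eqToIso`; a 2-cell is determined by its cell.
  leftUnitor_eqToIso f := Iso.ext (Hom₂.ext ((congrArg Iso.hom
    (Strict.leftUnitor_eqToIso f.hom)).trans (cell_eqToHom (Hom.id_comp f)).symm))
  rightUnitor_eqToIso f := Iso.ext (Hom₂.ext ((congrArg Iso.hom
    (Strict.rightUnitor_eqToIso f.hom)).trans (cell_eqToHom (Hom.comp_id f)).symm))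
  associator_eqToIso f g h := Iso.ext (Hom₂.ext ((congrArg Iso.hom
    (Strict.associator_eqToIso f.hom g.hom h.hom)).trans
      (cell_eqToHom (Hom.comp_assoc f g h)).symm))

end Pseudomonoid

/-! ### The 2-functor from pseudomonoids to pseudofunctors into monoidal categories. -/

namespace Pseudomonoid

variable {B : Type u₁} [Bicategory.{w, v₁} B] {P Q R : Pseudomonoid (Pseudofunctor B Cat.{v, u})}

theorem Hom.ε_toMonoidal (f : Hom P Q) (x : B) :
    Functor.LaxMonoidal.ε (f.toMonoidal.app x).functor = cmp f.unitIso.hom x PUnit.unit := rfl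

theorem Hom.μ_toMonoidal (f : Hom P Q) (x : B) (a b : P.pt.obj x) :
    Functor.LaxMonoidal.μ (f.toMonoidal.app x).functor a b = cmp f.mulIso.hom x (a, b) := rfl

theorem Hom.cmp_mulIso_id (x : B) (p : (prod P.pt P.pt).obj x) :
    cmp (Hom.id P).mulIso.hom x p = 𝟙 ((P.mul.app x).toFunctor.obj p) :=
  cmp_idMulIso x p

theorem Hom.cmp_unitIso_id (x : B) (t : (one : Pseudofunctor B Cat.{v, u}).obj x) :
    cmp (Hom.id P).unitIso.hom x t = 𝟙 ((P.unit.app x).toFunctor.obj t) :=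
  cmp_idUnitIso x t

/-- The underlying functors and naturality constraints agree definitionally. Only the monoidal
constraints need an argument, as those of `Hom.id` are given by an `eqToIso`. -/
theorem Hom.toMonoidal_id (P : Pseudomonoid (Pseudofunctor B Cat.{v, u})) :
    (Hom.id P).toMonoidal = 𝟙 P.toMonoidal :=
  MonoidalCat.trans_ext (fun _ => rfl)
    (fun x => heq_of_eq ((Hom.ε_toMonoidal (Hom.id P) x).trans (Hom.cmp_unitIso_id x _)))
    (fun x a b => heq_of_eq ((Hom.μ_toMonoidal (Hom.id P) x a b).trans (Hom.cmp_mulIso_id x _)))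
    (fun _ _ => HEq.rfl)

/-- `compMulIso` and `compUnitIso` have as components exactly the constraints of a composite of
monoidal functors. -/
theorem Hom.toMonoidal_comp (f : Hom P Q) (g : Hom Q R) :
    (f.comp g).toMonoidal = f.toMonoidal ≫ g.toMonoidal :=
  MonoidalCat.trans_ext (fun _ => rfl)
    (fun x => heq_of_eq ((Hom.ε_toMonoidal (f.comp g) x).trans (cmp_compUnitIso f g x _)))
    (fun x a b => heq_of_eq ((Hom.μ_toMonoidal (f.comp g) x a b).trans (cmp_compMulIso f g x _)))
    (fun h a => heq_of_eq ((nat_comp_trans f.hom g.hom h a).trans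
      (MonoidalCat.naturalityApp_comp f.toMonoidal g.toMonoidal h a).symm))

variable (B) in
/-- The 2-functor from pseudomonoids to pseudofunctors to monoidal categories. -/
def toMonoidalFunctor : StrictPseudofunctor (Pseudomonoid (Pseudofunctor B Cat.{v, u}))
    (Pseudofunctor B MonoidalCat.{v, u}) :=
  haveI := Pseudomonoid.strict (B := B)
  haveI := MonoidalCat.strict (B := B)
  strictPseudofunctorMk toMonoidal Hom.toMonoidal Hom₂.toMonoidal
    (fun _ => MonoidalCat.component_ext fun _ _ => rfl)
    (fun _ _ => MonoidalCat.component_ext fun _ _ => rfl)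
    Hom.toMonoidal_id Hom.toMonoidal_comp
    -- Whiskering is computed by the same formula on components in both 2-categories.
    (fun _ _ _ _ => MonoidalCat.heq_of_component (Hom.toMonoidal_comp _ _)
      (Hom.toMonoidal_comp _ _) fun _ _ => HEq.rfl)
    (fun _ _ => MonoidalCat.heq_of_component (Hom.toMonoidal_comp _ _)
      (Hom.toMonoidal_comp _ _) fun _ _ => HEq.rfl)

end Pseudomonoid

/-! ### From pseudofunctors into monoidal categories back to pseudomonoids. -/

section Plain

open MonoidalCategory

variable {C D : Type u} [Category.{v} C] [Category.{v} D] [MonoidalCategory C]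
  [MonoidalCategory D]

/-- The axioms of pseudomonoids apply the multiplication to pairs of morphisms. The monoidal axioms
in this section are therefore rewritten with `⊗ₘ` and identities in place of whiskerings. -/
theorem tensorHom_leftUnitor {a b : C} (f : a ⟶ b) :
    (𝟙 (𝟙_ C) ⊗ₘ f) ≫ (λ_ b).hom = (λ_ a).hom ≫ f := by
  rw [id_tensorHom, MonoidalCategory.leftUnitor_naturality]

theorem tensorHom_rightUnitor {a b : C} (f : a ⟶ b) :
    (f ⊗ₘ 𝟙 (𝟙_ C)) ≫ (ρ_ b).hom = (ρ_ a).hom ≫ f := by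
  rw [tensorHom_id, MonoidalCategory.rightUnitor_naturality]

theorem pentagon_tensorHom (a b c d : C) :
    ((α_ a b c).hom ⊗ₘ 𝟙 d) ≫ (α_ a (b ⊗ c) d).hom ≫ (𝟙 a ⊗ₘ (α_ b c d).hom) =
      (α_ (a ⊗ b) c d).hom ≫ (α_ a b (c ⊗ d)).hom := by
  rw [tensorHom_id, id_tensorHom, MonoidalCategory.pentagon]

theorem triangle_tensorHom (a b : C) :
    ((ρ_ a).hom ⊗ₘ 𝟙 b) = (α_ a (𝟙_ C) b).hom ≫ (𝟙 a ⊗ₘ (λ_ b).hom) := by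
  rw [tensorHom_id, id_tensorHom, MonoidalCategory.triangle]

variable (F : C ⥤ D) [F.LaxMonoidal]

theorem tensorHom_associativity (a b c : C) :
    (Functor.LaxMonoidal.μ F a b ⊗ₘ 𝟙 (F.obj c)) ≫ Functor.LaxMonoidal.μ F (a ⊗ b) c ≫
        F.map (α_ a b c).hom =
      (α_ (F.obj a) (F.obj b) (F.obj c)).hom ≫
        (𝟙 (F.obj a) ⊗ₘ Functor.LaxMonoidal.μ F b c) ≫ Functor.LaxMonoidal.μ F a (b ⊗ c) := by
  rw [tensorHom_id, id_tensorHom, Functor.LaxMonoidal.associativity]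

theorem tensorHom_left_unitality (a : C) :
    (Functor.LaxMonoidal.ε F ⊗ₘ 𝟙 (F.obj a)) ≫ Functor.LaxMonoidal.μ F (𝟙_ C) a ≫
      F.map (λ_ a).hom = (λ_ (F.obj a)).hom := by
  rw [tensorHom_id, Functor.LaxMonoidal.left_unitality]

theorem tensorHom_right_unitality (a : C) :
    (𝟙 (F.obj a) ⊗ₘ Functor.LaxMonoidal.ε F) ≫ Functor.LaxMonoidal.μ F a (𝟙_ C) ≫
      F.map (ρ_ a).hom = (ρ_ (F.obj a)).hom := by
  rw [id_tensorHom, Functor.LaxMonoidal.right_unitality]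

end Plain

namespace MonoidalCat

variable {B : Type u₁} [Bicategory.{w, v₁} B]

theorem hom₂_congr {C D : MonoidalCat.{v, u}} {F G : C ⟶ D} {σ τ : F ⟶ G} (h : σ = τ)
    (a : C.carrier) : (Hom₂.natTrans σ).app a = (Hom₂.natTrans τ).app a := by rw [h]

/-- The natural isomorphism underlying a monoidal one. -/
abbrev toNatIso {C D : MonoidalCat.{v, u}} {F G : C ⟶ D} (e : F ≅ G) :
    F.functor ≅ G.functor where
  hom := Hom₂.natTrans e.hom
  inv := Hom₂.natTrans e.inv
  hom_inv_id := congrArg Hom₂.natTrans e.hom_inv_id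
  inv_hom_id := congrArg Hom₂.natTrans e.inv_hom_id

section

variable (P : Pseudofunctor B MonoidalCat.{v, u})

/-- The pseudofunctor to categories underlying a pseudofunctor to monoidal categories. -/
def underlying : Pseudofunctor B Cat.{v, u} where
  obj x := Cat.of (P.obj x).carrier
  map f := (P.map f).functor.toCatHom
  map₂ θ := (Hom₂.natTrans (P.map₂ θ)).toCatHom₂
  mapId x := Cat.Hom.isoMk (toNatIso (P.mapId x))
  mapComp f g := Cat.Hom.isoMk (toNatIso (P.mapComp f g))
  map₂_id f := catHom₂_ext (hom₂_congr (P.map₂_id f))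
  map₂_comp θ κ := catHom₂_ext (hom₂_congr (P.map₂_comp θ κ))
  map₂_whisker_left f _ _ θ := catHom₂_ext (hom₂_congr (P.map₂_whisker_left f θ))
  map₂_whisker_right θ f := catHom₂_ext (hom₂_congr (P.map₂_whisker_right θ f))
  map₂_associator f g h := catHom₂_ext (hom₂_congr (P.map₂_associator f g h))
  map₂_left_unitor f := catHom₂_ext (hom₂_congr (P.map₂_left_unitor f))
  map₂_right_unitor f := catHom₂_ext (hom₂_congr (P.map₂_right_unitor f))

/-- The multiplication given by tensor products. -/
def mulTrans : prod (underlying P) (underlying P) ⟶ underlying P :=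
  mkTrans (F := prod (underlying P) (underlying P)) (G := underlying P)
    (fun x => MonoidalCategory.tensor (P.obj x).carrier)
    (fun f => CategoryTheory.Functor.Monoidal.μNatIso (P.map f).functor)
    -- With the tensorators as constraints, the three pseudonaturality axioms are the monoidality of
    -- `map₂`, `mapId` and `mapComp`.
    (fun θ p => (NatTrans.IsMonoidal.tensor (τ := Hom₂.natTrans (P.map₂ θ)) p.1 p.2).symm)
    (fun x p => (NatTrans.IsMonoidal.tensor (τ := Hom₂.natTrans (P.mapId x).hom) p.1 p.2).trans
      (Category.comp_id _))
    (fun f g p => NatTrans.IsMonoidal.tensor (τ := Hom₂.natTrans (P.mapComp f g).hom) p.1 p.2)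

/-- The unit given by unit objects. -/
def unitTrans : (one : Pseudofunctor B Cat.{v, u}) ⟶ underlying P :=
  mkTrans (F := one) (G := underlying P)
    (fun x =>
      { obj _ := MonoidalCategoryStruct.tensorUnit (P.obj x).carrier
        -- A general unit 1-cell sends the morphism of the terminal category to an identity only by
        -- `map_id`, so rebuilding a pseudomonoid does not return its unit definitionally.
        map _ := 𝟙 _
        map_comp _ _ := (Category.comp_id _).symm })
    (fun f => NatIso.ofComponents
      (fun _ => CategoryTheory.Functor.Monoidal.εIso (P.map f).functor)
      (fun _ => (Category.id_comp _).trans ((whisker_eq _ ((P.map f).functor.map_id _)).trans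
        (Category.comp_id _)).symm))
    (fun θ _ => (Category.id_comp _).trans
      (NatTrans.IsMonoidal.unit (τ := Hom₂.natTrans (P.map₂ θ))).symm)
    (fun x _ => NatTrans.IsMonoidal.unit (τ := Hom₂.natTrans (P.mapId x).hom))
    (fun f g _ => (NatTrans.IsMonoidal.unit (τ := Hom₂.natTrans (P.mapComp f g).hom)).trans
      (Category.id_comp _).symm)

/-- The associativity constraint given by associators. -/
def assocMod : prodMap (mulTrans P) (𝟙 (underlying P)) ≫ mulTrans P ≅
    prodAssoc _ _ _ ≫ prodMap (𝟙 (underlying P)) (mulTrans P) ≫ mulTrans P :=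
  IndexedMonoidal.mkIso
    (fun x => NatIso.ofComponents
      (fun p => MonoidalCategoryStruct.associator (C := (P.obj x).carrier) p.1.1 p.1.2 p.2)
      (fun t => MonoidalCategory.associator_naturality (C := (P.obj x).carrier) t.1.1 t.1.2 t.2))
    -- The associators form a modification because each reindexing functor satisfies the
    -- associativity axiom.
    (fun f p => (whisker_eq _ (nat_assoc_target (m := mulTrans P) f p)).trans
      ((tensorHom_associativity (P.map f).functor p.1.1 p.1.2 p.2).symm.trans
        ((Category.assoc _ _ _).symm.trans (eq_whisker
          (nat_assoc_source (m := mulTrans P) f p) _).symm)))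

/-- The left unit constraint given by left unitors. -/
def leftUnitMod : prodMap (unitTrans P) (𝟙 (underlying P)) ≫ mulTrans P ≅ snd _ _ :=
  IndexedMonoidal.mkIso
    (fun x => NatIso.ofComponents
      (fun p => MonoidalCategoryStruct.leftUnitor (C := (P.obj x).carrier) p.2)
      (fun t => tensorHom_leftUnitor (C := (P.obj x).carrier) t.2))
    (fun f p => (Category.comp_id _).trans
      ((tensorHom_left_unitality (P.map f).functor p.2).symm.trans
        ((Category.assoc _ _ _).symm.trans (eq_whisker
          (nat_leftUnit_source (m := mulTrans P) (u := unitTrans P) f p) _).symm)))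

/-- The right unit constraint given by right unitors. -/
def rightUnitMod : prodMap (𝟙 (underlying P)) (unitTrans P) ≫ mulTrans P ≅ fst _ _ :=
  IndexedMonoidal.mkIso
    (fun x => NatIso.ofComponents
      (fun p => MonoidalCategoryStruct.rightUnitor (C := (P.obj x).carrier) p.1)
      (fun t => tensorHom_rightUnitor (C := (P.obj x).carrier) t.1))
    (fun f p => (Category.comp_id _).trans
      ((tensorHom_right_unitality (P.map f).functor p.1).symm.trans
        ((Category.assoc _ _ _).symm.trans (eq_whisker
          (nat_rightUnit_source (m := mulTrans P) (u := unitTrans P) f p) _).symm)))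

/-- The pseudomonoid given by a pseudofunctor to monoidal categories. -/
def toPseudomonoid : Pseudomonoid (Pseudofunctor B Cat.{v, u}) where
  pt := underlying P
  mul := mulTrans P
  unit := unitTrans P
  assoc := assocMod P
  leftUnit := leftUnitMod P
  rightUnit := rightUnitMod P
  pentagon := (pentagon_iff _).2 fun x p =>
    pentagon_tensorHom (C := (P.obj x).carrier) p.1.1.1 p.1.1.2 p.1.2 p.2
  triangle := (triangle_iff _ _ _).2 fun x p =>
    triangle_tensorHom (C := (P.obj x).carrier) p.1.1 p.2

end

section

variable {P Q R : Pseudofunctor B MonoidalCat.{v, u}}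

/-- The transformation underlying a transformation of pseudofunctors to monoidal categories. -/
def underlyingTrans (η : P ⟶ Q) : underlying P ⟶ underlying Q where
  app x := (η.app x).functor.toCatHom
  naturality f := Cat.Hom.isoMk (toNatIso (η.naturality f))
  naturality_naturality θ := catHom₂_ext (hom₂_congr (η.naturality_naturality θ))
  naturality_id x := catHom₂_ext (hom₂_congr (η.naturality_id x))
  naturality_comp f g := catHom₂_ext (hom₂_congr (η.naturality_comp f g))

/-- The multiplicativity constraint given by tensorators. -/
def mulMod (η : P ⟶ Q) : prodMap (underlyingTrans η) (underlyingTrans η) ≫ mulTrans Q ≅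
    mulTrans P ≫ underlyingTrans η :=
  IndexedMonoidal.mkIso
    (fun x => CategoryTheory.Functor.Monoidal.μNatIso (η.app x).functor)
    (fun {x y} f p => by
      refine (whisker_eq _ (nat_comp_trans (mulTrans P) (underlyingTrans η) f p)).trans (Eq.trans ?_
        (eq_whisker (nat_prodMap_comp (underlyingTrans η) (underlyingTrans η) (mulTrans Q) f p)
          _).symm)
      -- The tensorators of `η` form a modification because its naturality constraints are monoidal.
      have h := NatTrans.IsMonoidal.tensor (τ := Hom₂.natTrans (η.naturality f).hom) p.1 p.2
      exact (Category.assoc _ _ _).symm.trans (h.trans (Category.assoc _ _ _).symm))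

/-- The unit constraint of a strong monoidal transformation. -/
def unitMod (η : P ⟶ Q) : unitTrans Q ≅ unitTrans P ≫ underlyingTrans η :=
  IndexedMonoidal.mkIso
    (fun x => NatIso.ofComponents
      (fun _ => CategoryTheory.Functor.Monoidal.εIso (η.app x).functor)
      (fun _ => (Category.id_comp _).trans ((whisker_eq _ ((η.app x).functor.map_id _)).trans
        (Category.comp_id _)).symm))
    (fun {x y} f p => by
      refine (whisker_eq _ (nat_comp_trans (unitTrans P) (underlyingTrans η) f p)).trans ?_
      have h := NatTrans.IsMonoidal.unit (τ := Hom₂.natTrans (η.naturality f).hom)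
      exact (Category.assoc _ _ _).symm.trans h)

/-- The morphism of pseudomonoids given by a transformation of pseudofunctors to monoidal
categories. -/
def homToPseudomonoid (η : P ⟶ Q) : toPseudomonoid P ⟶ toPseudomonoid Q where
  hom := underlyingTrans η
  mulIso := mulMod η
  unitIso := unitMod η
  assoc_compat := (assocCompat_iff _ _ _).2 fun x p =>
    tensorHom_associativity (η.app x).functor p.1.1 p.1.2 p.2
  leftUnit_compat := (leftUnitCompat_iff _ _ _ _).2 fun x p =>
    tensorHom_left_unitality (η.app x).functor p.2
  rightUnit_compat := (rightUnitCompat_iff _ _ _ _).2 fun x p =>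
    tensorHom_right_unitality (η.app x).functor p.1

/-- The 2-cell of pseudomonoids given by a modification. -/
def hom₂ToPseudomonoid {η θ : P ⟶ Q} (σ : η ⟶ θ) :
    homToPseudomonoid η ⟶ homToPseudomonoid θ :=
  Pseudomonoid.Hom₂.mk'
    { as :=
        { app x := (Hom₂.natTrans (σ.as.app x)).toCatHom₂
          naturality f := catHom₂_ext (hom₂_congr (σ.as.naturality f)) } }
    (fun x p => (NatTrans.IsMonoidal.tensor (τ := Hom₂.natTrans (σ.as.app x)) p.1 p.2).symm)
    (fun x _ => NatTrans.IsMonoidal.unit (τ := Hom₂.natTrans (σ.as.app x)))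

end

end MonoidalCat

variable {B : Type u₁} [Bicategory.{w, v₁} B]

namespace Pseudomonoid

variable {P Q R : Pseudomonoid (Pseudofunctor B Cat.{v, u})}

/-- The components of a 2-cell of pseudomonoids. -/
def component {f g : P ⟶ Q} (σ : f ⟶ g) (x : B) (a : P.pt.obj x) :
    (f.hom.app x).toFunctor.obj a ⟶ (g.hom.app x).toFunctor.obj a :=
  cmp (Hom₂.cell σ) x a

theorem component_ext {f g : P ⟶ Q} {σ τ : f ⟶ g}
    (h : ∀ x a, component σ x a = component τ x a) : σ = τ :=
  Hom₂.ext (cmp_ext h)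

theorem heq_of_component {f f' g g' : P ⟶ Q} (h : f = f') (h' : g = g') {σ : f ⟶ g}
    {τ : f' ⟶ g'} (H : ∀ x a, component σ x a ≍ component τ x a) : σ ≍ τ := by
  subst h h'
  exact heq_of_eq (component_ext fun x a => eq_of_heq (H x a))

theorem component_whiskerLeft (f : P ⟶ Q) {g g' : Q ⟶ R} (σ : g ⟶ g') (x : B) (a : P.pt.obj x) :
    component (f ◁ σ) x a = component σ x ((f.hom.app x).toFunctor.obj a) := rfl

theorem component_whiskerRight {f f' : P ⟶ Q} (σ : f ⟶ f') (g : Q ⟶ R) (x : B)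
    (a : P.pt.obj x) :
    component (σ ▷ g) x a = (g.hom.app x).toFunctor.map (component σ x a) := rfl

end Pseudomonoid

/-! ### The 2-functor back to pseudomonoids. -/

namespace MonoidalCat

variable {P Q R : Pseudofunctor B MonoidalCat.{v, u}}

theorem homToPseudomonoid_id (P : Pseudofunctor B MonoidalCat.{v, u}) :
    homToPseudomonoid (𝟙 P) = 𝟙 (toPseudomonoid P) :=
  Pseudomonoid.Hom.ext'
    (IndexedMonoidal.trans_ext (fun _ => rfl) fun f a => heq_of_eq
      ((naturalityApp_id P f a).trans (nat_id_trans (underlying P) f a).symm))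
    (fun x p => heq_of_eq (Pseudomonoid.cmp_idMulIso (P := toPseudomonoid P) x p).symm)
    (fun x t => heq_of_eq (Pseudomonoid.cmp_idUnitIso (P := toPseudomonoid P) x t).symm)

theorem homToPseudomonoid_comp (η : P ⟶ Q) (θ : Q ⟶ R) :
    homToPseudomonoid (η ≫ θ) = homToPseudomonoid η ≫ homToPseudomonoid θ :=
  Pseudomonoid.Hom.ext'
    (IndexedMonoidal.trans_ext (fun _ => rfl) fun f a => heq_of_eq
      ((naturalityApp_comp η θ f a).trans
        (nat_comp_trans (underlyingTrans η) (underlyingTrans θ) f a).symm))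
    (fun x p => heq_of_eq (Pseudomonoid.cmp_compMulIso (homToPseudomonoid η)
      (homToPseudomonoid θ) x p).symm)
    (fun x t => heq_of_eq (Pseudomonoid.cmp_compUnitIso (homToPseudomonoid η)
      (homToPseudomonoid θ) x t).symm)

theorem component_hom₂ToPseudomonoid {η θ : P ⟶ Q} (σ : η ⟶ θ) (x : B)
    (a : (P.obj x).carrier) :
    Pseudomonoid.component (hom₂ToPseudomonoid σ) x a = component σ x a := rfl

/-- Both sides are the component of `σ` at the image of `a` under `η`. -/
theorem component_hom₂ToPseudomonoid_whiskerLeft (η : P ⟶ Q) {θ κ : Q ⟶ R} (σ : θ ⟶ κ) (x : B)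
    (a : (P.obj x).carrier) : Pseudomonoid.component (hom₂ToPseudomonoid (η ◁ σ)) x a ≍
      Pseudomonoid.component (homToPseudomonoid η ◁ hom₂ToPseudomonoid σ) x a :=
  (heq_of_eq (component_hom₂ToPseudomonoid (η ◁ σ) x a)).trans
    (heq_of_eq (Pseudomonoid.component_whiskerLeft (homToPseudomonoid η)
      (hom₂ToPseudomonoid σ) x a)).symm

theorem component_hom₂ToPseudomonoid_whiskerRight {η θ : P ⟶ Q} (σ : η ⟶ θ) (κ : Q ⟶ R) (x : B)
    (a : (P.obj x).carrier) : Pseudomonoid.component (hom₂ToPseudomonoid (σ ▷ κ)) x a ≍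
      Pseudomonoid.component (hom₂ToPseudomonoid σ ▷ homToPseudomonoid κ) x a :=
  (heq_of_eq (component_hom₂ToPseudomonoid (σ ▷ κ) x a)).trans
    (heq_of_eq (Pseudomonoid.component_whiskerRight (hom₂ToPseudomonoid σ)
      (homToPseudomonoid κ) x a)).symm

variable (B) in
/-- The 2-functor from pseudofunctors to monoidal categories to pseudomonoids. -/
def toPseudomonoidFunctor : StrictPseudofunctor (Pseudofunctor B MonoidalCat.{v, u})
    (Pseudomonoid (Pseudofunctor B Cat.{v, u})) :=
  haveI := Pseudomonoid.strict (B := B)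
  haveI := MonoidalCat.strict (B := B)
  strictPseudofunctorMk toPseudomonoid homToPseudomonoid hom₂ToPseudomonoid
    (fun _ => Pseudomonoid.component_ext fun _ _ => rfl)
    (fun _ _ => Pseudomonoid.component_ext fun _ _ => rfl)
    homToPseudomonoid_id homToPseudomonoid_comp
    (fun η θ κ σ => Pseudomonoid.heq_of_component (homToPseudomonoid_comp η θ)
      (homToPseudomonoid_comp η κ) (component_hom₂ToPseudomonoid_whiskerLeft η σ))
    (fun {_ _ _ η θ} σ κ => Pseudomonoid.heq_of_component (homToPseudomonoid_comp η κ)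
      (homToPseudomonoid_comp θ κ) (component_hom₂ToPseudomonoid_whiskerRight σ κ))

end MonoidalCat

/-! ### The unit: a pseudomonoid and the one rebuilt from its fibres. -/

section Plain

variable {C : Type*} [Category C]

theorem AssocEq.of_eq_id (m : C × C ⥤ C)
    {α β : ∀ p : (C × C) × C, m.obj (m.obj p.1, p.2) ⟶ m.obj (p.1.1, m.obj (p.1.2, p.2))}
    {φ : ∀ p : C × C, m.obj p ⟶ m.obj p} (hα : ∀ p, α p = β p) (h : ∀ p, φ p = 𝟙 (m.obj p)) :
    AssocEq m m (𝟭 C) α β φ := by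
  obtain rfl : φ = _ := funext h
  obtain rfl : α = _ := funext hα
  exact AssocEq.id m α

end Plain

namespace MonoidalCat

variable (P : Pseudofunctor B MonoidalCat.{v, u}) (x : B)

theorem cmp_assoc (a b c : (P.obj x).carrier) :
    cmp (toPseudomonoid P).assoc.hom x ((a, b), c) =
      (MonoidalCategoryStruct.associator (C := (P.obj x).carrier) a b c).hom := rfl

theorem cmp_leftUnit (a : (P.obj x).carrier) :
    cmp (toPseudomonoid P).leftUnit.hom x (PUnit.unit, a) =
      (MonoidalCategoryStruct.leftUnitor (C := (P.obj x).carrier) a).hom := rfl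

theorem cmp_rightUnit (a : (P.obj x).carrier) :
    cmp (toPseudomonoid P).rightUnit.hom x (a, PUnit.unit) =
      (MonoidalCategoryStruct.rightUnitor (C := (P.obj x).carrier) a).hom := rfl

end MonoidalCat

namespace Pseudomonoid

section

variable (P : Pseudomonoid (Pseudofunctor B Cat.{v, u}))

/-- The identity, as a transformation to the pseudofunctor formed from the fibres. -/
def toFibresTrans : P.pt ⟶ MonoidalCat.underlying P.toMonoidal := 𝟙 P.pt

/-- The identity, as a transformation from the pseudofunctor formed from the fibres. -/
def ofFibresTrans : MonoidalCat.underlying P.toMonoidal ⟶ P.pt := 𝟙 P.pt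

/-- `P.pt` and the pseudofunctor rebuilt from its fibres agree definitionally, so `toFibresTrans` is
an identity 1-cell whose type records the change of description. -/
theorem nat_toFibresTrans {x y : B} (f : x ⟶ y) (a : P.pt.obj x) :
    (nat P.toFibresTrans f a).hom = 𝟙 ((P.pt.map f).toFunctor.obj a) :=
  nat_id_trans P.pt f a

theorem nat_ofFibresTrans {x y : B} (f : x ⟶ y) (a : P.pt.obj x) :
    (nat P.ofFibresTrans f a).hom = 𝟙 ((P.pt.map f).toFunctor.obj a) :=
  nat_id_trans P.pt f a

/-- The multiplicativity constraint of the identity to the pseudomonoid formed from the fibres. -/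
def toFibresMulIso : prodMap P.toFibresTrans P.toFibresTrans ≫ MonoidalCat.mulTrans P.toMonoidal ≅
    P.mul ≫ P.toFibresTrans :=
  -- The tensor product of the fibre is `P.tensor x` again. After cancelling identities, both sides
  -- of the modification axiom are `nat P.mul f p`.
  IndexedMonoidal.mkIso (fun x => Iso.refl (P.tensor x)) (fun {x y} f p => by
    refine (whisker_eq _ ((nat_comp_trans P.mul P.toFibresTrans f p).trans
      (whisker_eq _ (P.nat_toFibresTrans f _)))).trans (.trans ?_ (eq_whisker
        ((nat_prodMap_comp P.toFibresTrans P.toFibresTrans (MonoidalCat.mulTrans P.toMonoidal)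
          f p).trans (eq_whisker
          ((congrArg₂ (fun s t => (P.mul.app y).toFunctor.map (Prod.mkHom s t))
            (P.nat_toFibresTrans f p.1) (P.nat_toFibresTrans f p.2)).trans
              ((P.mul.app y).toFunctor.map_id _)) _)) _).symm)
    exact (Category.id_comp _).trans ((Category.comp_id _).trans ((whisker_eq _
      ((P.pt.map f).toFunctor.map_id _)).trans ((Category.comp_id _).trans
        (Category.id_comp _))).symm))

/-- The multiplicativity constraint of the identity from the pseudomonoid formed from the fibres. -/
def ofFibresMulIso : prodMap P.ofFibresTrans P.ofFibresTrans ≫ P.mul ≅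
    MonoidalCat.mulTrans P.toMonoidal ≫ P.ofFibresTrans :=
  IndexedMonoidal.mkIso (fun x => Iso.refl (P.tensor x)) (fun {x y} f p => by
    refine (whisker_eq _ ((nat_comp_trans (MonoidalCat.mulTrans P.toMonoidal)
      P.ofFibresTrans f p).trans
      (whisker_eq _ (P.nat_ofFibresTrans f _)))).trans (.trans ?_ (eq_whisker
        ((nat_prodMap_comp P.ofFibresTrans P.ofFibresTrans P.mul f p).trans (eq_whisker
          ((congrArg₂ (fun s t => (P.mul.app y).toFunctor.map (Prod.mkHom s t))
            (P.nat_ofFibresTrans f p.1) (P.nat_ofFibresTrans f p.2)).trans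
              ((P.mul.app y).toFunctor.map_id _)) _)) _).symm)
    exact (Category.id_comp _).trans ((Category.comp_id _).trans ((whisker_eq _
      ((P.pt.map f).toFunctor.map_id _)).trans ((Category.comp_id _).trans
        (Category.id_comp _))).symm))

/-- The unit constraint of the identity to the pseudomonoid formed from the fibres. -/
def toFibresUnitIso : MonoidalCat.unitTrans P.toMonoidal ≅ P.unit ≫ P.toFibresTrans :=
  IndexedMonoidal.mkIso (F := one)
    -- The two unit functors agree on objects, but on morphisms only through `map_id`; hence a
    -- natural isomorphism with identity components.
    (fun x => NatIso.ofComponents (fun _ => Iso.refl _) (fun {_ _} _ => (Category.comp_id _).trans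
      (((P.unit.app x).toFunctor.map_id _).symm.trans (Category.id_comp _).symm)))
    (fun f _ => (Category.id_comp _).trans ((nat_comp_trans P.unit P.toFibresTrans f _).trans
      ((whisker_eq _ (P.nat_toFibresTrans f _)).trans ((Category.comp_id _).trans
      ((whisker_eq _ ((P.pt.map f).toFunctor.map_id _)).trans (Category.comp_id _)).symm))))

/-- The unit constraint of the identity from the pseudomonoid formed from the fibres. -/
def ofFibresUnitIso : P.unit ≅ MonoidalCat.unitTrans P.toMonoidal ≫ P.ofFibresTrans :=
  IndexedMonoidal.mkIso (F := one)
    (fun x => NatIso.ofComponents (fun _ => Iso.refl _) (fun {_ _} _ => (Category.comp_id _).trans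
      (((P.unit.app x).toFunctor.map_id _).trans (Category.id_comp _).symm)))
    (fun f _ => (Category.id_comp _).trans
      ((nat_comp_trans (MonoidalCat.unitTrans P.toMonoidal) P.ofFibresTrans f _).trans
      ((whisker_eq _ (P.nat_ofFibresTrans f _)).trans ((Category.comp_id _).trans
      ((whisker_eq _ ((P.pt.map f).toFunctor.map_id _)).trans (Category.comp_id _)).symm))))

theorem cmp_toFibresMulIso (x : B) (p : (prod P.pt P.pt).obj x) :
    cmp P.toFibresMulIso.hom x p = 𝟙 ((P.mul.app x).toFunctor.obj p) := rfl

theorem cmp_ofFibresMulIso (x : B) (p : (prod P.pt P.pt).obj x) :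
    cmp P.ofFibresMulIso.hom x p = 𝟙 ((P.mul.app x).toFunctor.obj p) := rfl

theorem cmp_toFibresUnitIso (x : B) (t : (one : Pseudofunctor B Cat.{v, u}).obj x) :
    cmp P.toFibresUnitIso.hom x t = 𝟙 ((P.unit.app x).toFunctor.obj t) := rfl

theorem cmp_ofFibresUnitIso (x : B) (t : (one : Pseudofunctor B Cat.{v, u}).obj x) :
    cmp P.ofFibresUnitIso.hom x t = 𝟙 ((P.unit.app x).toFunctor.obj t) := rfl

theorem associator_fibre (x : B) (a b c : P.pt.obj x) :
    (MonoidalCategoryStruct.associator (C := (P.toMonoidal.obj x).carrier) a b c).hom =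
      cmp P.assoc.hom x ((a, b), c) := rfl

theorem leftUnitor_fibre (x : B) (a : P.pt.obj x) :
    (MonoidalCategoryStruct.leftUnitor (C := (P.toMonoidal.obj x).carrier) a).hom =
      cmp P.leftUnit.hom x (PUnit.unit, a) := rfl

theorem rightUnitor_fibre (x : B) (a : P.pt.obj x) :
    (MonoidalCategoryStruct.rightUnitor (C := (P.toMonoidal.obj x).carrier) a).hom =
      cmp P.rightUnit.hom x (a, PUnit.unit) := rfl

/-- The round trip stores the associativity constraint as the associators of the fibres and then
reads it back. -/
theorem cmp_assoc_fibres (x : B) (p : (prod (prod P.pt P.pt) P.pt).obj x) :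
    cmp (MonoidalCat.toPseudomonoid P.toMonoidal).assoc.hom x p = cmp P.assoc.hom x p :=
  (MonoidalCat.cmp_assoc P.toMonoidal x p.1.1 p.1.2 p.2).trans
    (P.associator_fibre x p.1.1 p.1.2 p.2)

theorem cmp_leftUnit_fibres (x : B) (p : (prod one P.pt).obj x) :
    cmp (MonoidalCat.toPseudomonoid P.toMonoidal).leftUnit.hom x p =
      cmp P.leftUnit.hom x p :=
  (MonoidalCat.cmp_leftUnit P.toMonoidal x p.2).trans (P.leftUnitor_fibre x p.2)

theorem cmp_rightUnit_fibres (x : B) (p : (prod P.pt one).obj x) :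
    cmp (MonoidalCat.toPseudomonoid P.toMonoidal).rightUnit.hom x p =
      cmp P.rightUnit.hom x p :=
  (MonoidalCat.cmp_rightUnit P.toMonoidal x p.1).trans (P.rightUnitor_fibre x p.1)

end
end Pseudomonoid

section Plain

variable {T C : Type*} [Category T] [Category C]

/-- Applied to the original and the rebuilt unit functor. The axiom involves these only on objects,
so their agreement on objects is enough to reduce to `LeftUnitEq.id`. -/
theorem LeftUnitEq.of_eq_id (m : C × C ⥤ C) (u w : T ⥤ C) (hw : ∀ t, w.obj t = u.obj t)
    {l : ∀ p : T × C, m.obj (u.obj p.1, p.2) ⟶ p.2}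
    {l' : ∀ p : T × C, m.obj (w.obj p.1, p.2) ⟶ p.2}
    {φ : ∀ p : C × C, m.obj p ⟶ m.obj p} {φ₀ : ∀ t, w.obj t ⟶ u.obj t}
    (hl : ∀ p, l' p ≍ l p) (h : ∀ p, φ p = 𝟙 (m.obj p)) (h₀ : ∀ t, φ₀ t ≍ 𝟙 (u.obj t)) :
    LeftUnitEq m m u w (𝟭 C) l l' φ φ₀ := by
  -- Splitting the functor lets its object part be replaced by `u.obj` while its action on morphisms
  -- stays arbitrary.
  obtain ⟨w, _, _, _⟩ := w
  dsimp only at hw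
  obtain rfl : w = u.obj := funext hw
  obtain rfl : φ = _ := funext h
  obtain rfl : φ₀ = _ := funext fun t => eq_of_heq (h₀ t)
  obtain rfl : l' = l := funext fun p => eq_of_heq (hl p)
  exact LeftUnitEq.id m u _

theorem RightUnitEq.of_eq_id (m : C × C ⥤ C) (u w : T ⥤ C) (hw : ∀ t, w.obj t = u.obj t)
    {r : ∀ p : C × T, m.obj (p.1, u.obj p.2) ⟶ p.1}
    {r' : ∀ p : C × T, m.obj (p.1, w.obj p.2) ⟶ p.1}
    {φ : ∀ p : C × C, m.obj p ⟶ m.obj p} {φ₀ : ∀ t, w.obj t ⟶ u.obj t}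
    (hr : ∀ p, r' p ≍ r p) (h : ∀ p, φ p = 𝟙 (m.obj p)) (h₀ : ∀ t, φ₀ t ≍ 𝟙 (u.obj t)) :
    RightUnitEq m m u w (𝟭 C) r r' φ φ₀ := by
  obtain ⟨w, _, _, _⟩ := w
  dsimp only at hw
  obtain rfl : w = u.obj := funext hw
  obtain rfl : φ = _ := funext h
  obtain rfl : φ₀ = _ := funext fun t => eq_of_heq (h₀ t)
  obtain rfl : r' = r := funext fun p => eq_of_heq (hr p)
  exact RightUnitEq.id m u _

end Plain

namespace Pseudomonoid

section

variable (P : Pseudomonoid (Pseudofunctor B Cat.{v, u}))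

theorem toFibres_assocCompat :
    AssocCompat P.assoc.hom (MonoidalCat.toPseudomonoid P.toMonoidal).assoc.hom
    P.toFibresMulIso.hom :=
  (assocCompat_iff _ _ _).2 fun x => AssocEq.of_eq_id (C := P.pt.obj x)
    (P.tensor x) (fun p => (P.cmp_assoc_fibres x p).symm) (P.cmp_toFibresMulIso x)

theorem toFibres_leftUnitCompat :
    LeftUnitCompat P.leftUnit.hom (MonoidalCat.toPseudomonoid P.toMonoidal).leftUnit.hom
    P.toFibresMulIso.hom P.toFibresUnitIso.hom :=
  (leftUnitCompat_iff _ _ _ _).2 fun x => LeftUnitEq.of_eq_id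
    (T := onePseudo.obj x) (C := P.pt.obj x) (P.tensor x) (P.unit.app x).toFunctor
    ((MonoidalCat.unitTrans P.toMonoidal).app x).toFunctor (fun _ => rfl)
    (fun p => heq_of_eq (P.cmp_leftUnit_fibres x p)) (P.cmp_toFibresMulIso x)
    (fun t => heq_of_eq (P.cmp_toFibresUnitIso x t))

theorem toFibres_rightUnitCompat :
    RightUnitCompat P.rightUnit.hom (MonoidalCat.toPseudomonoid P.toMonoidal).rightUnit.hom
    P.toFibresMulIso.hom P.toFibresUnitIso.hom :=
  (rightUnitCompat_iff _ _ _ _).2 fun x => RightUnitEq.of_eq_id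
    (T := onePseudo.obj x) (C := P.pt.obj x) (P.tensor x) (P.unit.app x).toFunctor
    ((MonoidalCat.unitTrans P.toMonoidal).app x).toFunctor (fun _ => rfl)
    (fun p => heq_of_eq (P.cmp_rightUnit_fibres x p)) (P.cmp_toFibresMulIso x)
    (fun t => heq_of_eq (P.cmp_toFibresUnitIso x t))

/-- The identity, as a morphism to the pseudomonoid formed from the fibres. -/
def toFibres : P ⟶ (MonoidalCat.toPseudomonoid P.toMonoidal) where
  hom := P.toFibresTrans
  mulIso := P.toFibresMulIso
  unitIso := P.toFibresUnitIso
  assoc_compat := P.toFibres_assocCompat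
  leftUnit_compat := P.toFibres_leftUnitCompat
  rightUnit_compat := P.toFibres_rightUnitCompat

theorem ofFibres_assocCompat :
    AssocCompat (MonoidalCat.toPseudomonoid P.toMonoidal).assoc.hom P.assoc.hom
    P.ofFibresMulIso.hom :=
  (assocCompat_iff _ _ _).2 fun x => AssocEq.of_eq_id (C := P.pt.obj x)
    (P.tensor x) (fun p => (P.cmp_assoc_fibres x p)) (P.cmp_ofFibresMulIso x)

theorem ofFibres_leftUnitCompat :
    LeftUnitCompat (MonoidalCat.toPseudomonoid P.toMonoidal).leftUnit.hom P.leftUnit.hom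
    P.ofFibresMulIso.hom P.ofFibresUnitIso.hom :=
  (leftUnitCompat_iff _ _ _ _).2 fun x => LeftUnitEq.of_eq_id
    (T := onePseudo.obj x) (C := P.pt.obj x) (P.tensor x)
    ((MonoidalCat.unitTrans P.toMonoidal).app x).toFunctor
    (P.unit.app x).toFunctor (fun _ => rfl)
    (fun p => heq_of_eq (P.cmp_leftUnit_fibres x p).symm) (P.cmp_ofFibresMulIso x)
    (fun t => heq_of_eq (P.cmp_ofFibresUnitIso x t))

theorem ofFibres_rightUnitCompat :
    RightUnitCompat (MonoidalCat.toPseudomonoid P.toMonoidal).rightUnit.hom P.rightUnit.hom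
    P.ofFibresMulIso.hom P.ofFibresUnitIso.hom :=
  (rightUnitCompat_iff _ _ _ _).2 fun x => RightUnitEq.of_eq_id
    (T := onePseudo.obj x) (C := P.pt.obj x) (P.tensor x)
    ((MonoidalCat.unitTrans P.toMonoidal).app x).toFunctor
    (P.unit.app x).toFunctor (fun _ => rfl)
    (fun p => heq_of_eq (P.cmp_rightUnit_fibres x p).symm) (P.cmp_ofFibresMulIso x)
    (fun t => heq_of_eq (P.cmp_ofFibresUnitIso x t))

/-- The identity, as a morphism from the pseudomonoid formed from the fibres. -/
def ofFibres : (MonoidalCat.toPseudomonoid P.toMonoidal) ⟶ P where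
  hom := P.ofFibresTrans
  mulIso := P.ofFibresMulIso
  unitIso := P.ofFibresUnitIso
  assoc_compat := P.ofFibres_assocCompat
  leftUnit_compat := P.ofFibres_leftUnitCompat
  rightUnit_compat := P.ofFibres_rightUnitCompat

end
end Pseudomonoid

namespace MonoidalCat

variable {P Q : Pseudofunctor B MonoidalCat.{v, u}} (η : P ⟶ Q)

theorem nat_underlyingTrans {x y : B} (f : x ⟶ y) (a : (P.obj x).carrier) :
    (nat (underlyingTrans η) f a).hom = naturalityApp η f a := rfl

theorem cmp_mulIso_homToPseudomonoid (x : B) (a b : (P.obj x).carrier) :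
    cmp (homToPseudomonoid η).mulIso.hom x (a, b) =
      Functor.LaxMonoidal.μ (η.app x).functor a b := rfl

theorem cmp_unitIso_homToPseudomonoid (x : B) (t : (one : Pseudofunctor B Cat.{v, u}).obj x) :
    cmp (homToPseudomonoid η).unitIso.hom x t =
      Functor.LaxMonoidal.ε (η.app x).functor := rfl

end MonoidalCat

namespace Pseudomonoid

section

variable {P Q R : Pseudomonoid (Pseudofunctor B Cat.{v, u})}

theorem naturalityApp_toMonoidal (f : P ⟶ Q) {x y : B} (h : x ⟶ y) (a : P.pt.obj x) :
    MonoidalCat.naturalityApp (Hom.toMonoidal f) h a = (nat f.hom h a).hom := rfl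

theorem cmp_mulIso_one (P : Pseudomonoid (Pseudofunctor B Cat.{v, u})) (x : B)
    (p : (prod P.pt P.pt).obj x) :
    cmp (Hom.mulIso (𝟙 P)).hom x p = 𝟙 ((P.mul.app x).toFunctor.obj p) :=
  Hom.cmp_mulIso_id x p

theorem cmp_unitIso_one (P : Pseudomonoid (Pseudofunctor B Cat.{v, u})) (x : B)
    (t : (one : Pseudofunctor B Cat.{v, u}).obj x) :
    cmp (Hom.unitIso (𝟙 P)).hom x t = 𝟙 ((P.unit.app x).toFunctor.obj t) :=
  Hom.cmp_unitIso_id x t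

theorem cmp_mulIso_comp (f : P ⟶ Q) (g : Q ⟶ R) (x : B) (p : (prod P.pt P.pt).obj x) :
    cmp (f ≫ g).mulIso.hom x p =
      cmp g.mulIso.hom x ((f.hom.app x).toFunctor.obj p.1, (f.hom.app x).toFunctor.obj p.2) ≫
        (g.hom.app x).toFunctor.map (cmp f.mulIso.hom x p) :=
  cmp_compMulIso f g x p

theorem cmp_unitIso_comp (f : P ⟶ Q) (g : Q ⟶ R) (x : B)
    (t : (one : Pseudofunctor B Cat.{v, u}).obj x) : cmp (f ≫ g).unitIso.hom x t =
      cmp g.unitIso.hom x t ≫ (g.hom.app x).toFunctor.map (cmp f.unitIso.hom x t) :=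
  cmp_compUnitIso f g x t

end

section

variable (P : Pseudomonoid (Pseudofunctor B Cat.{v, u}))

theorem cmp_mulIso_toFibres (x : B) (p : (prod P.pt P.pt).obj x) :
    cmp P.toFibres.mulIso.hom x p = 𝟙 ((P.mul.app x).toFunctor.obj p) := rfl

theorem cmp_unitIso_toFibres (x : B) (t : (one : Pseudofunctor B Cat.{v, u}).obj x) :
    cmp P.toFibres.unitIso.hom x t = 𝟙 ((P.unit.app x).toFunctor.obj t) := rfl

theorem cmp_mulIso_ofFibres (x : B) (p : (prod P.pt P.pt).obj x) :
    cmp P.ofFibres.mulIso.hom x p = 𝟙 ((P.mul.app x).toFunctor.obj p) := rfl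

theorem cmp_unitIso_ofFibres (x : B) (t : (one : Pseudofunctor B Cat.{v, u}).obj x) :
    cmp P.ofFibres.unitIso.hom x t = 𝟙 ((P.unit.app x).toFunctor.obj t) := rfl

theorem toFibres_ofFibres_hom : P.toFibresTrans ≫ P.ofFibresTrans = 𝟙 P.pt := Strict.comp_id _

theorem ofFibres_toFibres_hom :
    P.ofFibresTrans ≫ P.toFibresTrans = 𝟙 (MonoidalCat.underlying P.toMonoidal) :=
  Strict.comp_id _

theorem toFibres_ofFibres : P.toFibres ≫ P.ofFibres = 𝟙 P :=
  Hom.ext' P.toFibres_ofFibres_hom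
    (fun x p => (heq_of_eq ((cmp_mulIso_comp P.toFibres P.ofFibres x p).trans ((eq_whisker
      (P.cmp_mulIso_ofFibres x p) _).trans
        ((Category.id_comp _).trans (P.cmp_mulIso_toFibres x p))))).trans
          (heq_of_eq (P.cmp_mulIso_one x p)).symm)
    (fun x t => (heq_of_eq ((cmp_unitIso_comp P.toFibres P.ofFibres x t).trans ((eq_whisker
      (P.cmp_unitIso_ofFibres x t) _).trans
        ((Category.id_comp _).trans (P.cmp_unitIso_toFibres x t))))).trans
          (heq_of_eq (P.cmp_unitIso_one x t)).symm)

theorem ofFibres_toFibres : P.ofFibres ≫ P.toFibres = 𝟙 (MonoidalCat.toPseudomonoid P.toMonoidal) :=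
  Hom.ext' P.ofFibres_toFibres_hom
    (fun x p => (heq_of_eq ((cmp_mulIso_comp P.ofFibres P.toFibres x p).trans ((eq_whisker
      (P.cmp_mulIso_toFibres x p) _).trans
        ((Category.id_comp _).trans (P.cmp_mulIso_ofFibres x p))))).trans
          (heq_of_eq (cmp_mulIso_one (MonoidalCat.toPseudomonoid P.toMonoidal) x p)).symm)
    (fun x t => (heq_of_eq ((cmp_unitIso_comp P.ofFibres P.toFibres x t).trans ((eq_whisker
      (P.cmp_unitIso_toFibres x t) _).trans
        ((Category.id_comp _).trans (P.cmp_unitIso_ofFibres x t))))).trans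
          (heq_of_eq (cmp_unitIso_one (MonoidalCat.toPseudomonoid P.toMonoidal) x t)).symm)

end

section

variable {P Q : Pseudomonoid (Pseudofunctor B Cat.{v, u})}

/-- Composing with an identity 1-cell on either side leaves the constraints of `f`, up to images of
identities. -/
theorem toFibres_naturality_hom (f : P ⟶ Q) : f.hom ≫ Q.toFibresTrans =
    P.toFibresTrans ≫ MonoidalCat.underlyingTrans (Hom.toMonoidal f) :=
  IndexedMonoidal.trans_ext (fun _ => rfl) fun {_ y} h a => heq_of_eq
    (((nat_comp_trans f.hom Q.toFibresTrans h a).trans ((whisker_eq _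
      (Q.nat_toFibresTrans h _)).trans (Category.comp_id _))).trans
    ((nat_comp_trans P.toFibresTrans (MonoidalCat.underlyingTrans (Hom.toMonoidal f)) h a).trans
      ((eq_whisker ((congrArg (f.hom.app y).toFunctor.map (P.nat_toFibresTrans h a)).trans
        ((f.hom.app y).toFunctor.map_id _)) _).trans ((Category.id_comp _).trans
          ((MonoidalCat.nat_underlyingTrans (Hom.toMonoidal f) h a).trans
            (naturalityApp_toMonoidal f h a))))).symm)

theorem toFibres_naturality (f : P ⟶ Q) : f ≫ Q.toFibres =
    P.toFibres ≫ MonoidalCat.homToPseudomonoid (Hom.toMonoidal f) :=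
  Hom.ext' (toFibres_naturality_hom f)
    (fun x p => (heq_of_eq ((cmp_mulIso_comp f Q.toFibres x p).trans ((eq_whisker
      (Q.cmp_mulIso_toFibres x _) _).trans (Category.id_comp _)))).trans
      (heq_of_eq ((cmp_mulIso_comp P.toFibres
        (MonoidalCat.homToPseudomonoid (Hom.toMonoidal f)) x p).trans ((whisker_eq _
          ((congrArg (f.hom.app x).toFunctor.map (P.cmp_mulIso_toFibres x p)).trans
            ((f.hom.app x).toFunctor.map_id _))).trans ((Category.comp_id _).trans
              ((MonoidalCat.cmp_mulIso_homToPseudomonoid (Hom.toMonoidal f) x p.1 p.2).trans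
                (Hom.μ_toMonoidal f x p.1 p.2)))))).symm)
    (fun x t => (heq_of_eq ((cmp_unitIso_comp f Q.toFibres x t).trans ((eq_whisker
      (Q.cmp_unitIso_toFibres x _) _).trans (Category.id_comp _)))).trans
      (heq_of_eq ((cmp_unitIso_comp P.toFibres
        (MonoidalCat.homToPseudomonoid (Hom.toMonoidal f)) x t).trans ((whisker_eq _
          ((congrArg (f.hom.app x).toFunctor.map (P.cmp_unitIso_toFibres x t)).trans
            ((f.hom.app x).toFunctor.map_id _))).trans ((Category.comp_id _).trans
              ((MonoidalCat.cmp_unitIso_homToPseudomonoid (Hom.toMonoidal f) x t).trans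
                (Hom.ε_toMonoidal f x)))))).symm)

/-- On components both sides are those of `σ`, since `toFibres` acts as the identity on objects and
morphisms. -/
theorem toFibres_naturality₂ {f g : P ⟶ Q} (σ : f ⟶ g) :
    σ ▷ Q.toFibres ≍
      P.toFibres ◁ MonoidalCat.hom₂ToPseudomonoid (Hom₂.toMonoidal σ) :=
  heq_of_component (toFibres_naturality f) (toFibres_naturality g) fun x a =>
    (heq_of_eq (component_whiskerRight σ Q.toFibres x a)).trans
      (heq_of_eq (component_whiskerLeft P.toFibres
        (MonoidalCat.hom₂ToPseudomonoid (Hom₂.toMonoidal σ)) x a)).symm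

end

variable (B) in
/-- The unit of the equivalence between pseudomonoids and pseudofunctors to monoidal categories. -/
def unitTwoNatIso : TwoNatIso
    (StrictPseudofunctor.id (Pseudomonoid (Pseudofunctor B Cat.{v, u})))
    ((toMonoidalFunctor B).comp (MonoidalCat.toPseudomonoidFunctor B)) :=
  twoNatIsoMk toFibres ofFibres toFibres_ofFibres ofFibres_toFibres toFibres_naturality
    toFibres_naturality₂

end Pseudomonoid

/-! ### The counit: a pseudofunctor into monoidal categories and the one rebuilt from it. -/

section Plain

open MonoidalCategory

variable {C : Type u} [Category.{v} C] [MonoidalCategory C]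

/-- This and the next two are the coherence axioms of the identity functor with identity
constraints, in the shape required by `monoidalOfIso`. -/
theorem tensorHom_associativity_id (a b c : C) :
    (𝟙 (a ⊗ b) ⊗ₘ 𝟙 c) ≫ 𝟙 ((a ⊗ b) ⊗ c) ≫ (α_ a b c).hom =
      (α_ a b c).hom ≫ (𝟙 a ⊗ₘ 𝟙 (b ⊗ c)) ≫ 𝟙 (a ⊗ b ⊗ c) := by
  simp

theorem tensorHom_left_unitality_id (a : C) :
    (𝟙 (𝟙_ C) ⊗ₘ 𝟙 a) ≫ 𝟙 (𝟙_ C ⊗ a) ≫ (λ_ a).hom = (λ_ a).hom := by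
  simp

theorem tensorHom_right_unitality_id (a : C) :
    (𝟙 a ⊗ₘ 𝟙 (𝟙_ C)) ≫ 𝟙 (a ⊗ 𝟙_ C) ≫ (ρ_ a).hom = (ρ_ a).hom := by
  simp

end Plain

namespace MonoidalCat

section

variable (P : Pseudofunctor B MonoidalCat.{v, u}) (x : B)

/-- The identity, as a functor from a fibre of the pseudomonoid formed from a pseudofunctor to
monoidal categories. -/
def ofFibreFunctor : ((toPseudomonoid P).toMonoidal.obj x).carrier ⥤ (P.obj x).carrier :=
  𝟭 (P.obj x).carrier

/-- The identity, as a strong monoidal functor from a fibre of the pseudomonoid formed from a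
pseudofunctor to monoidal categories. -/
def ofFibre : (toPseudomonoid P).toMonoidal.obj x ⟶ P.obj x where
  functor := ofFibreFunctor P x
  -- The rebuilt fibre has the same `⊗ₘ`, unit and constraints, but its whiskerings are tensor
  -- products with identities, which agree with the original ones only by a monoidal law. The
  -- comparison is thus an identity functor with identity constraints between two presentations.
  monoidal := monoidalOfIso (C := ((toPseudomonoid P).toMonoidal.obj x).carrier)
    (D := (P.obj x).carrier)
    (ofFibreFunctor P x) (Iso.refl _) (fun _ _ => Iso.refl _)
    (fun _ _ => (Category.comp_id _).trans (Category.id_comp _).symm)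
    (tensorHom_associativity_id (C := (P.obj x).carrier))
    (tensorHom_left_unitality_id (C := (P.obj x).carrier))
    (tensorHom_right_unitality_id (C := (P.obj x).carrier))

/-- The identity, as a functor to a fibre of the pseudomonoid formed from a pseudofunctor to
monoidal categories. -/
def toFibreFunctor : (P.obj x).carrier ⥤ ((toPseudomonoid P).toMonoidal.obj x).carrier :=
  𝟭 (P.obj x).carrier

/-- The identity, as a strong monoidal functor to a fibre of the pseudomonoid formed from a
pseudofunctor to monoidal categories. -/
def toFibre : P.obj x ⟶ (toPseudomonoid P).toMonoidal.obj x where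
  functor := toFibreFunctor P x
  monoidal := monoidalOfIso (C := (P.obj x).carrier)
    (D := ((toPseudomonoid P).toMonoidal.obj x).carrier)
    (toFibreFunctor P x) (Iso.refl _) (fun _ _ => Iso.refl _)
    (fun _ _ => (Category.comp_id _).trans (Category.id_comp _).symm)
    (tensorHom_associativity_id (C := (P.obj x).carrier))
    (tensorHom_left_unitality_id (C := (P.obj x).carrier))
    (tensorHom_right_unitality_id (C := (P.obj x).carrier))

end

end MonoidalCat

namespace MonoidalCat

section

variable (P : Pseudofunctor B MonoidalCat.{v, u}) {x y : B} (f : x ⟶ y)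

/-- The naturality constraint of the identity from the fibres. -/
def ofFibreNatural : (toPseudomonoid P).toMonoidal.map f ≫ ofFibre P y ≅
    ofFibre P x ≫ P.map f :=
  mkIso (Iso.refl (P.map f).functor)
    -- Both sides reduce to the unit constraint, and in the next condition to the tensorator, of
    -- `P.map f`.
    ((Category.comp_id _).trans ((Category.id_comp _).trans ((whisker_eq _
      ((P.map f).functor.map_id _)).trans (Category.comp_id _)).symm))
    (fun _ _ => (Category.comp_id _).trans ((Category.id_comp _).trans ((eq_whisker
      (MonoidalCategory.id_tensorHom_id _ _) _).trans ((Category.id_comp _).trans ((whisker_eq _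
      ((P.map f).functor.map_id _)).trans (Category.comp_id _)))).symm))

/-- The naturality constraint of the identity to the fibres. -/
def toFibreNatural : P.map f ≫ toFibre P y ≅
    toFibre P x ≫ (toPseudomonoid P).toMonoidal.map f :=
  mkIso (Iso.refl (P.map f).functor)
    ((Category.comp_id _).trans ((Category.id_comp _).trans ((whisker_eq _
      ((P.map f).functor.map_id _)).trans (Category.comp_id _)).symm))
    (fun _ _ => (Category.comp_id _).trans ((Category.id_comp _).trans ((eq_whisker
      (MonoidalCategory.id_tensorHom_id (C := (P.obj y).carrier) _ _) _).trans
        ((Category.id_comp _).trans ((whisker_eq _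
          ((P.map f).functor.map_id _)).trans (Category.comp_id _)))).symm))

end

variable (P : Pseudofunctor B MonoidalCat.{v, u})

/-- The identity from the fibres. -/
def ofFibres : (toPseudomonoid P).toMonoidal ⟶ P where
  app := ofFibre P
  naturality f := ofFibreNatural P f
  naturality_naturality θ := hom₂_ext fun a => (Category.comp_id _).trans (Category.id_comp _).symm
  naturality_id x := hom₂_ext fun a => by
    -- All unitors, and below all associators and constraints of the comparison, have identity
    -- components, leaving the structure of `P` on both sides.
    change 𝟙 _ ≫ (Hom₂.natTrans (P.mapId x).hom).app a =
      (Hom₂.natTrans (P.mapId x).hom).app a ≫ 𝟙 _ ≫ 𝟙 _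
    simp
  naturality_comp f g := hom₂_ext fun a => by
    change 𝟙 _ ≫ (Hom₂.natTrans (P.mapComp f g).hom).app a =
      (Hom₂.natTrans (P.mapComp f g).hom).app a ≫ 𝟙 _ ≫ 𝟙 _ ≫ 𝟙 _ ≫
        (P.map g).functor.map (𝟙 _) ≫ 𝟙 _
    simp
    exact (Category.comp_id _).symm

/-- The identity to the fibres. -/
def toFibres : P ⟶ (toPseudomonoid P).toMonoidal where
  app := toFibre P
  naturality f := toFibreNatural P f
  naturality_naturality θ := hom₂_ext fun a => (Category.comp_id _).trans (Category.id_comp _).symm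
  naturality_id x := hom₂_ext fun a => by
    change 𝟙 _ ≫ (Hom₂.natTrans (P.mapId x).hom).app a =
      (Hom₂.natTrans (P.mapId x).hom).app a ≫ 𝟙 _ ≫ 𝟙 _
    simp
  naturality_comp f g := hom₂_ext fun a => by
    change 𝟙 _ ≫ (Hom₂.natTrans (P.mapComp f g).hom).app a =
      (Hom₂.natTrans (P.mapComp f g).hom).app a ≫ 𝟙 _ ≫ 𝟙 _ ≫ 𝟙 _ ≫
        (P.map g).functor.map (𝟙 _) ≫ 𝟙 _
    simp
    exact (Category.comp_id _).symm

theorem naturalityApp_ofFibres {x y : B} (f : x ⟶ y) (a : (P.obj x).carrier) :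
    naturalityApp (ofFibres P) f a = 𝟙 ((P.map f).functor.obj a) := rfl

theorem naturalityApp_toMonoidal {Q : Pseudofunctor B MonoidalCat.{v, u}} (η : P ⟶ Q) {x y : B}
    (f : x ⟶ y) (a : (P.obj x).carrier) :
    naturalityApp (Pseudomonoid.Hom.toMonoidal (homToPseudomonoid η)) f a =
      naturalityApp η f a := rfl

theorem ofFibres_toFibres : ofFibres P ≫ toFibres P = 𝟙 (toPseudomonoid P).toMonoidal :=
  trans_ext (fun _ => rfl) (fun _ => heq_of_eq (Category.id_comp _))
    (fun _ _ _ => heq_of_eq (Category.id_comp _))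
    fun f a => (heq_of_eq ((naturalityApp_comp (ofFibres P) (toFibres P) f a).trans
      (Category.id_comp _))).trans
        (heq_of_eq (naturalityApp_id (toPseudomonoid P).toMonoidal f a)).symm

theorem toFibres_ofFibres : toFibres P ≫ ofFibres P = 𝟙 P :=
  trans_ext (fun _ => rfl) (fun _ => heq_of_eq (Category.id_comp _))
    (fun _ _ _ => heq_of_eq (Category.id_comp _))
    fun f a => (heq_of_eq ((naturalityApp_comp (toFibres P) (ofFibres P) f a).trans
      (Category.id_comp _))).trans (heq_of_eq (naturalityApp_id P f a)).symm

section

variable {P} {Q : Pseudofunctor B MonoidalCat.{v, u}}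

/-- The comparison 1-cells have identity functors and identity constraints, so both composites carry
the functors and constraints of `η`. -/
theorem ofFibres_naturality (η : P ⟶ Q) :
    Pseudomonoid.Hom.toMonoidal (homToPseudomonoid η) ≫ ofFibres Q = ofFibres P ≫ η :=
  trans_ext (fun _ => rfl)
    (fun x => heq_of_eq ((Category.id_comp _).trans ((whisker_eq _
      ((η.app x).functor.map_id _)).trans (Category.comp_id _)).symm))
    (fun x _ _ => heq_of_eq ((Category.id_comp _).trans ((whisker_eq _
      ((η.app x).functor.map_id _)).trans (Category.comp_id _)).symm))
    fun {_ y} f a => (heq_of_eq ((naturalityApp_comp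
      (Pseudomonoid.Hom.toMonoidal (homToPseudomonoid η)) (ofFibres Q) f a).trans
        ((whisker_eq _ (naturalityApp_ofFibres Q f _)).trans ((Category.comp_id _).trans
          (naturalityApp_toMonoidal P η f a))))).trans
      (heq_of_eq ((naturalityApp_comp (ofFibres P) η f a).trans ((eq_whisker ((congrArg
        (η.app y).functor.map (naturalityApp_ofFibres P f a)).trans
          ((η.app y).functor.map_id _)) _).trans (Category.id_comp _)))).symm

theorem ofFibres_naturality₂ {η θ : P ⟶ Q} (σ : η ⟶ θ) :
    Pseudomonoid.Hom₂.toMonoidal (hom₂ToPseudomonoid σ) ▷ ofFibres Q ≍ ofFibres P ◁ σ :=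
  heq_of_component (ofFibres_naturality η) (ofFibres_naturality θ) fun x a =>
    (heq_of_eq (component_whiskerRight (Pseudomonoid.Hom₂.toMonoidal (hom₂ToPseudomonoid σ))
      (ofFibres Q) x a)).trans (heq_of_eq (component_whiskerLeft (ofFibres P) σ x a)).symm

end

variable (B) in
/-- The counit of the equivalence between pseudomonoids and pseudofunctors to monoidal
categories. -/
def counitTwoNatIso : TwoNatIso
    ((toPseudomonoidFunctor B).comp (Pseudomonoid.toMonoidalFunctor B))
    (StrictPseudofunctor.id (Pseudofunctor B MonoidalCat.{v, u})) :=
  twoNatIsoMk ofFibres toFibres ofFibres_toFibres toFibres_ofFibres ofFibres_naturality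
    ofFibres_naturality₂

end MonoidalCat

/-! ### The equivalence of 2-categories. -/

/-- Pseudomonoids in pseudofunctors to categories are equivalent to pseudofunctors to monoidal
categories. -/
def pseudomonoidEquivalence (B : Type u₁) [Bicategory.{w, v₁} B] :
    TwoEquivalence (Pseudomonoid (Pseudofunctor B Cat.{v, u}))
      (Pseudofunctor B MonoidalCat.{v, u}) where
  functor := Pseudomonoid.toMonoidalFunctor B
  inverse := MonoidalCat.toPseudomonoidFunctor B
  unitIso := Pseudomonoid.unitTwoNatIso B
  counitIso := MonoidalCat.counitTwoNatIso B

end IndexedMonoidal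

theorem mainTheorem8 (X : Type u₁) [Category.{v₁} X] :
    Bicategory.Strict (IndexedMonoidal.Pseudomonoid (IndexedMonoidal.IndexedCat.{v, u} X)) ∧
    Bicategory.Strict (Pseudofunctor (LocallyDiscrete Xᵒᵖ) IndexedMonoidal.MonoidalCat.{v, u}) ∧
    Nonempty (IndexedMonoidal.TwoEquivalence
      (IndexedMonoidal.Pseudomonoid (IndexedMonoidal.IndexedCat.{v, u} X))
      (Pseudofunctor (LocallyDiscrete Xᵒᵖ) IndexedMonoidal.MonoidalCat.{v, u})) :=
  -- The base `B` is specialised to `Xᵒᵖ`, seen as a bicategory with only identity 2-cells.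
  ⟨IndexedMonoidal.Pseudomonoid.strict, IndexedMonoidal.MonoidalCat.strict,
    ⟨IndexedMonoidal.pseudomonoidEquivalence (LocallyDiscrete Xᵒᵖ)⟩⟩
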